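/- Let $k\ge 1$ be an integer and let $G$ be a finite simple graph with $n\ge 1$ vertices, maximum degree $\Delta$ and degeneracy $\delta$, given by adjacency lists together with a unit-cost adjacency test. A vertex set is a $k$-defective clique if it contains at most $k$ pairs of distinct non-adjacent vertices. For vertices $v$ and sets $A$, let $\overline d_A(v)$ be the number of non-neighbours of $v$ in $A$ (a vertex is not a non-neighbour of itself). Consider the following algorithm BBRes on a unit-cost random access machine. It maintains the largest $k$-defective clique $g^*$ found so far (initially empty) and uses a recursive procedure Rec$(S,C)$ on branches, i.e. disjoint vertex sets $S,C$ such that $S$ is a $k$-defective clique: (a) compute an upper bound on the size of every $k$-defective clique $T$ with $S\subseteq T\subseteq S\cup C$, and return if it is at most $|g^*|$; (b) delete from $C$ every vertex $v$ for which $S\cup\{v\}$ is not a $k$-defective clique, and then apply further reduction rules, which may delete vertices of $C$ but do not decrease the maximum size of a $k$-defective clique $T$ with $S\subseteq T\subseteq S\cup C$ if that maximum exceeds $|g^*|$; (c) early termination: if $S\cup C$ is a $k$-defective clique, or $\overline d_C(v)\le 2$ for all $v\in C$, call IRSolver$(S,C)$, update $g^*$ if the result is larger, and return; (d) otherwise choose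 by BS-three a pivot $p\in C$ with $\overline d_C(p)\ge 3$ and $\overline d_S(p)\ge 1$ if there is one, and any $p\in C$ with $\overline d_C(p)\ge3$ if not; run Rec$(S\cup\{p\},C\setminus\{p\})$ and then Rec$(S,C\setminus\{p\})$. IRSolver returns $S\cup C$ if this is a $k$-defective clique. Otherwise it repeatedly lets $\Gamma$ be the set of $v\in C$ with minimum $\overline d_S(v)$, picks $v^*\in\Gamma$ minimizing $\overline d_C(v)$ if that minimum is at most $1$, and minimizing $\overline d_\Gamma(v)$ otherwise, and moves $v^*$ from $C$ to $S$, until this would make $S$ stop being a $k$-defective clique; then it returns $S$. BBRes computes a degeneracy ordering $v_1,\dots,v_n$ by peeling off vertices of minimum degree; in Stage I it runs Rec$(\{v_i\},C_i)$ for $i=1,\dots,n$, where $C_i$ is the set of vertices $v_j$, $j>i$, at distance one or two from $v_i$ in $G$; and if then $|g^*|<k+1$, in Stage II it runs Rec$(\emptyset,V)$. All ties are broken arbitrarily. The upper bounds and the further reduction rules may be any procedures with the stated properties that run in $O((|S|+|C|+1)^2)$ steps on each branch. Let $\lambda_k$ be the largest real root of $x^{k+4}-2x^{k+3}+x^3-x+1=0$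 and $\gamma_k$ the largest real root of $x^{k+3}-2x^{k+2}+x^2-x+1=0$. Then: 1. If the maximum $k$-defective clique of $G$ has at least $k+2$ vertices, BBRes runs in $O\big(n(\Delta\delta)^2\lambda_k^{\Delta\delta}\big)$ steps; otherwise it runs in $O\big(n^2\lambda_k^{n}\big)$ steps. The implied constants depend only on the constant in the quadratic bound for the upper-bound and reduction procedures, not on $G$, $k$ or the ways in which ties are broken. 2. For all $k\ge1$, the largest real roots $\lambda_k$ and $\gamma_k$ exist, $\lambda_k<\gamma_k$, $\lambda_k<\lambda_{k+1}$ and $\gamma_k<\gamma_{k+1}$; moreover $\lambda_k\to 2$ and $\gamma_k\to2$ as $k\to\infty$. -/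

import Mathlib

open Filter Topology Polynomial

namespace Defective

/-! ### Graph notions -/

/-- The number of non-edges of `G` inside the vertex set `T`: unordered pairs of distinct
vertices of `T` that are not adjacent. -/
def nonEdges {n : ℕ} (G : SimpleGraph (Fin n)) [DecidableRel G.Adj] (T : Finset (Fin n)) : ℕ :=
  (T.sym2.filter (fun e => e ∈ Gᶜ.edgeSet)).card

/-- `T` induces a `k`-defective clique. -/
def IsDefective {n : ℕ} (G : SimpleGraph (Fin n)) [DecidableRel G.Adj] (k : ℕ)
    (T : Finset (Fin n)) : Prop :=
  nonEdges G T ≤ k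

instance {n : ℕ} (G : SimpleGraph (Fin n)) [DecidableRel G.Adj] (k : ℕ) :
    DecidablePred (IsDefective G k) :=
  fun T => inferInstanceAs (Decidable (nonEdges G T ≤ k))

/-- The number of vertices of a maximum `k`-defective clique of `G`. -/
def defectiveNumber {n : ℕ} (G : SimpleGraph (Fin n)) [DecidableRel G.Adj] (k : ℕ) : ℕ :=
  ((Finset.univ : Finset (Finset (Fin n))).filter (IsDefective G k)).sup Finset.card

/-- The degeneracy of `G`: the least `d` such that every nonempty induced subgraph has a vertex
of degree at most `d`. -/
noncomputable def degeneracy {n : ℕ} (G : SimpleGraph (Fin n)) [DecidableRel G.Adj] : ℕ :=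
  sInf {d : ℕ | ∀ T : Finset (Fin n), T.Nonempty →
    ∃ v ∈ T, (T.filter (fun w => G.Adj v w)).card ≤ d}

/-- `nb` is an adjacency-list representation of `G`: `nb v` lists the neighbours of `v`,
each of them once, in any order. -/
def IsAdjLists {n : ℕ} (G : SimpleGraph (Fin n)) (nb : Fin n → List (Fin n)) : Prop :=
  ∀ v, (nb v).Nodup ∧ ∀ w, w ∈ nb v ↔ G.Adj v w

/-! ### Step-counting programs

The machine is a unit-cost random access machine on vertices and natural numbers. The graph is
stored as adjacency lists, and adjacency of two given vertices is tested in one step. Arrays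
indexed by vertices (or by numbers up to `n`) are functions; reading or writing one entry is one
step. One counted step stands for a bounded number of such operations. -/

/-- A result together with the number of steps spent on it. -/
structure Timed (α : Type) where
  val : α
  steps : ℕ

instance : Monad Timed where
  pure a := ⟨a, 0⟩
  bind x f := ⟨(f x.val).val, x.steps + (f x.val).steps⟩

/-- Spend `c` steps. -/
def charge (c : ℕ) : Timed Unit := ⟨(), c⟩

/-- The length of a list. -/
def lengthT {α : Type} : List α → Timed ℕ
  | [] => do
    charge 1
    return 0
  | _ :: L => do
    charge 1
    let c ← lengthT L
    return c + 1

/-- Concatenation of lists. -/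
def appendT {α : Type} (L L' : List α) : Timed (List α) := do
  charge (L.length + 1)
  return L ++ L'

/-- Keep the entries that pass the test `p`. -/
def filterT {α : Type} (p : α → Timed Bool) : List α → Timed (List α)
  | [] => do
    charge 1
    return []
  | x :: L => do
    charge 1
    let b ← p x
    let L' ← filterT p L
    return if b then x :: L' else L'

/-- Remove (the first occurrence of) one entry. -/
def eraseT {α : Type} [DecidableEq α] (x : α) (L : List α) : Timed (List α) := do
  charge (L.length + 1)
  return L.erase x

/-- The least value of `f` on a list, with the list of all entries that attain it
(`(0, [])` for the empty list). -/
def argminT {α : Type} (f : α → Timed ℕ) : List α → Timed (ℕ × List α)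
  | [] => do
    charge 1
    return (0, [])
  | x :: L => do
    charge 1
    let a ← f x
    let r ← argminT f L
    return if r.2.isEmpty || decide (a < r.1) then (a, [x])
      else if a = r.1 then (r.1, x :: r.2) else r

/-- Take an entry of a list, the one that the selector `i` points to (`none` only for the empty
list). As `i` ranges over all numbers, every entry is possible. -/
def chooseT {α : Type} (i : ℕ) (L : List α) : Timed (Option α) := do
  charge (L.length + 1)
  return L[i % L.length]?

/-- The number of non-neighbours of `v` in a list of vertices. -/
def nonDegT {n : ℕ} (G : SimpleGraph (Fin n)) [DecidableRel G.Adj] (v : Fin n) :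
    List (Fin n) → Timed ℕ
  | [] => do
    charge 1
    return 0
  | w :: L => do
    charge 1
    let c ← nonDegT G v L
    return if v ≠ w ∧ ¬ G.Adj v w then c + 1 else c

/-- The number of non-edges inside a list of vertices. -/
def nonEdgesT {n : ℕ} (G : SimpleGraph (Fin n)) [DecidableRel G.Adj] :
    List (Fin n) → Timed ℕ
  | [] => do
    charge 1
    return 0
  | v :: L => do
    charge 1
    let d ← nonDegT G v L
    let c ← nonEdgesT G L
    return d + c

/-! ### The degeneracy ordering, by peeling off vertices of minimum degree -/

/-- Compute all degrees, and put every vertex into the bucket of its degree. -/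
def fillBuckets {n : ℕ} (nb : Fin n → List (Fin n)) :
    List (Fin n) → (Fin n → ℕ) → (ℕ → List (Fin n)) →
      Timed ((Fin n → ℕ) × (ℕ → List (Fin n)))
  | [], deg, bucket => do
    charge 1
    return (deg, bucket)
  | v :: L, deg, bucket => do
    charge 1
    let d ← lengthT (nb v)
    fillBuckets nb L (Function.update deg v d) (Function.update bucket d (v :: bucket d))

/-- Lower by one the degrees of those vertices of a list that are still present, and file each of
them under its new degree. The old entry stays where it is and is skipped later. -/
def lowerDegrees {n : ℕ} (gone : Fin n → Bool) :
    List (Fin n) → (Fin n → ℕ) → (ℕ → List (Fin n)) →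
      Timed ((Fin n → ℕ) × (ℕ → List (Fin n)))
  | [], deg, bucket => do
    charge 1
    return (deg, bucket)
  | u :: L, deg, bucket => do
    charge 1
    if gone u then
      lowerDegrees gone L deg bucket
    else
      let d := deg u - 1
      lowerDegrees gone L (Function.update deg u d) (Function.update bucket d (u :: bucket d))

/-- The peeling loop. `left` vertices are still present, and none of them has a degree below `d`.
The first argument bounds the number of rounds; `(n + 2) ^ 2` is never exhausted. -/
def peel {n : ℕ} (nb : Fin n → List (Fin n)) :
    ℕ → ℕ → ℕ → (Fin n → ℕ) → (Fin n → Bool) → (ℕ → List (Fin n)) → Timed (List (Fin n))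
  | 0, _, _, _, _, _ => return []
  | fuel + 1, left, d, deg, gone, bucket => do
    charge 1
    if left = 0 then
      return []
    else
      match bucket d with
      | [] => peel nb fuel left (d + 1) deg gone bucket
      | v :: rest =>
        let bucket' := Function.update bucket d rest
        if gone v || decide (deg v ≠ d) then
          peel nb fuel left d deg gone bucket'
        else do
          let gone' := Function.update gone v true
          let r ← lowerDegrees gone' (nb v) deg bucket'
          let order ← peel nb fuel (left - 1) (d - 1) r.1 gone' r.2
          return v :: order

/-- A degeneracy ordering of the vertices: each vertex has minimum degree in the subgraph induced
by itself and the later vertices. -/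
def degeneracyOrder {n : ℕ} (nb : Fin n → List (Fin n)) : Timed (List (Fin n)) := do
  charge (n + 1)
  let r ← fillBuckets nb (List.finRange n) (fun _ => 0) (fun _ => [])
  peel nb ((n + 2) ^ 2) n 0 r.1 (fun _ => false) r.2

/-! ### `IRSolver` -/

/-- For all `v` in a list, write into arrays the number of non-neighbours of `v` in `S` and the
list of the non-neighbours of `v` in `C`. -/
def irTables {n : ℕ} (G : SimpleGraph (Fin n)) [DecidableRel G.Adj] (S C : List (Fin n)) :
    List (Fin n) → (Fin n → ℕ) → (Fin n → List (Fin n)) →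
      Timed ((Fin n → ℕ) × (Fin n → List (Fin n)))
  | [], dS, nn => do
    charge 1
    return (dS, nn)
  | v :: L, dS, nn => do
    charge 1
    let d ← nonDegT G v S
    let l ← filterT (fun w => (⟨decide (v ≠ w ∧ ¬ G.Adj v w), 1⟩ : Timed Bool)) C
    irTables G S C L (Function.update dS v d) (Function.update nn v l)

/-- After `x` moved from the candidates into the solution: raise `dS w` for all non-neighbours
`w` of `x` in a list. -/
def raiseT {n : ℕ} : List (Fin n) → (Fin n → ℕ) → Timed (Fin n → ℕ)
  | [], dS => do
    charge 1
    return dS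
  | w :: L, dS => do
    charge 1
    raiseT L (Function.update dS w (dS w + 1))

/-- After `x` moved from the candidates into the solution: delete `x` from the lists of
non-neighbours of all `w` in a list. -/
def dropT {n : ℕ} (x : Fin n) :
    List (Fin n) → (Fin n → List (Fin n)) → Timed (Fin n → List (Fin n))
  | [], nn => do
    charge 1
    return nn
  | w :: L, nn => do
    charge 1
    let l ← eraseT x (nn w)
    dropT x L (Function.update nn w l)

/-- The rounds of `IRSolver`. The partial solution is `S` with `e` non-edges, the remaining
candidates are `C`; for `v` in `C`, `dS v` is the number of non-neighbours of `v` in `S`, and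
`nn v` lists the non-neighbours of `v` in `C`. Ties are broken by the selector `sel`. The first
argument bounds the number of rounds. -/
def irLoop {n : ℕ} (k : ℕ) (sel : List (Fin n) → List (Fin n) → ℕ) :
    ℕ → List (Fin n) → List (Fin n) → (Fin n → ℕ) → (Fin n → List (Fin n)) → ℕ →
      Timed (List (Fin n))
  | 0, S, _, _, _, _ => return S
  | fuel + 1, S, C, dS, nn, e => do
    charge 1
    -- the least number of non-neighbours in `S`, and the candidates that attain it
    let mΓ ← argminT (fun v => (⟨dS v, 1⟩ : Timed ℕ)) C
    -- among these, the least number of non-neighbours in `C`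
    let r ← argminT (fun v => lengthT (nn v)) mΓ.2
    let cands ←
      if r.1 ≤ 1 then pure r.2
      else do
        -- the least number of non-neighbours among the minimizers of the first line
        let r' ← argminT (fun v => do
          let l ← filterT (fun w => (⟨decide (dS w = mΓ.1), 1⟩ : Timed Bool)) (nn v)
          lengthT l) mΓ.2
        pure r'.2
    let x? ← chooseT (sel S C) cands
    match x? with
    | none => return S
    | some x =>
      if k < e + dS x then
        return S
      else do
        let C' ← eraseT x C
        let dS' ← raiseT (nn x) dS
        let nn' ← dropT x (nn x) nn
        irLoop k sel fuel (x :: S) C' dS' nn' (e + dS x)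

/-- `IRSolver` on the branch `(S, C)`. An array entry is written before it is read, so the
initial contents of the arrays do not matter. -/
def irSolver {n : ℕ} (G : SimpleGraph (Fin n)) [DecidableRel G.Adj] (k : ℕ)
    (sel : List (Fin n) → List (Fin n) → ℕ) (S C : List (Fin n)) : Timed (List (Fin n)) := do
  let g ← appendT S C
  let e ← nonEdgesT G g
  if e ≤ k then
    return g
  else do
    let eS ← nonEdgesT G S
    let t ← irTables G S C C (fun _ => 0) (fun _ => [])
    irLoop k sel (C.length + 1) S C t.1 t.2 eS

/-! ### `BBRes` -/

/-- The auxiliary pruning procedures of the branch-and-bound search: `bound S C` computes an upper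
bound of the branch `(S, C)`; `keep S C b` decides which candidates the reduction rules retain
when the best solution so far has `b` vertices. -/
structure Pruning (n : ℕ) where
  bound : List (Fin n) → List (Fin n) → Timed ℕ
  keep : List (Fin n) → List (Fin n) → ℕ → Timed (Fin n → Bool)

/-- `(S, C)` is a branch: disjoint vertex sets, and `S` induces a `k`-defective clique. -/
def IsBranch {n : ℕ} (G : SimpleGraph (Fin n)) [DecidableRel G.Adj] (k : ℕ)
    (S C : List (Fin n)) : Prop :=
  (S ++ C).Nodup ∧ IsDefective G k S.toFinset

/-- `T` is a solution of the branch `(S, C)`: a `k`-defective clique between `S` and `S ∪ C`. -/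
def IsSolution {n : ℕ} (G : SimpleGraph (Fin n)) [DecidableRel G.Adj] (k : ℕ)
    (S C : List (Fin n)) (T : Finset (Fin n)) : Prop :=
  IsDefective G k T ∧ S.toFinset ⊆ T ∧ T ⊆ (S ++ C).toFinset

/-- The pruning procedures do what their names say (the upper bound is one, and reductions do not
lose the solutions that improve on the best one so far), in time quadratic in the size of the
branch, with constant `M`. -/
structure Pruning.Admissible {n : ℕ} (P : Pruning n) (G : SimpleGraph (Fin n))
    [DecidableRel G.Adj] (k M : ℕ) : Prop where
  bound_valid : ∀ S C T, IsBranch G k S C → IsSolution G k S C T → T.card ≤ (P.bound S C).val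
  keep_valid : ∀ S C b T, IsBranch G k S C → IsSolution G k S C T → b < T.card →
    ∃ T', IsSolution G k S (C.filter (P.keep S C b).val) T' ∧ T.card ≤ T'.card
  bound_steps : ∀ S C, IsBranch G k S C →
    (P.bound S C).steps ≤ M * (S.length + C.length + 1) ^ 2
  keep_steps : ∀ S C b, IsBranch G k S C →
    (P.keep S C b).steps ≤ M * (S.length + C.length + 1) ^ 2

/-- The recursive procedure of `BBRes` on the branch `(S, C)`, where `best` is the best solution
so far; it returns the best solution afterwards. Pivots are chosen by the rule BS-three, with ties
broken by the selector `piv`. The first argument bounds the depth of the recursion; the candidate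
set shrinks in every call, so that its length plus one is never exhausted. -/
def bbRec {n : ℕ} (G : SimpleGraph (Fin n)) [DecidableRel G.Adj] (k : ℕ) (P : Pruning n)
    (piv sel : List (Fin n) → List (Fin n) → ℕ) :
    ℕ → List (Fin n) → List (Fin n) → List (Fin n) → Timed (List (Fin n))
  | 0, _, _, best => return best
  | fuel + 1, S, C, best => do
    charge 1
    let b ← lengthT best
    let ub ← P.bound S C
    if ub ≤ b then
      return best
    else do
      -- reductions: drop the candidates that cannot be added to `S`, then apply the other rules
      let eS ← nonEdgesT G S
      let C₁ ← filterT (fun v => do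
        let d ← nonDegT G v S
        return decide (eS + d ≤ k)) C
      let keep ← P.keep S C₁ b
      let C₂ ← filterT (fun v => (⟨keep v, 1⟩ : Timed Bool)) C₁
      -- early termination
      let g ← appendT S C₂
      let e ← nonEdgesT G g
      let three ← filterT (fun v => do
        let d ← nonDegT G v C₂
        return decide (3 ≤ d)) C₂
      if e ≤ k ∨ three = [] then do
        let gopt ← irSolver G k sel S C₂
        let l ← lengthT gopt
        return if b < l then gopt else best
      else do
        -- branching by BS-three
        let threeS ← filterT (fun v => do
          let d ← nonDegT G v S
          return decide (1 ≤ d)) three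
        let p? ← chooseT (piv S C₂) (if threeS = [] then three else threeS)
        match p? with
        | none => return best
        | some p => do
          let C₃ ← eraseT p C₂
          let best₁ ← bbRec G k P piv sel fuel (p :: S) C₃ best
          bbRec G k P piv sel fuel S C₃ best₁

/-- Append to `acc` those entries of a list that are different from `v`, have not been processed,
and were not met before in the search from `v` (which `mark` records). -/
def addNew {n : ℕ} (v : Fin n) (done : Fin n → Bool) :
    List (Fin n) → (Fin n → Option (Fin n)) → List (Fin n) →
      Timed ((Fin n → Option (Fin n)) × List (Fin n))
  | [], mark, acc => do
    charge 1
    return (mark, acc)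
  | u :: L, mark, acc => do
    charge 1
    if u = v ∨ done u = true ∨ mark u = some v then
      addNew v done L mark acc
    else
      addNew v done L (Function.update mark u (some v)) (u :: acc)

/-- Apply `addNew` to the adjacency lists of all vertices of a list. -/
def addNbrs {n : ℕ} (nb : Fin n → List (Fin n)) (v : Fin n) (done : Fin n → Bool) :
    List (Fin n) → (Fin n → Option (Fin n)) → List (Fin n) →
      Timed ((Fin n → Option (Fin n)) × List (Fin n))
  | [], mark, acc => do
    charge 1
    return (mark, acc)
  | u :: L, mark, acc => do
    charge 1
    let r ← addNew v done (nb u) mark acc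
    addNbrs nb v done L r.1 r.2

/-- Stage I: run through the degeneracy ordering; for each vertex `v` solve the branch that
consists of `v` and of the vertices after `v` at distance one or two from `v`. -/
def stageOne {n : ℕ} (G : SimpleGraph (Fin n)) [DecidableRel G.Adj] (k : ℕ) (P : Pruning n)
    (piv sel : List (Fin n) → List (Fin n) → ℕ) (nb : Fin n → List (Fin n)) :
    List (Fin n) → (Fin n → Bool) → (Fin n → Option (Fin n)) → List (Fin n) →
      Timed (List (Fin n))
  | [], _, _, best => do
    charge 1
    return best
  | v :: order, done, mark, best => do
    charge 1
    let r₁ ← addNew v done (nb v) mark []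
    let r₂ ← addNbrs nb v done (nb v) r₁.1 r₁.2
    let best' ← bbRec G k P piv sel (r₂.2.length + 1) [v] r₂.2 best
    stageOne G k P piv sel nb order (Function.update done v true) r₂.1 best'

/-- The algorithm `BBRes`. -/
def bbRes {n : ℕ} (G : SimpleGraph (Fin n)) [DecidableRel G.Adj] (k : ℕ) (P : Pruning n)
    (piv sel : List (Fin n) → List (Fin n) → ℕ) (nb : Fin n → List (Fin n)) :
    Timed (List (Fin n)) := do
  let order ← degeneracyOrder nb
  charge (n + 1)
  let best ← stageOne G k P piv sel nb order (fun _ => false) (fun _ => none) []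
  let b ← lengthT best
  if b < k + 1 then do
    charge (n + 1)
    bbRec G k P piv sel (n + 1) [] (List.finRange n) best
  else
    return best

/-! ### The bases of the exponentials -/

/-- The largest real root of a real polynomial. -/
noncomputable def largestRoot (p : ℝ[X]) : ℝ := sSup {x : ℝ | p.IsRoot x}

/-- The polynomial `x ^ (k + 4) - 2 x ^ (k + 3) + x ^ 3 - x + 1`. -/
noncomputable def lamPoly (k : ℕ) : ℝ[X] :=
  X ^ (k + 4) - 2 * X ^ (k + 3) + X ^ 3 - X + 1

/-- The polynomial `x ^ (k + 3) - 2 x ^ (k + 2) + x ^ 2 - x + 1`. -/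
noncomputable def gamPoly (k : ℕ) : ℝ[X] :=
  X ^ (k + 3) - 2 * X ^ (k + 2) + X ^ 2 - X + 1

/-- The number `λ_k`. -/
noncomputable def lam (k : ℕ) : ℝ := largestRoot (lamPoly k)

/-- The number `γ_k`. -/
noncomputable def gam (k : ℕ) : ℝ := largestRoot (gamPoly k)

end Defective

/-!
Why the theorem is true.

*Correctness of the search.* If there is a `k`-defective clique with at least `k + 2` vertices, the
bound has no room for Stage II, so Stage I has to find `k + 1` vertices. A clique `T` of that kind
has diameter at most two (`near_of_isDefective`), hence it lies in the branch of its first vertex in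
the ordering, and `bbRec` solves that branch to optimality (`bbRec_spec`). This rests on the
optimality of `IRSolver` when every candidate has at most two non-neighbours among the candidates
(`irSolver_spec`), which follows from an exchange argument: some best solution contains the greedily
chosen vertex `x` (`exists_solution_of_isGreedyChoice`). The only case in which no single exchange
works is that the cheapest candidates form cycles of the complement. Then one walks along the cycle
of `x`, whose vertices should alternate between the outside and the inside of the solution. If the
alternation fails somewhere, the failure can be moved to `x` by free exchanges
(`exists_swap_of_alternating_path`); if not, the two halves of the cycle can be exchanged for each
other (`exists_swap_of_two_regular`).

*Running time.* One call of `bbRec` is quadratic in the size of its branch (`bbRec_step`), so it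
remains to count calls. The bases `λ_k` are above `4 / 3` and so close to `2` that crude counts are
enough. Among `m` candidates there are at most `2 ^ (m + 1)` calls, and roughly `m ^ r` if only `r`
more vertices can be included (`isTreeBound_two_pow`, `isTreeBound_card`).

If all `k`-defective cliques have at most `k + 1` vertices, the second count is quasi-polynomial in
`m` as soon as `m > (4 / 3) ^ k`, and for `m ≤ (4 / 3) ^ k` the ratio `(2 / λ_k) ^ m` is bounded,
because `2 - λ_k` is at most `8 * (3 / 4) ^ k`. So there are `O(λ_k ^ m)` calls (`exists_nodes_le`),
and the branches of Stage I add up to a geometric series.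

If there is a larger one, with `Δ` and `δ` the maximum degree and the degeneracy, then `k < 2δ`
(`lt_two_mul_degeneracy`). In the branch of a vertex `v`, at most `δ` candidates are neighbours of
`v`, and each other one costs one of the `k` non-edges when it is included. Hence there are at most
`2 ^ (δ + 1) * (Δ ^ 2 + Δ + 1) ^ (k + 1)` calls (`isTreeBound_adj`), which is a polynomial in `Δ`
raised to the power `δ`, and so `O((4 / 3) ^ (Δδ))` (`exists_poly_pow_le`).

The degeneracy ordering is computed in time linear in the size of the graph (`peel_spec`), by means
of a potential function.
-/

namespace Defective

/-! ### The numbers `λ_k` and `γ_k` -/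

theorem lamPoly_eval (k : ℕ) (x : ℝ) :
    (lamPoly k).eval x = x ^ (k + 3) * (x - 2) + (x ^ 3 - x + 1) := by
  simp [lamPoly]; ring

theorem gamPoly_eval (k : ℕ) (x : ℝ) :
    (gamPoly k).eval x = x ^ (k + 2) * (x - 2) + (x ^ 2 - x + 1) := by
  simp [gamPoly]; ring

theorem isGreatest_largestRoot {p : ℝ[X]} (hp : p ≠ 0) {x : ℝ} (hx : p.IsRoot x) :
    IsGreatest {x : ℝ | p.IsRoot x} (largestRoot p) := by
  have hfin : {x : ℝ | p.IsRoot x}.Finite := Polynomial.finite_setOfPred_isRoot hp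
  exact ⟨Set.Nonempty.csSup_mem ⟨x, hx⟩ hfin, fun y hy => le_csSup hfin.bddAbove hy⟩

theorem lam_isGreatest (k : ℕ) : IsGreatest {x : ℝ | (lamPoly k).IsRoot x} (lam k) := by
  refine isGreatest_largestRoot (x := 1) (fun h => ?_) (by simp [IsRoot, lamPoly_eval]; norm_num)
  have := lamPoly_eval k 2
  rw [h] at this
  norm_num at this

theorem gam_isGreatest (k : ℕ) : IsGreatest {x : ℝ | (gamPoly k).IsRoot x} (gam k) := by
  refine isGreatest_largestRoot (x := 1) (fun h => ?_) (by simp [IsRoot, gamPoly_eval]; norm_num)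
  have := gamPoly_eval k 2
  rw [h] at this
  norm_num at this

/-- A sign change to the right of `x` puts the largest root to the right of `x`. -/
theorem lt_of_isGreatest_root {p : ℝ[X]} {r x : ℝ} (hr : IsGreatest {x : ℝ | p.IsRoot x} r)
    (hx : x ≤ 2) (hneg : p.eval x < 0) (hpos : 0 ≤ p.eval 2) : x < r := by
  obtain ⟨y, hy, hy0⟩ := intermediate_value_Icc hx p.continuous.continuousOn ⟨hneg.le, hpos⟩
  have hle : y ≤ r := hr.2 hy0
  rcases hy.1.lt_or_eq with h | h
  · exact h.trans_le hle
  · subst h; simp [hy0] at hneg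

theorem lam_lt_two (k : ℕ) : lam k < 2 := by
  by_contra! h
  have h0 : (lamPoly k).eval (lam k) = 0 := (lam_isGreatest k).1
  rw [lamPoly_eval] at h0
  have h1 : 0 ≤ lam k ^ (k + 3) * (lam k - 2) := mul_nonneg (by positivity) (by linarith)
  nlinarith [sq_nonneg (lam k), mul_nonneg (by linarith : 0 ≤ lam k) (sq_nonneg (lam k - 1))]

theorem gam_lt_two (k : ℕ) : gam k < 2 := by
  by_contra! h
  have h0 : (gamPoly k).eval (gam k) = 0 := (gam_isGreatest k).1
  rw [gamPoly_eval] at h0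
  have h1 : 0 ≤ gam k ^ (k + 2) * (gam k - 2) := mul_nonneg (by positivity) (by linarith)
  nlinarith

theorem four_thirds_lt_lam {k : ℕ} (hk : 1 ≤ k) : 4 / 3 < lam k := by
  refine lt_of_isGreatest_root (lam_isGreatest k) (by norm_num) ?_ ?_
  · rw [lamPoly_eval]
    have : ((4 : ℝ) / 3) ^ 4 ≤ (4 / 3) ^ (k + 3) := pow_le_pow_right₀ (by norm_num) (by omega)
    norm_num at this ⊢
    linarith
  · rw [lamPoly_eval]; norm_num

/-- `x * gamPoly k x = lamPoly k x - (x - 1) ^ 2`. -/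
theorem lam_lt_gam {k : ℕ} (hk : 1 ≤ k) : lam k < gam k := by
  have h1 := four_thirds_lt_lam hk
  have h0 : (lamPoly k).eval (lam k) = 0 := (lam_isGreatest k).1
  refine lt_of_isGreatest_root (gam_isGreatest k) (lam_lt_two k).le ?_
    (by rw [gamPoly_eval]; norm_num)
  rw [lamPoly_eval] at h0
  rw [gamPoly_eval]
  have h2 : lam k * (lam k ^ (k + 2) * (lam k - 2) + (lam k ^ 2 - lam k + 1))
      = - (lam k - 1) ^ 2 := by
    rw [pow_succ (lam k) (k + 2)] at h0
    linear_combination h0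
  have h3 : 0 < (lam k - 1) ^ 2 := pow_pos (by linarith) 2
  by_contra! h
  have := mul_nonneg (by linarith : 0 ≤ lam k) h
  linarith

/-- `lamPoly (k + 1) x = x * lamPoly k x - (x - 1) * (x ^ 3 - x + 1)`. -/
theorem lam_lt_succ {k : ℕ} (hk : 1 ≤ k) : lam k < lam (k + 1) := by
  have h1 := four_thirds_lt_lam hk
  have h0 : (lamPoly k).eval (lam k) = 0 := (lam_isGreatest k).1
  refine lt_of_isGreatest_root (lam_isGreatest (k + 1)) (lam_lt_two k).le ?_
    (by rw [lamPoly_eval]; norm_num)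
  rw [lamPoly_eval] at h0 ⊢
  have h2 : lam k ^ (k + 1 + 3) * (lam k - 2) + (lam k ^ 3 - lam k + 1)
      = - ((lam k - 1) * (lam k ^ 3 - lam k + 1)) := by
    rw [show k + 1 + 3 = k + 3 + 1 by ring, pow_succ (lam k) (k + 3)]
    linear_combination lam k * h0
  have h3 : 0 < (lam k - 1) * (lam k ^ 3 - lam k + 1) := by
    refine mul_pos (by linarith) ?_
    nlinarith [mul_pos (by linarith : 0 < lam k) (by nlinarith : 0 < lam k ^ 2 - 1)]
  linarith

/-- `gamPoly (k + 1) x = x * gamPoly k x - (x - 1) * (x ^ 2 - x + 1)`. -/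
theorem gam_lt_succ {k : ℕ} (hk : 1 ≤ k) : gam k < gam (k + 1) := by
  have h1 := (four_thirds_lt_lam hk).trans (lam_lt_gam hk)
  have h0 : (gamPoly k).eval (gam k) = 0 := (gam_isGreatest k).1
  refine lt_of_isGreatest_root (gam_isGreatest (k + 1)) (gam_lt_two k).le ?_
    (by rw [gamPoly_eval]; norm_num)
  rw [gamPoly_eval] at h0 ⊢
  have h2 : gam k ^ (k + 1 + 2) * (gam k - 2) + (gam k ^ 2 - gam k + 1)
      = - ((gam k - 1) * (gam k ^ 2 - gam k + 1)) := by
    rw [show k + 1 + 2 = k + 2 + 1 by ring, pow_succ (gam k) (k + 2)]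
    linear_combination gam k * h0
  have h3 : 0 < (gam k - 1) * (gam k ^ 2 - gam k + 1) :=
    mul_pos (by linarith) (by nlinarith)
  linarith

/-- `λ_k` approaches `2` exponentially fast: from `λ ^ (k + 3) * (2 - λ) = λ ^ 3 - λ + 1 ≤ 8`. -/
theorem two_sub_lam_mul_le {k : ℕ} (hk : 1 ≤ k) : (2 - lam k) * (4 / 3) ^ k ≤ 8 := by
  have h1 := four_thirds_lt_lam hk
  have h2 := lam_lt_two k
  have h0 : (lamPoly k).eval (lam k) = 0 := (lam_isGreatest k).1
  rw [lamPoly_eval] at h0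
  have h3 : ((4 : ℝ) / 3) ^ k ≤ lam k ^ (k + 3) :=
    (pow_le_pow_right₀ (by norm_num) (by omega)).trans
      (pow_le_pow_left₀ (by norm_num) h1.le _)
  have h4 : (2 - lam k) * (4 / 3) ^ k ≤ (2 - lam k) * lam k ^ (k + 3) :=
    mul_le_mul_of_nonneg_left h3 (by linarith)
  have h5 : lam k ^ 3 ≤ 2 ^ 3 := pow_le_pow_left₀ (by linarith) h2.le 3
  have h6 : (2 - lam k) * lam k ^ (k + 3) = lam k ^ 3 - lam k + 1 := by linear_combination -h0
  linarith

theorem tendsto_lam : Tendsto lam atTop (𝓝 2) := by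
  have h : Tendsto (fun k : ℕ => (2 : ℝ) - 8 * (3 / 4) ^ k) atTop (𝓝 2) := by
    simpa using tendsto_const_nhds.sub
      ((tendsto_pow_atTop_nhds_zero_of_lt_one (by norm_num : (0 : ℝ) ≤ 3 / 4)
        (by norm_num)).const_mul (8 : ℝ))
  refine tendsto_of_tendsto_of_tendsto_of_le_of_le' h tendsto_const_nhds ?_
    (Eventually.of_forall fun k => (lam_lt_two k).le)
  filter_upwards [eventually_ge_atTop 1] with k hk
  have := two_sub_lam_mul_le hk
  have h1 : ((4 : ℝ) / 3) ^ k * (3 / 4) ^ k = 1 := by rw [← mul_pow]; norm_num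
  have h2 : (0 : ℝ) < (3 / 4) ^ k := by positivity
  nlinarith [mul_le_mul_of_nonneg_right this h2.le]

theorem tendsto_gam : Tendsto gam atTop (𝓝 2) := by
  refine tendsto_of_tendsto_of_tendsto_of_le_of_le' tendsto_lam tendsto_const_nhds ?_
    (Eventually.of_forall fun k => (gam_lt_two k).le)
  filter_upwards [eventually_ge_atTop 1] with k hk using (lam_lt_gam hk).le

/-! ### Values and costs of the elementary programs -/

namespace Timed

variable {α β : Type}

@[simp] theorem val_bind (x : Timed α) (f : α → Timed β) : (x >>= f).val = (f x.val).val := rfl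

@[simp] theorem steps_bind (x : Timed α) (f : α → Timed β) :
    (x >>= f).steps = x.steps + (f x.val).steps := rfl

@[simp] theorem val_pure (a : α) : (pure a : Timed α).val = a := rfl

@[simp] theorem steps_pure (a : α) : (pure a : Timed α).steps = 0 := rfl

@[simp] theorem val_ite (c : Prop) [Decidable c] (x y : Timed α) :
    (if c then x else y).val = if c then x.val else y.val := apply_ite _ _ _ _

@[simp] theorem steps_ite (c : Prop) [Decidable c] (x y : Timed α) :
    (if c then x else y).steps = if c then x.steps else y.steps := apply_ite _ _ _ _

end Timed

@[simp] theorem steps_charge (c : ℕ) : (charge c).steps = c := rfl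

@[simp] theorem lengthT_val {α : Type} (L : List α) : (lengthT L).val = L.length := by
  induction L with
  | nil => rfl
  | cons x L ih => simp [lengthT, ih]

@[simp] theorem lengthT_steps {α : Type} (L : List α) : (lengthT L).steps = L.length + 1 := by
  induction L with
  | nil => rfl
  | cons x L ih => simp [lengthT, ih]; omega

@[simp] theorem appendT_val {α : Type} (L L' : List α) : (appendT L L').val = L ++ L' := rfl

@[simp] theorem appendT_steps {α : Type} (L L' : List α) :
    (appendT L L').steps = L.length + 1 := rfl

@[simp] theorem eraseT_val {α : Type} [DecidableEq α] (x : α) (L : List α) :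
    (eraseT x L).val = L.erase x := rfl

@[simp] theorem eraseT_steps {α : Type} [DecidableEq α] (x : α) (L : List α) :
    (eraseT x L).steps = L.length + 1 := rfl

@[simp] theorem chooseT_val {α : Type} (i : ℕ) (L : List α) :
    (chooseT i L).val = L[i % L.length]? := rfl

@[simp] theorem chooseT_steps {α : Type} (i : ℕ) (L : List α) :
    (chooseT i L).steps = L.length + 1 := rfl

theorem exists_mem_choose {α : Type} (i : ℕ) {L : List α} (hL : L ≠ []) :
    ∃ x ∈ L, L[i % L.length]? = some x := by
  have h : i % L.length < L.length := Nat.mod_lt _ (List.length_pos_iff.2 hL)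
  exact ⟨L[i % L.length], List.getElem_mem h, List.getElem?_eq_getElem h⟩

@[simp] theorem filterT_val {α : Type} (p : α → Timed Bool) (L : List α) :
    (filterT p L).val = L.filter (fun x => (p x).val) := by
  induction L with
  | nil => rfl
  | cons x L ih => by_cases h : (p x).val <;> simp [filterT, ih, h]

theorem filterT_steps_le {α : Type} (p : α → Timed Bool) (L : List α) (c : ℕ)
    (h : ∀ x ∈ L, (p x).steps ≤ c) : (filterT p L).steps ≤ (c + 1) * L.length + 1 := by
  induction L with
  | nil => simp [filterT]
  | cons x L ih =>
    have h1 := ih fun y hy => h y (List.mem_cons_of_mem _ hy)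
    have h2 := h x List.mem_cons_self
    simp only [filterT, Timed.steps_bind, steps_charge, Timed.steps_pure, List.length_cons]
    nlinarith

theorem argminT_steps_le {α : Type} (f : α → Timed ℕ) (L : List α) (c : ℕ)
    (h : ∀ x ∈ L, (f x).steps ≤ c) : (argminT f L).steps ≤ (c + 1) * L.length + 1 := by
  induction L with
  | nil => simp [argminT]
  | cons x L ih =>
    have h1 := ih fun y hy => h y (List.mem_cons_of_mem _ hy)
    have h2 := h x List.mem_cons_self
    simp only [argminT, Timed.steps_bind, steps_charge, Timed.steps_pure, List.length_cons]
    nlinarith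

/-- The second component is empty only for the empty list, for which the first one is a junk
value. -/
theorem argminT_spec {α : Type} (f : α → Timed ℕ) (L : List α) :
    ((argminT f L).val.2 = [] ↔ L = []) ∧
      (∀ x ∈ L, (argminT f L).val.1 ≤ (f x).val) ∧
      (argminT f L).val.2 = L.filter (fun x => (f x).val = (argminT f L).val.1) := by
  induction L with
  | nil => simp [argminT]
  | cons x L ih =>
    obtain ⟨h1, h2, h3⟩ := ih
    simp only [argminT, Timed.val_bind, Timed.val_pure]
    split_ifs with hc hc'
    · simp only [Bool.or_eq_true, List.isEmpty_iff, decide_eq_true_eq] at hc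
      have hlt : ∀ y ∈ L, (f x).val < (f y).val := by
        intro y hy
        rcases hc with hc | hc
        · rw [h1.1 hc] at hy; simp at hy
        · exact hc.trans_le (h2 y hy)
      refine ⟨by simp, ?_, ?_⟩
      · intro y hy
        rcases List.mem_cons.1 hy with rfl | hy
        · exact le_rfl
        · exact (hlt y hy).le
      · rw [List.filter_cons_of_pos (by simp), eq_comm, List.cons.injEq]
        refine ⟨rfl, List.filter_eq_nil_iff.2 fun y hy => ?_⟩
        simpa using (hlt y hy).ne'
    · simp only [Bool.or_eq_true, List.isEmpty_iff, decide_eq_true_eq, not_or, not_lt] at hc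
      refine ⟨by simp, ?_, ?_⟩
      · intro y hy
        rcases List.mem_cons.1 hy with rfl | hy
        · exact hc.2
        · exact h2 y hy
      · rw [List.filter_cons_of_pos (by simpa using hc'), ← h3]
    · simp only [Bool.or_eq_true, List.isEmpty_iff, decide_eq_true_eq, not_or, not_lt] at hc
      refine ⟨by simp [hc.1], ?_, ?_⟩
      · intro y hy
        rcases List.mem_cons.1 hy with rfl | hy
        · exact hc.2
        · exact h2 y hy
      · rw [List.filter_cons_of_neg (by simpa using hc'), ← h3]

theorem mem_argminT {α : Type} {f : α → Timed ℕ} {L : List α} {x : α} :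
    x ∈ (argminT f L).val.2 ↔ x ∈ L ∧ (f x).val = (argminT f L).val.1 := by
  rw [(argminT_spec f L).2.2]
  simp

/-! ### Non-neighbours and non-edges -/

section

variable {n : ℕ} (G : SimpleGraph (Fin n)) [DecidableRel G.Adj]

/-- The number of non-neighbours of `v` in `A`; a vertex is not a non-neighbour of itself. -/
def nonDeg (A : Finset (Fin n)) (v : Fin n) : ℕ :=
  (A.filter fun w => v ≠ w ∧ ¬ G.Adj v w).card

theorem nonDeg_mono {A B : Finset (Fin n)} (h : A ⊆ B) (v : Fin n) :
    nonDeg G A v ≤ nonDeg G B v :=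
  Finset.card_le_card (Finset.filter_subset_filter _ h)

theorem nonDeg_union {A B : Finset (Fin n)} (h : Disjoint A B) (v : Fin n) :
    nonDeg G (A ∪ B) v = nonDeg G A v + nonDeg G B v := by
  rw [nonDeg, Finset.filter_union, Finset.card_union_of_disjoint
    (Finset.disjoint_filter_filter h)]
  rfl

theorem nonDeg_insert {A : Finset (Fin n)} {x : Fin n} (hx : x ∉ A) (v : Fin n) :
    nonDeg G (insert x A) v = nonDeg G A v + if v ≠ x ∧ ¬ G.Adj v x then 1 else 0 := by
  rw [nonDeg, Finset.filter_insert]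
  split_ifs with h
  · rw [Finset.card_insert_of_notMem (by simp [hx])]; rfl
  · rfl

theorem nonEdges_empty : nonEdges G ∅ = 0 := rfl

theorem nonEdges_insert {T : Finset (Fin n)} {v : Fin n} (hv : v ∉ T) :
    nonEdges G (insert v T) = nonEdges G T + nonDeg G T v := by
  have h : ((insert v T).sym2.filter (fun e => e ∈ Gᶜ.edgeSet)) =
      (T.sym2.filter (fun e => e ∈ Gᶜ.edgeSet)) ∪
        ((T.filter fun w => v ≠ w ∧ ¬ G.Adj v w).image fun w => s(v, w)) := by
    ext e
    induction e with | _ a b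
    simp only [Finset.mem_filter, Finset.mk_mem_sym2_iff, Finset.mem_insert,
      SimpleGraph.mem_edgeSet, SimpleGraph.compl_adj, Finset.mem_union, Finset.mem_image,
      Sym2.eq_iff]
    constructor
    · rintro ⟨⟨rfl | ha, rfl | hb⟩, hne, hadj⟩
      · exact absurd rfl hne
      · exact Or.inr ⟨b, ⟨hb, hne, hadj⟩, by simp⟩
      · exact Or.inr ⟨a, ⟨ha, hne.symm, fun h => hadj h.symm⟩, by simp⟩
      · exact Or.inl ⟨⟨ha, hb⟩, hne, hadj⟩
    · rintro (⟨⟨ha, hb⟩, hne, hadj⟩ | ⟨w, ⟨hw, hne, hadj⟩, ⟨rfl, rfl⟩ | ⟨rfl, rfl⟩⟩)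
      · exact ⟨⟨Or.inr ha, Or.inr hb⟩, hne, hadj⟩
      · exact ⟨⟨Or.inl rfl, Or.inr hw⟩, hne, hadj⟩
      · exact ⟨⟨Or.inr hw, Or.inl rfl⟩, hne.symm, fun h => hadj h.symm⟩
  rw [nonEdges, h, Finset.card_union_of_disjoint, Finset.card_image_of_injective]
  · rfl
  · intro a b hab
    exact Sym2.congr_right.1 hab
  · rw [Finset.disjoint_left]
    intro e he he'
    obtain ⟨w, -, rfl⟩ := Finset.mem_image.1 he'
    simp [hv] at he

theorem nonEdges_mono {A B : Finset (Fin n)} (h : A ⊆ B) : nonEdges G A ≤ nonEdges G B :=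
  Finset.card_le_card (Finset.filter_subset_filter _ (Finset.sym2_mono h))

@[simp] theorem nonDegT_val (v : Fin n) (L : List (Fin n)) :
    (nonDegT G v L).val = (L.filter fun w => v ≠ w ∧ ¬ G.Adj v w).length := by
  induction L with
  | nil => rfl
  | cons w L ih =>
    by_cases h : v ≠ w ∧ ¬ G.Adj v w
    · rw [List.filter_cons_of_pos (by simpa using h)]
      simp only [nonDegT, Timed.val_bind, if_pos h, ih]
      simp
    · rw [List.filter_cons_of_neg (by simpa using h)]
      simp only [nonDegT, Timed.val_bind, if_neg h, ih]
      simp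

theorem length_filter_nonAdj {L : List (Fin n)} (hL : L.Nodup) (v : Fin n) :
    (L.filter fun w => v ≠ w ∧ ¬ G.Adj v w).length = nonDeg G L.toFinset v := by
  rw [← List.toFinset_card_of_nodup (hL.filter _), List.toFinset_filter, nonDeg]
  simp

@[simp] theorem nonDegT_steps (v : Fin n) (L : List (Fin n)) :
    (nonDegT G v L).steps = L.length + 1 := by
  induction L with
  | nil => rfl
  | cons w L ih => simp [nonDegT, ih]; omega

theorem nonEdgesT_val {L : List (Fin n)} (hL : L.Nodup) :
    (nonEdgesT G L).val = nonEdges G L.toFinset := by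
  induction L with
  | nil => rfl
  | cons v L ih =>
    obtain ⟨h1, h2⟩ := List.nodup_cons.1 hL
    rw [List.toFinset_cons, nonEdges_insert G (by simpa using h1)]
    simp only [nonEdgesT, Timed.val_bind, Timed.val_pure, ih h2, nonDegT_val,
      length_filter_nonAdj G h2]
    omega

theorem nonEdgesT_steps_le (L : List (Fin n)) :
    (nonEdgesT G L).steps ≤ (L.length + 1) ^ 2 := by
  induction L with
  | nil => simp [nonEdgesT]
  | cons v L ih =>
    simp only [nonEdgesT, Timed.steps_bind, steps_charge, nonDegT_steps, Timed.steps_pure,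
      List.length_cons]
    nlinarith

end

/-! ### The exchange argument behind `IRSolver` -/

section

variable {n : ℕ} (G : SimpleGraph (Fin n)) [DecidableRel G.Adj]

theorem nonDeg_erase {A : Finset (Fin n)} {a v : Fin n} (ha : a ∈ A) (h : v ≠ a ∧ ¬ G.Adj v a) :
    nonDeg G (A.erase a) v + 1 = nonDeg G A v := by
  conv_rhs => rw [← Finset.insert_erase ha, nonDeg_insert G (Finset.notMem_erase a A), if_pos h]

theorem nonDeg_erase_self {A : Finset (Fin n)} {a : Fin n} (ha : a ∈ A) :
    nonDeg G (A.erase a) a = nonDeg G A a := by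
  conv_rhs => rw [← Finset.insert_erase ha, nonDeg_insert G (Finset.notMem_erase a A),
    if_neg (by simp), add_zero]

theorem nonDeg_pos {A : Finset (Fin n)} {a v : Fin n} (ha : a ∈ A) (h : v ≠ a ∧ ¬ G.Adj v a) :
    1 ≤ nonDeg G A v :=
  Finset.card_pos.2 ⟨a, Finset.mem_filter.2 ⟨ha, h⟩⟩

theorem nonEdges_union {A B : Finset (Fin n)} (h : Disjoint A B) :
    nonEdges G (A ∪ B) = nonEdges G A + ∑ v ∈ B, nonDeg G A v + nonEdges G B := by
  induction B using Finset.induction_on with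
  | empty => simp [nonEdges_empty]
  | insert v B hv ih =>
    rw [Finset.disjoint_insert_right] at h
    rw [Finset.union_insert, nonEdges_insert G (by simp [h.1, hv]), ih h.2,
      nonEdges_insert G hv, Finset.sum_insert hv, nonDeg_union G h.2]
    ring

/-- What it costs to add the vertices of `X` to a partial solution in which `v` has `w v`
non-neighbours. -/
def addCost (w : Fin n → ℕ) (X : Finset (Fin n)) : ℕ :=
  ∑ v ∈ X, w v + nonEdges G X

theorem addCost_swap (w : Fin n → ℕ) {X : Finset (Fin n)} {a b : Fin n} (ha : a ∈ X)
    (hb : b ∉ X) :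
    addCost G w (insert b (X.erase a)) + w a + nonDeg G X a =
      addCost G w X + w b + nonDeg G (X.erase a) b := by
  have hb' : b ∉ X.erase a := fun h => hb (Finset.mem_of_mem_erase h)
  have h1 := nonEdges_insert G hb'
  have h2 := nonEdges_insert G (Finset.notMem_erase a X)
  rw [Finset.insert_erase ha, nonDeg_erase_self G ha] at h2
  have h3 := Finset.sum_erase_add X w ha
  have h4 := Finset.sum_insert (f := w) hb'
  simp only [addCost]
  omega

theorem card_swap {X : Finset (Fin n)} {a b : Fin n} (ha : a ∈ X) (hb : b ∉ X) :
    (insert b (X.erase a)).card = X.card := by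
  rw [Finset.card_insert_of_notMem fun h => hb (Finset.mem_of_mem_erase h),
    Finset.card_erase_add_one ha]

variable {G}

/-- A cheapest candidate with at most one non-neighbour in `X` can be exchanged into `X`. -/
theorem exists_swap_of_nonDeg_le_one {w : Fin n → ℕ} {C X : Finset (Fin n)} {x : Fin n}
    (hX : X ⊆ C) (hne : X.Nonempty) (hxC : x ∈ C) (hmin : ∀ u ∈ C, w x ≤ w u)
    (hxX : x ∉ X) (hdeg : nonDeg G X x ≤ 1) :
    ∃ X' ⊆ C, x ∈ X' ∧ X'.card = X.card ∧ addCost G w X' ≤ addCost G w X := by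
  suffices h : ∃ a ∈ X, nonDeg G (X.erase a) x = 0 by
    obtain ⟨a, ha, h0⟩ := h
    refine ⟨insert x (X.erase a), Finset.insert_subset hxC ((Finset.erase_subset _ _).trans hX),
      Finset.mem_insert_self _ _, card_swap ha hxX, ?_⟩
    have := addCost_swap G w ha hxX
    have := hmin a (hX ha)
    omega
  by_cases h : ∃ a ∈ X, x ≠ a ∧ ¬ G.Adj x a
  · obtain ⟨a, ha, hN⟩ := h
    have := nonDeg_erase G ha hN
    exact ⟨a, ha, by omega⟩
  · push Not at h
    obtain ⟨a, ha⟩ := hne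
    refine ⟨a, ha, ?_⟩
    rw [nonDeg, Finset.card_eq_zero, Finset.filter_eq_empty_iff]
    rintro u hu ⟨h1, h2⟩
    exact h2 (h u (Finset.mem_of_mem_erase hu) h1)

/-- Suppose that a walk in the complement, whose vertices are alternately outside and inside `X`,
leads from `x` to a vertex `p d` at which the alternation fails: a vertex outside `X` with at most
one non-neighbour in `X`, or a vertex inside `X` with at least one. Exchanging the last two
vertices is free and moves the failure two steps closer to `x`; in the end, `x` itself can be
exchanged into `X`. -/
theorem exists_swap_of_alternating_path {w : Fin n → ℕ} {C : Finset (Fin n)} {x : Fin n}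
    (hxC : x ∈ C) (hmin : ∀ u ∈ C, w x ≤ w u) (hC : ∀ u ∈ C, nonDeg G C u ≤ 2)
    {p : ℕ → Fin n} (hp0 : p 0 = x) (d : ℕ) :
    ∀ X : Finset (Fin n), X ⊆ C → X.Nonempty → Set.InjOn p (Set.Iic d) →
      (∀ i ≤ d, p i ∈ C ∧ w (p i) = w x) →
      (∀ i < d, p i ≠ p (i + 1) ∧ ¬ G.Adj (p i) (p (i + 1))) →
      (∀ i ≤ d, p i ∈ X ↔ Odd i) →
      (Even d → nonDeg G X (p d) ≤ 1) → (Odd d → 1 ≤ nonDeg G X (p d)) →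
      ∃ X' ⊆ C, x ∈ X' ∧ X'.card = X.card ∧ addCost G w X' ≤ addCost G w X := by
  induction d using Nat.strong_induction_on with
  | _ d ih =>
  intro X hX hne hinj hpC hadj halt heven hodd
  rcases Nat.even_or_odd d with hd | hd
  · rcases Nat.eq_zero_or_pos d with rfl | hpos
    · refine exists_swap_of_nonDeg_le_one hX hne hxC hmin ?_ ?_
      · rw [← hp0, halt 0 le_rfl]; simp
      · simpa [hp0] using heven hd
    obtain ⟨m, rfl⟩ : ∃ m, d = m + 2 := by
      obtain ⟨r, rfl⟩ := hd; exact ⟨r + r - 2, by omega⟩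
    have hm : Even m := by simpa [Nat.even_add] using hd
    have ha : p (m + 1) ∈ X := (halt _ (by omega)).2 hm.add_one
    have hb : p (m + 2) ∉ X := by rw [halt _ le_rfl]; simpa using hd
    have hN : p (m + 2) ≠ p (m + 1) ∧ ¬ G.Adj (p (m + 2)) (p (m + 1)) :=
      ⟨(hadj (m + 1) (by omega)).1.symm, fun h => (hadj (m + 1) (by omega)).2 h.symm⟩
    have h0 := nonDeg_erase G ha hN
    have h1 := heven hd
    have hsw := addCost_swap G w ha hb
    have hwa := (hpC (m + 1) (by omega)).2
    have hwb := (hpC (m + 2) (by omega)).2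
    have hX' : insert (p (m + 2)) (X.erase (p (m + 1))) ⊆ C :=
      Finset.insert_subset (hpC _ le_rfl).1 ((Finset.erase_subset _ _).trans hX)
    obtain ⟨X', h2, h3, h4, h5⟩ := ih m (by omega) _ hX' ⟨_, Finset.mem_insert_self _ _⟩
      (hinj.mono fun i hi => by simp only [Set.mem_Iic] at *; omega)
      (fun i hi => hpC i (by omega)) (fun i hi => hadj i (by omega))
      (fun i hi => by
        have e1 : p i ≠ p (m + 1) := fun h => by
          have := hinj (by simp; omega) (by simp) h; omega
        have e2 : p i ≠ p (m + 2) := fun h => by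
          have := hinj (by simp; omega) (by simp) h; omega
        simp [e1, e2, halt i (by omega)])
      (fun _ => by
        have e1 := nonDeg_erase G (hpC (m + 1) (by omega)).1 (hadj m (by omega))
        have e2 : insert (p (m + 2)) (X.erase (p (m + 1))) ⊆ C.erase (p (m + 1)) := by
          refine fun u hu => Finset.mem_erase.2 ⟨?_, hX' hu⟩
          rintro rfl
          exact hN.1 (by simpa [eq_comm] using hu)
        have e3 := nonDeg_mono G e2 (p m)
        have e4 := hC _ (hpC m (by omega)).1
        omega)
      (fun h => absurd hm (Nat.not_even_iff_odd.2 h))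
    refine ⟨X', h2, h3, h4.trans (card_swap ha hb), h5.trans ?_⟩
    omega
  · obtain ⟨m, rfl⟩ : ∃ m, d = m + 1 := by
      obtain ⟨r, rfl⟩ := hd; exact ⟨2 * r, by omega⟩
    have hm : Even m := by
      rwa [Nat.odd_add_one, Nat.not_odd_iff_even] at hd
    have ha : p (m + 1) ∈ X := (halt _ (by omega)).2 hd
    have hb : p m ∉ X := by rw [halt _ (by omega)]; simpa using hm
    have hN := hadj m (by omega)
    have h0 := nonDeg_erase G (hX ha) hN
    have h1 := hodd hd
    have h2 := hC _ (hpC m (by omega)).1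
    have h3 := nonDeg_mono G (Finset.erase_subset_erase (p (m + 1)) hX) (p m)
    have hsw := addCost_swap G w ha hb
    have hwa := (hpC (m + 1) (by omega)).2
    have hwb := (hpC m (by omega)).2
    have hX' : insert (p m) (X.erase (p (m + 1))) ⊆ C :=
      Finset.insert_subset (hpC _ (by omega)).1 ((Finset.erase_subset _ _).trans hX)
    rcases Nat.eq_zero_or_pos m with rfl | hpos
    · exact ⟨_, hX', by simp [hp0], card_swap ha hb, by omega⟩
    obtain ⟨q, rfl⟩ : ∃ q, m = q + 1 := ⟨m - 1, by omega⟩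
    have hq : Odd q := by
      rcases Nat.even_or_odd q with h | h
      · simp [parity_simps, h] at hm
      · exact h
    obtain ⟨X', h2, h3, h4, h5⟩ := ih q (by omega) _ hX' ⟨_, Finset.mem_insert_self _ _⟩
      (hinj.mono fun i hi => by simp only [Set.mem_Iic] at *; omega)
      (fun i hi => hpC i (by omega)) (fun i hi => hadj i (by omega))
      (fun i hi => by
        have e1 : p i ≠ p (q + 1) := fun h => by
          have := hinj (by simp; omega) (by simp) h; omega
        have e2 : p i ≠ p (q + 1 + 1) := fun h => by
          have := hinj (by simp; omega) (by simp) h; omega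
        simp [e1, e2, halt i (by omega)])
      (fun h => absurd hq (Nat.not_odd_iff_even.2 h))
      (fun _ => nonDeg_pos G (Finset.mem_insert_self _ _) (hadj q (by omega)))
    refine ⟨X', h2, h3, h4.trans (card_swap ha hb), h5.trans ?_⟩
    omega

/-- The graph of the non-edges of `G` within `C` that have exactly one end in `X`. -/
def crossGraph (G : SimpleGraph (Fin n)) (C X : Finset (Fin n)) : SimpleGraph (Fin n) where
  Adj u v := u ∈ C ∧ v ∈ C ∧ (u ≠ v ∧ ¬ G.Adj u v) ∧ (u ∈ X ↔ v ∉ X)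
  symm := ⟨fun u v ⟨h1, h2, h3, h4⟩ =>
    ⟨h2, h1, ⟨h3.1.symm, fun h => h3.2 h.symm⟩, by tauto⟩⟩
  loopless := ⟨fun u h => h.2.2.1.1 rfl⟩

/-- The case in which the cheapest candidates make up disjoint cycles of the complement of
`G[C]`. Either the alternation along the cycle of `x` fails somewhere, or the cycle alternates all
the way round and the two halves can be exchanged for each other. -/
theorem exists_swap_of_two_regular {w : Fin n → ℕ} {C X : Finset (Fin n)} {x : Fin n}
    (hX : X ⊆ C) (hne : X.Nonempty) (hxC : x ∈ C) (hmin : ∀ u ∈ C, w x ≤ w u)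
    (hC : ∀ u ∈ C, nonDeg G C u ≤ 2) (hxX : x ∉ X)
    (hreg : ∀ u ∈ C, w u = w x → nonDeg G C u = 2)
    (hclosed : ∀ u ∈ C, w u = w x → ∀ v ∈ C, u ≠ v ∧ ¬ G.Adj u v → w v = w x) :
    ∃ X' ⊆ C, x ∈ X' ∧ X'.card = X.card ∧ addCost G w X' ≤ addCost G w X := by
  classical
  set B := crossGraph G C X with hB
  have hreach : ∀ y, B.Reachable x y → y ∈ C ∧ w y = w x := by
    rintro y ⟨W⟩
    suffices h : ∀ u v : Fin n, B.Walk u v → u ∈ C ∧ w u = w x → v ∈ C ∧ w v = w x from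
      h x y W ⟨hxC, rfl⟩
    intro u v W
    induction W with
    | nil => exact id
    | cons h _ ih => exact fun hu => ih ⟨h.2.1, hclosed _ hu.1 hu.2 _ h.2.1 h.2.2.1⟩
  by_cases hdef : ∃ y, B.Reachable x y ∧
      ((y ∉ X ∧ nonDeg G X y ≤ 1) ∨ (y ∈ X ∧ 1 ≤ nonDeg G X y))
  · obtain ⟨y, hy, hyd⟩ := hdef
    obtain ⟨W, hW⟩ := hy.exists_isPath
    have hend : W.getVert W.length = y := W.getVert_length
    have hmem : ∀ i ≤ W.length, W.getVert i ∈ C ∧ w (W.getVert i) = w x :=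
      fun i hi => hreach _ ⟨W.take i⟩
    have halt : ∀ i ≤ W.length, W.getVert i ∈ X ↔ Odd i := by
      intro i
      induction i with
      | zero => intro _; simp [hxX]
      | succ i ih =>
        intro hi
        have h1 := (W.adj_getVert_succ (i := i) (by omega)).2.2.2
        rw [ih (by omega)] at h1
        rw [Nat.odd_add_one]
        tauto
    refine exists_swap_of_alternating_path hxC hmin hC W.getVert_zero W.length X hX hne
      hW.getVert_injOn hmem
      (fun i hi => (W.adj_getVert_succ hi).2.2.1) halt ?_ ?_
    · intro he
      rw [hend]
      have : y ∉ X := by rw [← hend, halt _ le_rfl]; simpa using he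
      tauto
    · intro ho
      rw [hend]
      have : y ∈ X := by rw [← hend, halt _ le_rfl]; exact ho
      tauto
  · push Not at hdef
    set K := C.filter fun y => B.Reachable x y with hK
    have hxK : x ∈ K := Finset.mem_filter.2 ⟨hxC, SimpleGraph.Reachable.refl x⟩
    have hKmem : ∀ y ∈ K, y ∈ C ∧ w y = w x := fun y hy => hreach y (Finset.mem_filter.1 hy).2
    have hstep : ∀ u ∈ K, ∀ v ∈ C, (u ≠ v ∧ ¬ G.Adj u v) → (u ∈ X ↔ v ∉ X) → v ∈ K := by
      intro u hu v hv hN hx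
      refine Finset.mem_filter.2 ⟨hv, (Finset.mem_filter.1 hu).2.trans ?_⟩
      exact SimpleGraph.Adj.reachable (G := B) ⟨(hKmem u hu).1, hv, hN, hx⟩
    -- a vertex of `K` outside `X` has all its non-neighbours in `X`
    have hout : ∀ u ∈ K, u ∉ X → ∀ v ∈ C, u ≠ v ∧ ¬ G.Adj u v → v ∈ X := by
      intro u hu huX v hv hN
      by_contra hvX
      have h1 := (hdef u (Finset.mem_filter.1 hu).2).1 huX
      have h2 := nonDeg_erase G hv hN
      have h3 : nonDeg G X u ≤ nonDeg G (C.erase v) u := nonDeg_mono G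
        (fun z hz => Finset.mem_erase.2 ⟨by rintro rfl; exact hvX hz, hX hz⟩) u
      have h4 := hC u (hKmem u hu).1
      omega
    -- a vertex of `K` inside `X` has none of its non-neighbours in `X`
    have hin : ∀ u ∈ K, u ∈ X → ∀ v ∈ C, u ≠ v ∧ ¬ G.Adj u v → v ∉ X := by
      intro u hu huX v hv hN hvX
      have h1 := (hdef u (Finset.mem_filter.1 hu).2).2 huX
      have h2 := nonDeg_pos G hvX hN
      omega
    have hcard : (K.filter (· ∉ X)).card = (K.filter (· ∈ X)).card := by
      have := Finset.card_mul_eq_card_mul (fun u v => u ≠ v ∧ ¬ G.Adj u v)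
        (s := K.filter (· ∉ X)) (t := K.filter (· ∈ X)) (m := 2) (n := 2) ?_ ?_
      · omega
      · intro u hu
        obtain ⟨hu, huX⟩ := Finset.mem_filter.1 hu
        rw [← hreg u (hKmem u hu).1 (hKmem u hu).2, nonDeg]
        congr 1
        ext v
        simp only [Finset.bipartiteAbove, Finset.mem_filter]
        constructor
        · rintro ⟨⟨h1, h2⟩, h3⟩; exact ⟨(hKmem v h1).1, h3⟩
        · rintro ⟨h1, h3⟩
          have hvX := hout u hu huX v h1 h3
          exact ⟨⟨hstep u hu v h1 h3 (by tauto), hvX⟩, h3⟩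
      · intro u hu
        obtain ⟨hu, huX⟩ := Finset.mem_filter.1 hu
        rw [← hreg u (hKmem u hu).1 (hKmem u hu).2, nonDeg]
        congr 1
        ext v
        simp only [Finset.bipartiteBelow, Finset.mem_filter]
        constructor
        · rintro ⟨⟨h1, h2⟩, h3⟩
          exact ⟨(hKmem v h1).1, h3.1.symm, fun h => h3.2 h.symm⟩
        · rintro ⟨h1, h3⟩
          have hvX := hin u hu huX v h1 h3
          exact ⟨⟨hstep u hu v h1 h3 (by tauto), hvX⟩, h3.1.symm, fun h => h3.2 h.symm⟩
    have hdisj : Disjoint (X.filter (· ∉ K)) (K.filter (· ∉ X)) := by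
      rw [Finset.disjoint_left]
      intro u h1 h2
      exact (Finset.mem_filter.1 h2).2 (Finset.mem_filter.1 h1).1
    have hXK : X.filter (· ∈ K) = K.filter (· ∈ X) := by
      ext u; simp only [Finset.mem_filter]; tauto
    have hXsplit : (X.filter (· ∈ K)).card + (X.filter (· ∉ K)).card = X.card :=
      Finset.card_filter_add_card_filter_not _
    have hwsplit : ∑ u ∈ X.filter (· ∈ K), w u + ∑ u ∈ X.filter (· ∉ K), w u = ∑ u ∈ X, w u :=
      Finset.sum_filter_add_sum_filter_not _ _ _
    have hsub : X.filter (· ∉ K) ∪ K.filter (· ∉ X) ⊆ C :=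
      Finset.union_subset ((Finset.filter_subset _ _).trans hX)
        ((Finset.filter_subset _ _).trans fun u hu => (hKmem u hu).1)
    refine ⟨X.filter (· ∉ K) ∪ K.filter (· ∉ X), hsub,
      Finset.mem_union_right _ (Finset.mem_filter.2 ⟨hxK, hxX⟩), ?_, ?_⟩
    · rw [Finset.card_union_of_disjoint hdisj]
      rw [hXK] at hXsplit
      omega
    · rw [addCost, addCost, Finset.sum_union hdisj]
      have e1 : ∑ u ∈ K.filter (· ∉ X), w u = (K.filter (· ∉ X)).card * w x := by
        rw [Finset.sum_const_nat fun u hu => (hKmem u (Finset.mem_filter.1 hu).1).2]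
      have e2 : ∑ u ∈ K.filter (· ∈ X), w u = (K.filter (· ∈ X)).card * w x := by
        rw [Finset.sum_const_nat fun u hu => (hKmem u (Finset.mem_filter.1 hu).1).2]
      rw [hXK] at hwsplit
      rw [hcard] at e1
      have e3 : nonEdges G (X.filter (· ∉ K) ∪ K.filter (· ∉ X)) ≤ nonEdges G X := by
        -- no vertex of `K \ X` lies on a non-edge of the new set
        have key : ∀ u ∈ X.filter (· ∉ K) ∪ K.filter (· ∉ X),
            ∀ v ∈ X.filter (· ∉ K) ∪ K.filter (· ∉ X), (u ≠ v ∧ ¬ G.Adj u v) → u ∈ X := by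
          intro u hu v hv hN
          by_contra huX
          have huK : u ∈ K := by
            simp only [Finset.mem_union, Finset.mem_filter] at hu; tauto
          have hvX := hout u huK huX v (hsub hv) hN
          have hvK := hstep u huK v (hsub hv) hN (by tauto)
          simp only [Finset.mem_union, Finset.mem_filter] at hv
          tauto
        refine Finset.card_le_card fun e he => ?_
        induction e with | _ a b
        simp only [Finset.mem_filter, Finset.mk_mem_sym2_iff, SimpleGraph.mem_edgeSet,
          SimpleGraph.compl_adj] at he ⊢
        obtain ⟨⟨ha, hb⟩, hab⟩ := he
        exact ⟨⟨key a ha b hb hab, key b hb a ha ⟨hab.1.symm, fun h => hab.2 h.symm⟩⟩, hab⟩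
      omega

/-- The choice rule of `IRSolver`: `x` has the least number `w x` of non-neighbours in the partial
solution; it has at most one non-neighbour in `C`, or else all vertices of the first kind have at
least two, and `x` has the fewest among themselves. -/
def IsGreedyChoice (G : SimpleGraph (Fin n)) [DecidableRel G.Adj] (w : Fin n → ℕ)
    (C : Finset (Fin n)) (x : Fin n) : Prop :=
  x ∈ C ∧ (∀ u ∈ C, w x ≤ w u) ∧
    (nonDeg G C x ≤ 1 ∨ ∀ u ∈ C, w u = w x → 2 ≤ nonDeg G C u ∧
      nonDeg G (C.filter (w · = w x)) x ≤ nonDeg G (C.filter (w · = w x)) u)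

theorem exists_swap_of_isGreedyChoice {w : Fin n → ℕ} {C X : Finset (Fin n)} {x : Fin n}
    (hX : X ⊆ C) (hne : X.Nonempty) (hC : ∀ u ∈ C, nonDeg G C u ≤ 2)
    (hx : IsGreedyChoice G w C x) :
    ∃ X' ⊆ C, x ∈ X' ∧ X'.card = X.card ∧ addCost G w X' ≤ addCost G w X := by
  obtain ⟨hxC, hmin, hx⟩ := hx
  by_cases hxX : x ∈ X
  · exact ⟨X, hX, hxX, rfl, le_rfl⟩
  by_cases hdeg : nonDeg G X x ≤ 1
  · exact exists_swap_of_nonDeg_le_one hX hne hxC hmin hxX hdeg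
  have hdegC := nonDeg_mono G hX x
  have hx := hx.resolve_left (by omega)
  by_cases hsw : ∃ u ∈ X, (x ≠ u ∧ ¬ G.Adj x u) ∧ w u ≠ w x
  · -- a non-neighbour in `X` that is more expensive than `x` pays for the other one
    obtain ⟨u, hu, hN, hwu⟩ := hsw
    refine ⟨insert x (X.erase u), Finset.insert_subset hxC ((Finset.erase_subset _ _).trans hX),
      Finset.mem_insert_self _ _, card_swap hu hxX, ?_⟩
    have h1 := addCost_swap G w hu hxX
    have h2 := hmin u (hX hu)
    have h3 := nonDeg_erase G hu hN
    have h4 := hC x hxC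
    omega
  · push Not at hsw
    have hxΓ : 2 ≤ nonDeg G (C.filter (w · = w x)) x := by
      refine le_trans (by omega : 2 ≤ nonDeg G X x) (Finset.card_le_card fun u hu => ?_)
      obtain ⟨h1, h2⟩ := Finset.mem_filter.1 hu
      exact Finset.mem_filter.2 ⟨Finset.mem_filter.2 ⟨hX h1, hsw u h1 h2⟩, h2⟩
    refine exists_swap_of_two_regular hX hne hxC hmin hC hxX
      (fun u hu hw => le_antisymm (hC u hu) (hx u hu hw).1) ?_
    intro u hu hw v hv hN
    by_contra hwv
    have h1 := (hx u hu hw).2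
    have h2 := nonDeg_erase G hv hN
    have h3 : nonDeg G (C.filter (w · = w x)) u ≤ nonDeg G (C.erase v) u := nonDeg_mono G
      (fun z hz => Finset.mem_erase.2 ⟨by rintro rfl; exact hwv (Finset.mem_filter.1 hz).2,
        (Finset.mem_filter.1 hz).1⟩) u
    have h4 := hC u hu
    omega

/-- Some best solution contains the greedily chosen vertex. -/
theorem exists_solution_of_isGreedyChoice {S C T : Finset (Fin n)} (hSC : Disjoint S C)
    (hST : S ⊆ T) (hT : T ⊆ S ∪ C) (hne : S ≠ T) (hC : ∀ u ∈ C, nonDeg G C u ≤ 2) {x : Fin n}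
    (hx : IsGreedyChoice G (nonDeg G S) C x) :
    ∃ T', insert x S ⊆ T' ∧ T' ⊆ S ∪ C ∧ T'.card = T.card ∧ nonEdges G T' ≤ nonEdges G T := by
  have hX : T \ S ⊆ C := by
    intro u hu
    have := hT (Finset.mem_sdiff.1 hu).1
    have := (Finset.mem_sdiff.1 hu).2
    simp_all
  obtain ⟨X', h1, h2, h3, h4⟩ := exists_swap_of_isGreedyChoice hX
    (Finset.sdiff_nonempty.2 fun h => hne (hST.antisymm h)) hC hx
  have hd : Disjoint S X' := hSC.mono_right h1
  refine ⟨S ∪ X', Finset.insert_subset (Finset.mem_union_right _ h2) Finset.subset_union_left,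
    Finset.union_subset_union_right h1, ?_, ?_⟩
  · rw [Finset.card_union_of_disjoint hd, h3, Finset.card_sdiff_of_subset hST]
    have := Finset.card_le_card hST
    omega
  · conv_rhs => rw [← Finset.union_sdiff_of_subset hST]
    rw [nonEdges_union G hd, nonEdges_union G Finset.disjoint_sdiff]
    simp only [addCost] at h4
    omega

end

/-! ### Correctness and running time of `IRSolver` -/

section

variable {n : ℕ} {G : SimpleGraph (Fin n)} [DecidableRel G.Adj]

theorem irTables_val (S C L : List (Fin n)) (dS : Fin n → ℕ) (nn : Fin n → List (Fin n)) :
    (∀ v, (irTables G S C L dS nn).val.1 v =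
      if v ∈ L then (S.filter fun w => v ≠ w ∧ ¬ G.Adj v w).length else dS v) ∧
    ∀ v, (irTables G S C L dS nn).val.2 v =
      if v ∈ L then C.filter (fun w => v ≠ w ∧ ¬ G.Adj v w) else nn v := by
  induction L generalizing dS nn with
  | nil => simp [irTables]
  | cons u L ih =>
    simp only [irTables, Timed.val_bind, nonDegT_val, filterT_val]
    constructor <;> intro v
    · rw [(ih _ _).1]
      by_cases h1 : v ∈ L
      · simp [h1]
      · by_cases h2 : v = u
        · subst h2; simp [h1]
        · simp [h1, h2]
    · rw [(ih _ _).2]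
      by_cases h1 : v ∈ L
      · simp [h1]
      · by_cases h2 : v = u
        · subst h2; simp [h1]
        · simp [h1, h2]

theorem irTables_steps_le (S C L : List (Fin n)) (dS : Fin n → ℕ) (nn : Fin n → List (Fin n)) :
    (irTables G S C L dS nn).steps ≤ L.length * (3 * (S.length + C.length + 1)) + 1 := by
  induction L generalizing dS nn with
  | nil => simp [irTables]
  | cons u L ih =>
    simp only [irTables, Timed.steps_bind, steps_charge, nonDegT_steps, List.length_cons]
    have h1 := filterT_steps_le
      (fun w => (⟨decide (u ≠ w ∧ ¬ G.Adj u w), 1⟩ : Timed Bool)) C 1 (fun _ _ => le_rfl)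
    have h2 := ih (Function.update dS u (nonDegT G u S).val) (Function.update nn u
      (filterT (fun w => (⟨decide (u ≠ w ∧ ¬ G.Adj u w), 1⟩ : Timed Bool)) C).val)
    nlinarith

theorem raiseT_val {L : List (Fin n)} (hL : L.Nodup) (dS : Fin n → ℕ) (v : Fin n) :
    (raiseT L dS).val v = dS v + if v ∈ L then 1 else 0 := by
  induction L generalizing dS with
  | nil => simp [raiseT]
  | cons u L ih =>
    obtain ⟨h1, h2⟩ := List.nodup_cons.1 hL
    simp only [raiseT, Timed.val_bind, ih h2]
    by_cases h : v = u
    · subst h; simp [h1]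
    · simp [h]

@[simp] theorem raiseT_steps (L : List (Fin n)) (dS : Fin n → ℕ) :
    (raiseT L dS).steps = L.length + 1 := by
  induction L generalizing dS with
  | nil => rfl
  | cons u L ih => simp [raiseT, ih]; omega

theorem dropT_val {L : List (Fin n)} (hL : L.Nodup) (x : Fin n) (nn : Fin n → List (Fin n))
    (v : Fin n) : (dropT x L nn).val v = if v ∈ L then (nn v).erase x else nn v := by
  induction L generalizing nn with
  | nil => simp [dropT]
  | cons u L ih =>
    obtain ⟨h1, h2⟩ := List.nodup_cons.1 hL
    simp only [dropT, Timed.val_bind, ih h2, eraseT_val]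
    by_cases h : v = u
    · subst h; simp [h1]
    · simp [h]

theorem dropT_steps_le {L : List (Fin n)} (hL : L.Nodup) (x : Fin n)
    (nn : Fin n → List (Fin n)) (c : ℕ) (h : ∀ v ∈ L, (nn v).length ≤ c) :
    (dropT x L nn).steps ≤ (c + 2) * L.length + 1 := by
  induction L generalizing nn with
  | nil => simp [dropT]
  | cons u L ih =>
    obtain ⟨h1, h2⟩ := List.nodup_cons.1 hL
    have h3 := ih h2 (Function.update nn u ((nn u).erase x)) fun v hv => by
      rw [Function.update_of_ne (by rintro rfl; exact h1 hv)]
      exact h v (List.mem_cons_of_mem _ hv)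
    have h4 := h u List.mem_cons_self
    simp only [dropT, Timed.steps_bind, steps_charge, eraseT_steps, eraseT_val, List.length_cons]
    nlinarith

/-- The candidates among which a round of `irLoop` chooses. -/
def irCands (C : List (Fin n)) (dS : Fin n → ℕ) (nn : Fin n → List (Fin n)) :
    Timed (List (Fin n)) := do
  let mΓ ← argminT (fun v => (⟨dS v, 1⟩ : Timed ℕ)) C
  let r ← argminT (fun v => lengthT (nn v)) mΓ.2
  if r.1 ≤ 1 then return r.2
  else do
    let r' ← argminT (fun v => do
      let l ← filterT (fun w => (⟨decide (dS w = mΓ.1), 1⟩ : Timed Bool)) (nn v)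
      lengthT l) mΓ.2
    return r'.2

/-- What a round of `irLoop` does once the vertex is chosen. -/
def irMove (k : ℕ) (sel : List (Fin n) → List (Fin n) → ℕ) (fuel : ℕ) (S C : List (Fin n))
    (dS : Fin n → ℕ) (nn : Fin n → List (Fin n)) (e : ℕ) :
    Option (Fin n) → Timed (List (Fin n))
  | none => return S
  | some x =>
      if k < e + dS x then
        return S
      else do
        let C' ← eraseT x C
        let dS' ← raiseT (nn x) dS
        let nn' ← dropT x (nn x) nn
        irLoop k sel fuel (x :: S) C' dS' nn' (e + dS x)

/-- A round of `irLoop`, as `irCands` followed by the choice of the vertex and `irMove`. -/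
theorem irLoop_succ (k : ℕ) (sel : List (Fin n) → List (Fin n) → ℕ) (fuel : ℕ)
    (S C : List (Fin n)) (dS : Fin n → ℕ) (nn : Fin n → List (Fin n)) (e : ℕ) :
    (irLoop k sel (fuel + 1) S C dS nn e).val =
      (irMove k sel fuel S C dS nn e
        (irCands C dS nn).val[sel S C % (irCands C dS nn).val.length]?).val ∧
    (irLoop k sel (fuel + 1) S C dS nn e).steps =
      1 + (irCands C dS nn).steps + ((irCands C dS nn).val.length + 1) +
      (irMove k sel fuel S C dS nn e
        (irCands C dS nn).val[sel S C % (irCands C dS nn).val.length]?).steps := by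
  simp only [irLoop, irCands]
  by_cases h : (argminT (fun v => lengthT (nn v))
      (argminT (fun v => (⟨dS v, 1⟩ : Timed ℕ)) C).val.2).val.1 ≤ 1
  · simp only [Timed.val_bind, Timed.steps_bind, if_pos h, Timed.val_pure, Timed.steps_pure,
      chooseT_val, chooseT_steps, steps_charge]
    cases (argminT (fun v => lengthT (nn v))
      (argminT (fun v => (⟨dS v, 1⟩ : Timed ℕ)) C).val.2).val.2[sel S C % (argminT (fun v =>
        lengthT (nn v)) (argminT (fun v => (⟨dS v, 1⟩ : Timed ℕ)) C).val.2).val.2.length]? <;>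
    exact ⟨rfl, by simp only [irMove]; omega⟩
  · simp only [Timed.val_bind, Timed.steps_bind, if_neg h, Timed.val_pure, Timed.steps_pure,
      chooseT_val, chooseT_steps, steps_charge]
    generalize (argminT (fun v => filterT (fun w => (⟨decide (dS w =
      (argminT (fun v => (⟨dS v, 1⟩ : Timed ℕ)) C).val.1), 1⟩ : Timed Bool)) (nn v) >>= fun l =>
        lengthT l) (argminT (fun v => (⟨dS v, 1⟩ : Timed ℕ)) C).val.2) = r
    cases r.val.2[sel S C % r.val.2.length]? <;>
    exact ⟨rfl, by simp only [irMove]; omega⟩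

/-- The invariant of `irLoop`: the arrays hold what they are meant to hold. -/
structure IRState (G : SimpleGraph (Fin n)) [DecidableRel G.Adj] (k : ℕ) (S C : List (Fin n))
    (dS : Fin n → ℕ) (nn : Fin n → List (Fin n)) (e : ℕ) : Prop where
  nodup : (S ++ C).Nodup
  e_eq : e = nonEdges G S.toFinset
  e_le : e ≤ k
  dS_eq : ∀ v ∈ C, dS v = nonDeg G S.toFinset v
  nn_nodup : ∀ v ∈ C, (nn v).Nodup
  mem_nn : ∀ v ∈ C, ∀ w, w ∈ nn v ↔ w ∈ C ∧ v ≠ w ∧ ¬ G.Adj v w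
  deg_le : ∀ v ∈ C, nonDeg G C.toFinset v ≤ 2

namespace IRState

variable {k : ℕ} {S C : List (Fin n)} {dS : Fin n → ℕ} {nn : Fin n → List (Fin n)} {e : ℕ}

theorem length_nn (h : IRState G k S C dS nn e) {v : Fin n} (hv : v ∈ C) :
    (nn v).length = nonDeg G C.toFinset v := by
  rw [← List.toFinset_card_of_nodup (h.nn_nodup v hv), nonDeg]
  congr 1
  ext w
  simp [h.mem_nn v hv]

theorem length_filter_nn (h : IRState G k S C dS nn e) {v : Fin n} (hv : v ∈ C) (m : ℕ) :
    ((nn v).filter fun w => dS w = m).length =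
      nonDeg G (C.toFinset.filter (nonDeg G S.toFinset · = m)) v := by
  rw [← List.toFinset_card_of_nodup ((h.nn_nodup v hv).filter _), nonDeg]
  congr 1
  ext w
  simp only [List.toFinset_filter, decide_eq_true_eq, Finset.mem_filter, List.mem_toFinset,
    h.mem_nn v hv]
  constructor
  · rintro ⟨⟨h1, h2⟩, h3⟩; exact ⟨⟨h1, h.dS_eq w h1 ▸ h3⟩, h2⟩
  · rintro ⟨⟨h1, h3⟩, h2⟩; exact ⟨⟨h1, h2⟩, h.dS_eq w h1 ▸ h3⟩

theorem disjoint (h : IRState G k S C dS nn e) : Disjoint S.toFinset C.toFinset := by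
  rw [List.disjoint_toFinset_iff_disjoint]
  exact List.disjoint_of_nodup_append h.nodup

theorem irCands_ne_nil (hC : C ≠ []) : (irCands C dS nn).val ≠ [] := by
  have h1 := (argminT_spec (fun v => (⟨dS v, 1⟩ : Timed ℕ)) C).1.not.2 hC
  simp only [irCands, Timed.val_bind, Timed.val_ite, Timed.val_pure]
  split_ifs
  · exact (argminT_spec _ _).1.not.2 h1
  · exact (argminT_spec _ _).1.not.2 h1

theorem irCands_subset {x : Fin n} (hx : x ∈ (irCands C dS nn).val) : x ∈ C := by
  simp only [irCands, Timed.val_bind, Timed.val_ite, Timed.val_pure] at hx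
  split_ifs at hx
  · exact (mem_argminT.1 (mem_argminT.1 hx).1).1
  · exact (mem_argminT.1 (mem_argminT.1 hx).1).1

theorem isGreedyChoice (h : IRState G k S C dS nn e) {x : Fin n}
    (hx : x ∈ (irCands C dS nn).val) : IsGreedyChoice G (nonDeg G S.toFinset) C.toFinset x := by
  have hxC := irCands_subset hx
  have hΓ : ∀ u, u ∈ (argminT (fun v => (⟨dS v, 1⟩ : Timed ℕ)) C).val.2 ↔
      u ∈ C ∧ dS u = (argminT (fun v => (⟨dS v, 1⟩ : Timed ℕ)) C).val.1 := fun u => mem_argminT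
  have hle := (argminT_spec (fun v => (⟨dS v, 1⟩ : Timed ℕ)) C).2.1
  simp only [irCands, Timed.val_bind, Timed.val_ite, Timed.val_pure] at hx
  set A := (argminT (fun v => (⟨dS v, 1⟩ : Timed ℕ)) C).val with hA
  have hxΓ : x ∈ A.2 := by
    split_ifs at hx
    · exact (mem_argminT.1 hx).1
    · exact (mem_argminT.1 hx).1
  have hxm := ((hΓ x).1 hxΓ).2
  refine ⟨by simpa using hxC, fun u hu => ?_, ?_⟩
  · rw [List.mem_toFinset] at hu
    rw [← h.dS_eq x hxC, ← h.dS_eq u hu, hxm]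
    exact hle u hu
  split_ifs at hx with hr
  · left
    have := (mem_argminT.1 hx).2
    rw [lengthT_val, h.length_nn hxC] at this
    omega
  · right
    intro u hu hw
    rw [List.mem_toFinset] at hu
    rw [← h.dS_eq x hxC, ← h.dS_eq u hu, hxm] at hw
    have huΓ := (hΓ u).2 ⟨hu, hw⟩
    constructor
    · have := (argminT_spec (fun v => lengthT (nn v)) A.2).2.1 u huΓ
      rw [lengthT_val, h.length_nn hu] at this
      omega
    · have h1 := (argminT_spec (fun v => filterT
        (fun w => (⟨decide (dS w = A.1), 1⟩ : Timed Bool)) (nn v) >>= fun l => lengthT l)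
        A.2).2.1 u huΓ
      rw [← (mem_argminT.1 hx).2] at h1
      simp only [Timed.val_bind, lengthT_val, filterT_val] at h1
      rwa [h.length_filter_nn hxC, h.length_filter_nn hu, ← hxm, h.dS_eq x hxC] at h1

theorem irCands_steps_le (h : IRState G k S C dS nn e) :
    (irCands C dS nn).steps + (irCands C dS nn).val.length ≤ 16 * C.length + 3 := by
  have hlen : ∀ v ∈ C, (nn v).length ≤ 2 := fun v hv => h.length_nn hv ▸ h.deg_le v hv
  have h1 := argminT_steps_le (fun v => (⟨dS v, 1⟩ : Timed ℕ)) C 1 (fun _ _ => le_rfl)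
  have h2 : (argminT (fun v => (⟨dS v, 1⟩ : Timed ℕ)) C).val.2.length ≤ C.length := by
    rw [(argminT_spec _ C).2.2]; exact List.length_filter_le _ _
  have hsub : ∀ u ∈ (argminT (fun v => (⟨dS v, 1⟩ : Timed ℕ)) C).val.2, u ∈ C :=
    fun u hu => (mem_argminT.1 hu).1
  simp only [irCands, Timed.val_bind, Timed.val_ite, Timed.val_pure, Timed.steps_bind,
    Timed.steps_ite, Timed.steps_pure]
  set A := (argminT (fun v => (⟨dS v, 1⟩ : Timed ℕ)) C).val with hA
  have h3 := argminT_steps_le (fun v => lengthT (nn v)) A.2 3 (fun u hu => by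
    have := hlen u (hsub u hu)
    simp; omega)
  have h4 : (argminT (fun v => lengthT (nn v)) A.2).val.2.length ≤ A.2.length := by
    rw [(argminT_spec _ A.2).2.2]; exact List.length_filter_le _ _
  set f : Fin n → Timed ℕ := fun v => filterT
        (fun w => (⟨decide (dS w = A.1), 1⟩ : Timed Bool)) (nn v) >>= fun l => lengthT l with hf
  have h5 := argminT_steps_le f A.2 8 (fun u hu => by
    have e1 := hlen u (hsub u hu)
    have e2 := filterT_steps_le (fun w => (⟨decide (dS w = A.1), 1⟩ : Timed Bool)) (nn u) 1
      (fun _ _ => le_rfl)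
    have e3 := List.length_filter_le (fun w => decide (dS w = A.1)) (nn u)
    simp only [hf, Timed.steps_bind, lengthT_steps, filterT_val]
    omega)
  have h6 : (argminT f A.2).val.2.length ≤ A.2.length := by
    rw [(argminT_spec _ A.2).2.2]; exact List.length_filter_le _ _
  split_ifs <;> omega

theorem move (h : IRState G k S C dS nn e) {x : Fin n} (hx : x ∈ C) (hk : e + dS x ≤ k) :
    IRState G k (x :: S) (C.erase x) (raiseT (nn x) dS).val (dropT x (nn x) nn).val
      (e + dS x) := by
  have hnd := h.nodup
  have hxS : x ∉ S := fun hS => List.disjoint_of_nodup_append hnd hS hx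
  have hCnd : C.Nodup := hnd.of_append_right
  have hmem : ∀ v, v ∈ C.erase x ↔ v ≠ x ∧ v ∈ C := fun v => hCnd.mem_erase_iff
  refine ⟨?_, ?_, hk, ?_, ?_, ?_, ?_⟩
  · refine (List.Perm.nodup_iff ?_).1 hnd
    exact ((List.perm_cons_erase hx).append_left S).trans List.perm_middle
  · rw [List.toFinset_cons, nonEdges_insert G (by simpa using hxS), ← h.e_eq, h.dS_eq x hx]
  · intro v hv
    obtain ⟨hvx, hv⟩ := (hmem v).1 hv
    rw [raiseT_val (h.nn_nodup x hx), List.toFinset_cons, nonDeg_insert G (by simpa using hxS),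
      h.dS_eq v hv]
    congr 1
    have : v ∈ nn x ↔ v ≠ x ∧ ¬ G.Adj v x := by
      rw [h.mem_nn x hx, G.adj_comm, ne_comm]; tauto
    simp only [this]
  · intro v hv
    rw [dropT_val (h.nn_nodup x hx)]
    obtain ⟨hvx, hv⟩ := (hmem v).1 hv
    split_ifs
    · exact (h.nn_nodup v hv).erase _
    · exact h.nn_nodup v hv
  · intro v hv w
    rw [dropT_val (h.nn_nodup x hx)]
    obtain ⟨hvx, hvC⟩ := (hmem v).1 hv
    split_ifs with hvn
    · rw [(h.nn_nodup v hvC).mem_erase_iff, h.mem_nn v hvC, hmem]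
      tauto
    · rw [h.mem_nn v hvC, hmem]
      constructor
      · rintro ⟨h1, h2⟩
        refine ⟨⟨?_, h1⟩, h2⟩
        rintro rfl
        exact hvn ((h.mem_nn w hx v).2 ⟨hvC, h2.1.symm, fun h => h2.2 h.symm⟩)
      · rintro ⟨⟨-, h1⟩, h2⟩; exact ⟨h1, h2⟩
  · intro v hv
    refine le_trans (nonDeg_mono G ?_ v) (h.deg_le v ((hmem v).1 hv).2)
    intro u hu
    rw [List.mem_toFinset] at hu ⊢
    exact ((hmem u).1 hu).2

end IRState

/-- The greedy rounds end with a largest solution of the branch. -/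
theorem irLoop_spec {k : ℕ} (sel : List (Fin n) → List (Fin n) → ℕ) (fuel : ℕ) :
    ∀ (S C : List (Fin n)) (dS : Fin n → ℕ) (nn : Fin n → List (Fin n)) (e : ℕ),
      IRState G k S C dS nn e → C.length < fuel →
      (irLoop k sel fuel S C dS nn e).val.Nodup ∧
      IsDefective G k (irLoop k sel fuel S C dS nn e).val.toFinset ∧
      (∀ T, IsSolution G k S C T → T.card ≤ (irLoop k sel fuel S C dS nn e).val.length) ∧
      (irLoop k sel fuel S C dS nn e).steps ≤ 40 * (C.length + 1) ^ 2 := by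
  induction fuel with
  | zero => intro S C dS nn e _ h; omega
  | succ fuel ih =>
    intro S C dS nn e h hfuel
    have hSnd : S.Nodup := h.nodup.of_append_left
    have hSdef : IsDefective G k S.toFinset := by
      rw [IsDefective, ← h.e_eq]; exact h.e_le
    have hcost := h.irCands_steps_le
    rw [(irLoop_succ k sel fuel S C dS nn e).1, (irLoop_succ k sel fuel S C dS nn e).2]
    by_cases hC : C = []
    · have hc : (irCands C dS nn).val = [] := by
        by_contra hne
        obtain ⟨x, hx⟩ := List.exists_mem_of_ne_nil _ hne
        have := IRState.irCands_subset hx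
        simp [hC] at this
      rw [hc] at hcost ⊢
      simp only [List.length_nil, List.getElem?_nil, irMove, Timed.val_pure, Timed.steps_pure]
      refine ⟨hSnd, hSdef, fun T hT => ?_, by nlinarith⟩
      have := Finset.card_le_card hT.2.2
      rw [hC, List.append_nil, List.toFinset_card_of_nodup hSnd] at this
      exact this
    obtain ⟨x, hx, hsome⟩ := exists_mem_choose (sel S C) (IRState.irCands_ne_nil (dS := dS)
      (nn := nn) hC)
    have hxC := IRState.irCands_subset hx
    have hxS : x ∉ S := fun hS => List.disjoint_of_nodup_append h.nodup hS hxC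
    rw [hsome]
    -- a solution that is not exhausted by `S` can be taken to contain `x`
    have hexch : ∀ T, IsSolution G k S C T → S.toFinset ≠ T → ∃ T',
        IsSolution G k (x :: S) (C.erase x) T' ∧ T'.card = T.card := by
      intro T hT hne
      obtain ⟨T', h1, h2, h3, h4⟩ := exists_solution_of_isGreedyChoice h.disjoint hT.2.1
        (by simpa using hT.2.2) hne (fun u hu => h.deg_le u (by simpa using hu))
        (h.isGreedyChoice hx)
      refine ⟨T', ⟨h4.trans hT.1, by simpa using h1, fun u hu => ?_⟩, h3⟩
      have := h2 hu
      simp only [Finset.mem_union, List.mem_toFinset, List.mem_append, List.mem_cons] at this ⊢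
      by_cases hux : u = x
      · simp [hux]
      · rw [List.mem_erase_of_ne hux]; tauto
    by_cases hk : k < e + dS x
    · simp only [irMove, if_pos hk, Timed.val_pure, Timed.steps_pure]
      refine ⟨hSnd, hSdef, fun T hT => ?_, by nlinarith⟩
      by_cases hne : S.toFinset = T
      · rw [← hne, List.toFinset_card_of_nodup hSnd]
      · obtain ⟨T', ⟨h1, h2, -⟩, -⟩ := hexch T hT hne
        have h5 := nonEdges_mono G h2
        rw [List.toFinset_cons, nonEdges_insert G (by simpa using hxS), ← h.e_eq,
          ← h.dS_eq x hxC] at h5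
        rw [IsDefective] at h1
        omega
    · have hmove := h.move hxC (not_lt.1 hk)
      have hlen : (C.erase x).length + 1 = C.length := by
        rw [List.length_erase_of_mem hxC]
        have := List.length_pos_of_mem hxC
        omega
      obtain ⟨i1, i2, i3, i4⟩ := ih _ _ _ _ _ hmove (by omega)
      simp only [irMove, if_neg hk, Timed.val_bind, Timed.steps_bind, eraseT_val, eraseT_steps,
        raiseT_steps]
      refine ⟨i1, i2, fun T hT => ?_, ?_⟩
      · by_cases hne : S.toFinset = T
        · refine le_trans ?_ (i3 (insert x S.toFinset) ⟨?_, by simp, ?_⟩)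
          · rw [← hne]; exact Finset.card_le_card (Finset.subset_insert _ _)
          · have := hmove.e_le
            rwa [hmove.e_eq, List.toFinset_cons] at this
          · intro u; simp; tauto
        · obtain ⟨T', h1, h2⟩ := hexch T hT hne
          exact h2 ▸ i3 T' h1
      · have l1 : (nn x).length ≤ 2 := h.length_nn hxC ▸ h.deg_le x hxC
        have l2 := dropT_steps_le (h.nn_nodup x hxC) x nn 2 (fun v hv => by
          have hvC := ((h.mem_nn x hxC v).1 hv).1
          exact h.length_nn hvC ▸ h.deg_le v hvC)
        rw [hlen] at i4
        nlinarith

/-- If `S ∪ C` is feasible or `C` has at most two non-neighbours per candidate, `IRSolver` returns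
a largest solution of the branch, in quadratic time. -/
theorem irSolver_spec {k : ℕ} (sel : List (Fin n) → List (Fin n) → ℕ) {S C : List (Fin n)}
    (hbr : IsBranch G k S C)
    (hC : nonEdges G (S ++ C).toFinset ≤ k ∨ ∀ v ∈ C, nonDeg G C.toFinset v ≤ 2) :
    (irSolver G k sel S C).val.Nodup ∧
    IsDefective G k (irSolver G k sel S C).val.toFinset ∧
    (∀ T, IsSolution G k S C T → T.card ≤ (irSolver G k sel S C).val.length) ∧
    (irSolver G k sel S C).steps ≤ 50 * (S.length + C.length + 1) ^ 2 := by
  obtain ⟨hnd, hdef⟩ := hbr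
  have c1 := nonEdgesT_steps_le G (S ++ C)
  rw [List.length_append] at c1
  by_cases he : nonEdges G (S ++ C).toFinset ≤ k
  · simp only [irSolver, Timed.val_bind, Timed.steps_bind, appendT_val, appendT_steps,
      nonEdgesT_val G hnd, if_pos he, Timed.val_pure, Timed.steps_pure]
    have c2 : S.length + 1 ≤ (S.length + C.length + 1) ^ 2 :=
      (by omega : _ ≤ S.length + C.length + 1).trans (Nat.le_self_pow two_ne_zero _)
    refine ⟨hnd, he, fun T hT => ?_, by omega⟩
    rw [← List.toFinset_card_of_nodup hnd]
    exact Finset.card_le_card hT.2.2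
  · have hC := hC.resolve_left he
    have hSnd : S.Nodup := hnd.of_append_left
    have hCnd : C.Nodup := hnd.of_append_right
    have c2 := nonEdgesT_steps_le G S
    have c3 := irTables_steps_le (G := G) S C C (fun _ => 0) (fun _ => [])
    obtain ⟨t1, t2⟩ := irTables_val (G := G) S C C (fun _ => 0) (fun _ => [])
    have hst : IRState G k S C (irTables G S C C (fun _ => 0) (fun _ => [])).val.1
        (irTables G S C C (fun _ => 0) (fun _ => [])).val.2 (nonEdges G S.toFinset) := by
      refine ⟨hnd, rfl, hdef, fun v hv => ?_, fun v hv => ?_, fun v hv w => ?_, hC⟩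
      · rw [t1, if_pos hv, length_filter_nonAdj G hSnd]
      · rw [t2, if_pos hv]; exact hCnd.filter _
      · rw [t2, if_pos hv]; simp
    obtain ⟨i1, i2, i3, i4⟩ := irLoop_spec sel (C.length + 1) S C _ _ _ hst (by omega)
    simp only [irSolver, Timed.val_bind, Timed.steps_bind, appendT_val, appendT_steps,
      nonEdgesT_val G hnd, nonEdgesT_val G hSnd, if_neg he]
    refine ⟨i1, i2, i3, ?_⟩
    nlinarith

end

/-! ### One call of the branch-and-bound recursion -/

section

variable {n : ℕ} {G : SimpleGraph (Fin n)} [DecidableRel G.Adj] {k : ℕ}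

/-- A list of distinct vertices that induce a `k`-defective clique. -/
def IsFeasible (G : SimpleGraph (Fin n)) [DecidableRel G.Adj] (k : ℕ) (L : List (Fin n)) : Prop :=
  L.Nodup ∧ IsDefective G k L.toFinset

theorem IsFeasible.length_le {L : List (Fin n)} (h : IsFeasible G k L) :
    L.length ≤ defectiveNumber G k := by
  rw [← List.toFinset_card_of_nodup h.1]
  exact Finset.le_sup (f := Finset.card) (Finset.mem_filter.2 ⟨Finset.mem_univ _, h.2⟩)

theorem IsDefective.mono {A B : Finset (Fin n)} (h : IsDefective G k B) (hAB : A ⊆ B) :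
    IsDefective G k A :=
  (nonEdges_mono G hAB).trans h

theorem IsBranch.sublist {S C C' : List (Fin n)} (h : IsBranch G k S C) (hC : C'.Sublist C) :
    IsBranch G k S C' :=
  ⟨h.1.sublist (hC.append_left S), h.2⟩

/-- A bound for the cost of a single call of `bbRec`, apart from the recursive calls, on a branch
with fewer than `L` vertices. -/
def callCost (G : SimpleGraph (Fin n)) [DecidableRel G.Adj] (k M L : ℕ) : ℕ :=
  (2 * M + 100) * L ^ 2 + 2 * defectiveNumber G k

/-- A call of `bbRec` shrinks the candidate list to some `C₂`, and then either solves the branch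
or makes two recursive calls. -/
theorem bbRec_step {P : Pruning n} {M : ℕ} (hP : P.Admissible G k M)
    (piv sel : List (Fin n) → List (Fin n) → ℕ) (fuel : ℕ) {S C best : List (Fin n)}
    (hbr : IsBranch G k S C) (hbest : IsFeasible G k best) {L : ℕ}
    (hL : S.length + C.length + 1 ≤ L) :
    (IsFeasible G k (bbRec G k P piv sel (fuel + 1) S C best).val ∧
      best.length ≤ (bbRec G k P piv sel (fuel + 1) S C best).val.length ∧
      (∀ T, IsSolution G k S C T →
        T.card ≤ (bbRec G k P piv sel (fuel + 1) S C best).val.length) ∧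
      (bbRec G k P piv sel (fuel + 1) S C best).steps ≤ callCost G k M L) ∨
    ∃ C₂ : List (Fin n), C₂.Sublist C ∧
      (∀ T, IsSolution G k S C T → best.length < T.card →
        ∃ T', IsSolution G k S C₂ T' ∧ T.card ≤ T'.card) ∧
      ∃ p ∈ C₂, IsDefective G k (insert p S.toFinset) ∧
        (bbRec G k P piv sel (fuel + 1) S C best).val =
          (bbRec G k P piv sel fuel S (C₂.erase p)
            (bbRec G k P piv sel fuel (p :: S) (C₂.erase p) best).val).val ∧
        (bbRec G k P piv sel (fuel + 1) S C best).steps ≤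
          callCost G k M L + (bbRec G k P piv sel fuel (p :: S) (C₂.erase p) best).steps +
            (bbRec G k P piv sel fuel S (C₂.erase p)
              (bbRec G k P piv sel fuel (p :: S) (C₂.erase p) best).val).steps := by
  have hSnd : S.Nodup := hbr.1.of_append_left
  have hCnd : C.Nodup := hbr.1.of_append_right
  have hω := hbest.length_le
  have hL1 : 1 ≤ L := by omega
  have hLL : L ≤ L ^ 2 := by nlinarith
  have hsq : ∀ s c : ℕ, s + c + 1 ≤ L → M * (s + c + 1) ^ 2 ≤ M * L ^ 2 := fun s c h =>
    Nat.mul_le_mul_left _ (Nat.pow_le_pow_left h 2)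
  have c0 := (hP.bound_steps S C hbr).trans (hsq _ _ hL)
  have hcc : callCost G k M L = 2 * (M * L ^ 2) + 100 * L ^ 2 + 2 * defectiveNumber G k := by
    rw [callCost]; ring
  generalize callCost G k M L = D at hcc ⊢
  by_cases hub : (P.bound S C).val ≤ best.length
  · left
    simp only [bbRec, Timed.val_bind, Timed.steps_bind, lengthT_val, lengthT_steps, if_pos hub,
      Timed.val_pure, Timed.steps_pure, steps_charge]
    exact ⟨hbest, le_rfl, fun T hT => (hP.bound_valid S C T hbr hT).trans hub, by omega⟩
  simp only [bbRec, Timed.val_bind, Timed.steps_bind, lengthT_val, lengthT_steps, if_neg hub,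
    steps_charge, nonEdgesT_val G hSnd, filterT_val, nonDegT_val, Timed.val_pure, appendT_val,
    appendT_steps, length_filter_nonAdj G hSnd]
  have c1 := (nonEdgesT_steps_le G S).trans (Nat.pow_le_pow_left (by omega : _ ≤ L) 2)
  have c2 := filterT_steps_le (fun v => nonDegT G v S >>= fun d =>
    (pure (decide (nonEdges G S.toFinset + d ≤ k)) : Timed Bool)) C (S.length + 1)
    (fun v _ => (congrArg (· + 0) (nonDegT_steps G v S)).le)
  replace c2 := c2.trans (by nlinarith : _ ≤ 2 * L ^ 2)
  generalize (filterT (fun v => nonDegT G v S >>= fun d =>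
    (pure (decide (nonEdges G S.toFinset + d ≤ k)) : Timed Bool)) C).steps = s2 at c2 ⊢
  generalize (nonEdgesT G S).steps = s1 at c1 ⊢
  set C₁ := C.filter fun v => decide (nonEdges G S.toFinset + nonDeg G S.toFinset v ≤ k) with hC₁
  have hC₁sub : C₁.Sublist C := List.filter_sublist
  have hbr₁ := hbr.sublist hC₁sub
  have hl₁ := hC₁sub.length_le
  have c3 := (hP.keep_steps S C₁ best.length hbr₁).trans (hsq _ _ (by omega))
  have c4 := filterT_steps_le (fun v => (⟨(P.keep S C₁ best.length).val v, 1⟩ : Timed Bool)) C₁ 1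
    (fun _ _ => le_rfl)
  generalize (filterT (fun v => (⟨(P.keep S C₁ best.length).val v, 1⟩ : Timed Bool)) C₁).steps
    = s4 at c4 ⊢
  generalize (P.keep S C₁ best.length).steps = s3 at c3 ⊢
  set C₂ := C₁.filter (P.keep S C₁ best.length).val with hC₂
  have hC₂sub₁ : C₂.Sublist C₁ := List.filter_sublist
  have hl₂ := hC₂sub₁.length_le
  have hC₂sub := hC₂sub₁.trans hC₁sub
  have hbr₂ := hbr.sublist hC₂sub
  have hC₂nd : C₂.Nodup := hCnd.sublist hC₂sub
  have c5 := (nonEdgesT_steps_le G (S ++ C₂)).trans (Nat.pow_le_pow_left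
    (by rw [List.length_append]; omega : _ ≤ L) 2)
  generalize (nonEdgesT G (S ++ C₂)).steps = s5 at c5 ⊢
  have c6 := filterT_steps_le (fun v => nonDegT G v C₂ >>= fun d =>
    (pure (decide (3 ≤ d)) : Timed Bool)) C₂ (C₂.length + 1)
    (fun v _ => (congrArg (· + 0) (nonDegT_steps G v C₂)).le)
  replace c6 := c6.trans (by nlinarith : _ ≤ 2 * L ^ 2)
  generalize (filterT (fun v => nonDegT G v C₂ >>= fun d =>
    (pure (decide (3 ≤ d)) : Timed Bool)) C₂).steps = s6 at c6 ⊢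
  have hdefp : ∀ p ∈ C₂, IsDefective G k (insert p S.toFinset) := by
    intro p hp
    have hp₁ := hC₂sub₁.subset hp
    have hpS : p ∉ S.toFinset := fun h => List.disjoint_of_nodup_append hbr₂.1
      (List.mem_toFinset.1 h) hp
    rw [hC₁, List.mem_filter, decide_eq_true_eq] at hp₁
    rw [IsDefective, nonEdges_insert G hpS]
    exact hp₁.2
  -- the reductions keep the solutions that are better than `best`
  have hkeep : ∀ T, IsSolution G k S C T → best.length < T.card →
      ∃ T', IsSolution G k S C₂ T' ∧ T.card ≤ T'.card := by
    intro T hT hlt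
    refine hP.keep_valid S C₁ best.length T hbr₁ ⟨hT.1, hT.2.1, fun u hu => ?_⟩ hlt
    have huSC := hT.2.2 hu
    simp only [List.mem_toFinset, List.mem_append] at huSC ⊢
    rcases huSC with h | h
    · exact Or.inl h
    · by_cases huS : u ∈ S
      · exact Or.inl huS
      · refine Or.inr (List.mem_filter.2 ⟨h, decide_eq_true ?_⟩)
        rw [← nonEdges_insert G (by simpa using huS)]
        exact hT.1.mono (Finset.insert_subset hu hT.2.1)
  have hthree : C₂.filter (fun v => decide (3 ≤ (C₂.filter fun w =>
      v ≠ w ∧ ¬ G.Adj v w).length)) = [] → ∀ v ∈ C₂, nonDeg G C₂.toFinset v ≤ 2 := by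
    intro h v hv
    have := List.filter_eq_nil_iff.1 h v hv
    rw [decide_eq_true_eq, length_filter_nonAdj G hC₂nd] at this
    omega
  rw [nonEdgesT_val G hbr₂.1]
  set three := C₂.filter (fun v => decide (3 ≤ (C₂.filter fun w =>
      v ≠ w ∧ ¬ G.Adj v w).length)) with hthree_def
  have hl₃ : three.length ≤ C₂.length := List.length_filter_le _ _
  by_cases hterm : nonEdges G (S ++ C₂).toFinset ≤ k ∨ three = []
  · left
    obtain ⟨i1, i2, i3, i4⟩ := irSolver_spec (k := k) sel hbr₂ (hterm.imp_right hthree)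
    replace i4 := i4.trans (Nat.mul_le_mul_left 50 (Nat.pow_le_pow_left (by omega : _ ≤ L) 2))
    have i5 := IsFeasible.length_le ⟨i1, i2⟩
    simp only [if_pos hterm, Timed.val_bind, Timed.steps_bind, Timed.val_pure, Timed.steps_pure,
      lengthT_val, lengthT_steps]
    refine ⟨?_, ?_, ?_, ?_⟩
    · split_ifs
      exacts [⟨i1, i2⟩, hbest]
    · split_ifs <;> omega
    · intro T hT
      have hmax : T.card ≤ best.length ∨ T.card ≤ (irSolver G k sel S C₂).val.length := by
        by_contra! hcon
        obtain ⟨T', h1, h2⟩ := hkeep T hT hcon.1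
        have := i3 T' h1
        omega
      split_ifs <;> omega
    · omega
  · right
    refine ⟨C₂, hC₂sub, hkeep, ?_⟩
    simp only [if_neg hterm, Timed.val_bind, Timed.steps_bind, filterT_val, Timed.val_pure,
      chooseT_val, chooseT_steps, nonDegT_val]
    have c7 := filterT_steps_le (fun v => nonDegT G v S >>= fun d =>
      (pure (decide (1 ≤ d)) : Timed Bool)) three (S.length + 1)
      (fun v _ => (congrArg (· + 0) (nonDegT_steps G v S)).le)
    replace c7 := c7.trans (by nlinarith : _ ≤ 2 * L ^ 2)
    generalize (filterT (fun v => nonDegT G v S >>= fun d =>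
      (pure (decide (1 ≤ d)) : Timed Bool)) three).steps = s7 at c7 ⊢
    set threeS := three.filter (fun v => decide (1 ≤ (S.filter fun w =>
      v ≠ w ∧ ¬ G.Adj v w).length)) with hthreeS
    have hl₄ : threeS.length ≤ three.length := List.length_filter_le _ _
    have hne : (if threeS = [] then three else threeS) ≠ [] := by
      split_ifs with h
      · exact fun h' => hterm (Or.inr h')
      · exact h
    have hl₅ : (if threeS = [] then three else threeS).length ≤ C₂.length := by
      split_ifs <;> omega
    obtain ⟨p, hp, hsome⟩ := exists_mem_choose (piv S C₂) hne
    have hpC₂ : p ∈ C₂ := by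
      split_ifs at hp
      · exact List.mem_of_mem_filter hp
      · exact List.mem_of_mem_filter (List.mem_of_mem_filter hp)
    refine ⟨p, hpC₂, hdefp p hpC₂, ?_, ?_⟩
    · rw [hsome]
      rfl
    · rw [hsome]
      simp only [Timed.steps_bind, eraseT_val, eraseT_steps]
      generalize (bbRec G k P piv sel fuel S (C₂.erase p)
        (bbRec G k P piv sel fuel (p :: S) (C₂.erase p) best).val).steps = B
      generalize (bbRec G k P piv sel fuel (p :: S) (C₂.erase p) best).steps = A
      linarith

end

/-! ### The size of the search tree -/

section

variable {n : ℕ} {G : SimpleGraph (Fin n)} [DecidableRel G.Adj] {k : ℕ}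

theorem IsBranch.cons_erase {S C : List (Fin n)} {p : Fin n} (h : IsBranch G k S C) (hp : p ∈ C)
    (hdef : IsDefective G k (insert p S.toFinset)) : IsBranch G k (p :: S) (C.erase p) := by
  refine ⟨(List.Perm.nodup_iff ?_).1 h.1, by rwa [List.toFinset_cons]⟩
  exact ((List.perm_cons_erase hp).append_left S).trans List.perm_middle

/-- The recursion returns a feasible solution that is at least as large as `best` and as every
solution of the branch. -/
theorem bbRec_spec {P : Pruning n} {M : ℕ} (hP : P.Admissible G k M)
    (piv sel : List (Fin n) → List (Fin n) → ℕ) (fuel : ℕ) :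
    ∀ S C best : List (Fin n), IsBranch G k S C → IsFeasible G k best → C.length < fuel →
      IsFeasible G k (bbRec G k P piv sel fuel S C best).val ∧
      best.length ≤ (bbRec G k P piv sel fuel S C best).val.length ∧
      ∀ T, IsSolution G k S C T → T.card ≤ (bbRec G k P piv sel fuel S C best).val.length := by
  induction fuel with
  | zero => intro S C best _ _ h; omega
  | succ fuel ih =>
    intro S C best hbr hbest hfuel
    rcases bbRec_step hP piv sel fuel hbr hbest le_rfl with ⟨h1, h2, h3, -⟩ |
      ⟨C₂, hC₂, hkeep, p, hp, hdef, hval, -⟩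
    · exact ⟨h1, h2, h3⟩
    have hbr₂ := hbr.sublist hC₂
    have hlen : (C₂.erase p).length < fuel := by
      have := hC₂.length_le
      have := List.length_pos_of_mem hp
      rw [List.length_erase_of_mem hp]
      omega
    obtain ⟨i1, i2, i3⟩ := ih _ _ best (hbr₂.cons_erase hp hdef) hbest hlen
    obtain ⟨j1, j2, j3⟩ := ih _ _ _ (hbr₂.sublist (List.erase_sublist (a := p))) i1 hlen
    rw [hval]
    refine ⟨j1, i2.trans j2, fun T hT => ?_⟩
    by_contra! hcon
    obtain ⟨T', hT', hTT'⟩ := hkeep T hT (by omega)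
    by_cases hpT : p ∈ T'
    · refine absurd (i3 T' ⟨hT'.1, ?_, fun u hu => ?_⟩) (by omega)
      · rw [List.toFinset_cons]
        exact Finset.insert_subset hpT hT'.2.1
      · have := hT'.2.2 hu
        simp only [List.mem_toFinset, List.mem_append, List.mem_cons] at this ⊢
        by_cases hup : u = p
        · simp [hup]
        · rw [List.mem_erase_of_ne hup]; tauto
    · refine absurd (j3 T' ⟨hT'.1, hT'.2.1, fun u hu => ?_⟩) (by omega)
      have := hT'.2.2 hu
      simp only [List.mem_toFinset, List.mem_append] at this ⊢
      rwa [List.mem_erase_of_ne (by rintro rfl; exact hpT hu)]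

/-- `Φ` bounds the number of calls in the search tree below a branch, for branches that satisfy an
invariant `I` of the partial solution. -/
structure IsTreeBound (G : SimpleGraph (Fin n)) [DecidableRel G.Adj] (k : ℕ)
    (I : List (Fin n) → Prop) (Φ : List (Fin n) → List (Fin n) → ℕ) : Prop where
  one_le : ∀ S C, 1 ≤ Φ S C
  mono : ∀ S C C', C'.Sublist C → Φ S C' ≤ Φ S C
  inv : ∀ S p, I S → I (p :: S)
  step : ∀ S C p, IsBranch G k S C → IsDefective G k (insert p S.toFinset) → I S → p ∈ C →
    1 + Φ (p :: S) (C.erase p) + Φ S (C.erase p) ≤ Φ S C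

theorem bbRec_steps_le {P : Pruning n} {M : ℕ} (hP : P.Admissible G k M)
    (piv sel : List (Fin n) → List (Fin n) → ℕ) {I : List (Fin n) → Prop}
    {Φ : List (Fin n) → List (Fin n) → ℕ} (hΦ : IsTreeBound G k I Φ) (L fuel : ℕ) :
    ∀ S C best : List (Fin n), IsBranch G k S C → IsFeasible G k best → C.length < fuel → I S →
      S.length + C.length + 1 ≤ L →
      (bbRec G k P piv sel fuel S C best).steps ≤ callCost G k M L * Φ S C := by
  induction fuel with
  | zero => intro S C best _ _ h; omega
  | succ fuel ih =>
    intro S C best hbr hbest hfuel hI hL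
    rcases bbRec_step hP piv sel fuel hbr hbest hL with ⟨-, -, -, h⟩ |
      ⟨C₂, hC₂, -, p, hp, hdef, -, hsteps⟩
    · exact h.trans (Nat.le_mul_of_pos_right _ (hΦ.one_le S C))
    have hbr₂ := hbr.sublist hC₂
    have hlen₂ := hC₂.length_le
    have hlen : (C₂.erase p).length + 1 = C₂.length := by
      have := List.length_pos_of_mem hp
      rw [List.length_erase_of_mem hp]
      omega
    have hbrp := hbr₂.cons_erase hp hdef
    have i1 := (bbRec_spec hP piv sel fuel _ _ best hbrp hbest (by omega)).1
    have i2 := ih _ _ best hbrp hbest (by omega) (hΦ.inv S p hI)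
      (by rw [List.length_cons]; omega)
    have i3 := ih _ _ _ (hbr₂.sublist (List.erase_sublist (a := p))) i1 (by omega) hI (by omega)
    calc _ ≤ callCost G k M L + callCost G k M L * Φ (p :: S) (C₂.erase p) +
          callCost G k M L * Φ S (C₂.erase p) := by linarith
      _ = callCost G k M L * (1 + Φ (p :: S) (C₂.erase p) + Φ S (C₂.erase p)) := by ring
      _ ≤ callCost G k M L * Φ S C := Nat.mul_le_mul_left _
          ((hΦ.step S C₂ p hbr₂ hdef hI hp).trans (hΦ.mono S C C₂ hC₂))

theorem isTreeBound_two_pow :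
    IsTreeBound G k (fun _ => True) fun _ C => 2 ^ (C.length + 1) - 1 where
  one_le S C := by
    have : 2 ≤ 2 ^ (C.length + 1) := Nat.le_self_pow (by omega) 2
    omega
  mono S C C' h := Nat.sub_le_sub_right
    (Nat.pow_le_pow_right (by norm_num) (Nat.add_le_add_right h.length_le 1)) 1
  inv _ _ _ := trivial
  step S C p _ _ _ hp := by
    have h1 : (C.erase p).length + 1 = C.length := by
      have := List.length_pos_of_mem hp
      rw [List.length_erase_of_mem hp]
      omega
    rw [← h1, pow_succ 2 ((C.erase p).length + 1)]
    have : 1 ≤ 2 ^ ((C.erase p).length + 1) := Nat.one_le_two_pow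
    omega

/-- A bound for the number of nodes of a search tree over `b` candidates in which at most `r`
candidates can be included, not counting inclusions among `a` special ones. -/
def nodeBound (a b r : ℕ) : ℕ := 2 ^ (a + 1) * (b + 1) ^ (r + 1) - 1

theorem two_le_pow_mul (a b r : ℕ) : 2 ≤ 2 ^ (a + 1) * (b + 1) ^ (r + 1) := by
  have h1 : 2 ≤ 2 ^ (a + 1) := Nat.le_self_pow (by omega) 2
  have h2 : 1 ≤ (b + 1) ^ (r + 1) := Nat.one_le_pow _ _ (by omega)
  nlinarith

theorem nodeBound_mono {a a' b b' r r' : ℕ} (ha : a ≤ a') (hb : b ≤ b') (hr : r ≤ r') :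
    nodeBound a b r ≤ nodeBound a' b' r' := by
  refine Nat.sub_le_sub_right (Nat.mul_le_mul (Nat.pow_le_pow_right (by norm_num) (by omega)) ?_) 1
  exact (Nat.pow_le_pow_left (by omega) _).trans (Nat.pow_le_pow_right (by omega) (by omega))

/-- Branching on a special candidate leaves the budget `r` as it is. -/
theorem nodeBound_special (a b r : ℕ) :
    1 + nodeBound a b r + nodeBound a b r ≤ nodeBound (a + 1) (b + 1) r := by
  have h1 := two_le_pow_mul a b r
  have h2 : 2 * (2 ^ (a + 1) * (b + 1) ^ (r + 1)) ≤
      2 ^ (a + 1 + 1) * (b + 1 + 1) ^ (r + 1) := by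
    rw [pow_succ 2 (a + 1), ← mul_assoc, mul_comm 2 (2 ^ (a + 1))]
    exact Nat.mul_le_mul_left _ (Nat.pow_le_pow_left (by omega) _)
  simp only [nodeBound]
  omega

/-- Branching on an ordinary candidate uses up one unit of the budget in the first branch. -/
theorem nodeBound_ordinary (a b r : ℕ) :
    1 + nodeBound a b r + nodeBound a b (r + 1) ≤ nodeBound a (b + 1) (r + 1) := by
  have h1 := two_le_pow_mul a b r
  have h2 := two_le_pow_mul a b (r + 1)
  have h3 : 2 ^ (a + 1) * (b + 1) ^ (r + 1) + 2 ^ (a + 1) * (b + 1) ^ (r + 1 + 1) ≤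
      2 ^ (a + 1) * (b + 1 + 1) ^ (r + 1 + 1) := by
    calc _ = 2 ^ (a + 1) * ((b + 1) ^ (r + 1) * (b + 1 + 1)) := by ring
      _ ≤ _ := Nat.mul_le_mul_left _ ?_
    rw [pow_succ (b + 1 + 1)]
    exact Nat.mul_le_mul_right _ (Nat.pow_le_pow_left (by omega) _)
  simp only [nodeBound]
  omega

/-- Partial solutions have at most `defectiveNumber G k` vertices. -/
theorem isTreeBound_card : IsTreeBound G k (fun _ => True)
    fun S C => nodeBound 0 C.length (defectiveNumber G k - S.length) where
  one_le S C := by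
    have := two_le_pow_mul 0 C.length (defectiveNumber G k - S.length)
    simp only [nodeBound]
    omega
  mono S C C' h := nodeBound_mono le_rfl h.length_le le_rfl
  inv _ _ _ := trivial
  step S C p hbr hdef _ hp := by
    have h1 : (C.erase p).length + 1 = C.length := by
      have := List.length_pos_of_mem hp
      rw [List.length_erase_of_mem hp]
      omega
    have hb := hbr.cons_erase hp hdef
    have h2 : (p :: S).length ≤ defectiveNumber G k :=
      IsFeasible.length_le ⟨hb.1.of_append_left, hb.2⟩
    rw [List.length_cons] at h2 ⊢
    obtain ⟨r, hr⟩ : ∃ r, defectiveNumber G k - S.length = r + 1 :=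
        ⟨_, (Nat.succ_pred (by omega)).symm⟩
    rw [show defectiveNumber G k - (S.length + 1) = r by omega, hr, ← h1]
    exact nodeBound_ordinary _ _ _

/-- If `v` belongs to the partial solution, then every further vertex is a neighbour of `v` or
costs at least one of the `k` non-edges. -/
theorem isTreeBound_adj (v : Fin n) : IsTreeBound G k (fun S => v ∈ S)
    fun S C => nodeBound (C.filter (G.Adj v)).length C.length (k - nonEdges G S.toFinset) where
  one_le S C := by
    have := two_le_pow_mul (C.filter (G.Adj v)).length C.length (k - nonEdges G S.toFinset)
    simp only [nodeBound]
    omega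
  mono S C C' h := nodeBound_mono (h.filter _).length_le h.length_le le_rfl
  inv _ _ h := List.mem_cons_of_mem _ h
  step S C p hbr hdef hv hp := by
    have h1 : (C.erase p).length + 1 = C.length := by
      have := List.length_pos_of_mem hp
      rw [List.length_erase_of_mem hp]
      omega
    have hpS : p ∉ S := fun h => List.disjoint_of_nodup_append hbr.1 h hp
    have hins := nonEdges_insert G (T := S.toFinset) (v := p) (by simpa using hpS)
    have hdef' : nonEdges G (insert p S.toFinset) ≤ k := hdef
    have hperm := (List.perm_cons_erase hp).filter (fun u => decide (G.Adj v u))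
    rw [List.toFinset_cons]
    by_cases hadj : G.Adj v p
    · rw [List.filter_cons_of_pos (by simpa using hadj)] at hperm
      rw [hperm.length_eq, List.length_cons, ← h1]
      refine le_trans ?_ (nodeBound_special _ _ _)
      gcongr
      exact nodeBound_mono le_rfl le_rfl (by omega)
    · rw [List.filter_cons_of_neg (by simpa using hadj)] at hperm
      have hpos : 1 ≤ nonDeg G S.toFinset p := nonDeg_pos G (a := v) (by simpa using hv)
        ⟨by rintro rfl; exact hpS hv, fun h => hadj h.symm⟩
      obtain ⟨r, hr⟩ : ∃ r, k - nonEdges G S.toFinset = r + 1 :=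
        ⟨_, (Nat.succ_pred (by omega)).symm⟩
      rw [hperm.length_eq, hr, ← h1]
      refine le_trans ?_ (nodeBound_ordinary _ _ _)
      gcongr
      exact nodeBound_mono le_rfl le_rfl (by omega)

end

/-! ### The degeneracy ordering -/

section

variable {n : ℕ} {G : SimpleGraph (Fin n)} [DecidableRel G.Adj]

/-- Every vertex of the list has at most `d` neighbours further down the list. -/
def LaterDegLE (G : SimpleGraph (Fin n)) [DecidableRel G.Adj] (d : ℕ) : List (Fin n) → Prop
  | [] => True
  | v :: L => (L.filter (G.Adj v)).length ≤ d ∧ LaterDegLE G d L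

theorem exists_degree_le_degeneracy (G : SimpleGraph (Fin n)) [DecidableRel G.Adj]
    {T : Finset (Fin n)} (hT : T.Nonempty) :
    ∃ v ∈ T, (T.filter (fun w => G.Adj v w)).card ≤ degeneracy G := by
  have h : {d : ℕ | ∀ T : Finset (Fin n), T.Nonempty →
      ∃ v ∈ T, (T.filter (fun w => G.Adj v w)).card ≤ d}.Nonempty :=
    ⟨n, fun T ⟨v, hv⟩ => ⟨v, hv, (Finset.card_le_univ _).trans (by simp)⟩⟩
  exact Nat.sInf_mem h T hT

theorem fillBuckets_spec (nb : Fin n → List (Fin n)) (L : List (Fin n)) :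
    ∀ (deg : Fin n → ℕ) (bucket : ℕ → List (Fin n)),
      (∀ u, (fillBuckets nb L deg bucket).val.1 u = if u ∈ L then (nb u).length else deg u) ∧
      (∀ i, bucket i ⊆ (fillBuckets nb L deg bucket).val.2 i) ∧
      (∀ u ∈ L, u ∈ (fillBuckets nb L deg bucket).val.2 (nb u).length) ∧
      ∑ i ∈ Finset.range n, ((fillBuckets nb L deg bucket).val.2 i).length ≤
        ∑ i ∈ Finset.range n, (bucket i).length + L.length ∧
      (fillBuckets nb L deg bucket).steps = (L.map fun u => (nb u).length + 2).sum + 1 := by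
  induction L with
  | nil => intro deg bucket; simp [fillBuckets]
  | cons v L ih =>
    intro deg bucket
    obtain ⟨h1, h2, h3, h4, h5⟩ := ih (Function.update deg v (nb v).length)
      (Function.update bucket (nb v).length (v :: bucket (nb v).length))
    simp only [fillBuckets, Timed.val_bind, Timed.steps_bind, lengthT_val, lengthT_steps,
      steps_charge]
    refine ⟨fun u => ?_, fun i => ?_, fun u hu => ?_, h4.trans ?_, ?_⟩
    · rw [h1]
      by_cases e1 : u ∈ L
      · simp [e1]
      · by_cases e2 : u = v
        · subst e2; simp
        · simp [e1, e2]
    · refine List.Subset.trans ?_ (h2 i)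
      by_cases e : i = (nb v).length
      · subst e; simp
      · simp [e]
    · rcases List.mem_cons.1 hu with rfl | hu
      · exact h2 _ (by simp)
      · exact h3 u hu
    · rw [List.length_cons]
      by_cases e : (nb v).length ∈ Finset.range n
      · rw [← Finset.add_sum_erase _ _ e, ← Finset.add_sum_erase _ (fun i => (bucket i).length) e,
          Finset.sum_congr rfl fun i hi => by
            rw [Function.update_of_ne (Finset.ne_of_mem_erase hi)]]
        simp
        omega
      · rw [Finset.sum_congr rfl fun i hi => by
            rw [Function.update_of_ne (by rintro rfl; exact e hi)]]
        omega
    · rw [h5, List.map_cons, List.sum_cons]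
      omega

theorem lowerDegrees_spec (gone : Fin n → Bool) (L : List (Fin n)) :
    ∀ (deg : Fin n → ℕ) (bucket : ℕ → List (Fin n)), L.Nodup →
      (∀ u, (lowerDegrees gone L deg bucket).val.1 u =
        if u ∈ L ∧ gone u = false then deg u - 1 else deg u) ∧
      (∀ i, bucket i ⊆ (lowerDegrees gone L deg bucket).val.2 i) ∧
      (∀ u ∈ L, gone u = false → u ∈ (lowerDegrees gone L deg bucket).val.2 (deg u - 1)) ∧
      ∑ i ∈ Finset.range n, ((lowerDegrees gone L deg bucket).val.2 i).length ≤
        ∑ i ∈ Finset.range n, (bucket i).length + (L.filter fun u => gone u = false).length ∧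
      (lowerDegrees gone L deg bucket).steps = L.length + 1 := by
  induction L with
  | nil => intro deg bucket _; simp [lowerDegrees]
  | cons v L ih =>
    intro deg bucket hnd
    obtain ⟨hv, hnd⟩ := List.nodup_cons.1 hnd
    by_cases hg : gone v = true
    · obtain ⟨h1, h2, h3, h4, h5⟩ := ih deg bucket hnd
      simp only [lowerDegrees, Timed.val_bind, Timed.steps_bind, steps_charge, if_pos hg]
      refine ⟨fun u => ?_, h2, fun u hu hgu => ?_, ?_, ?_⟩
      · rw [h1]
        by_cases e2 : u = v
        · subst e2; simp [hg]
        · simp [e2]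
      · rcases List.mem_cons.1 hu with rfl | hu
        · simp [hg] at hgu
        · exact h3 u hu hgu
      · rwa [List.filter_cons_of_neg (by simp [hg])]
      · rw [h5, List.length_cons]; omega
    · obtain ⟨h1, h2, h3, h4, h5⟩ := ih (Function.update deg v (deg v - 1))
        (Function.update bucket (deg v - 1) (v :: bucket (deg v - 1))) hnd
      simp only [lowerDegrees, Timed.val_bind, Timed.steps_bind, steps_charge, if_neg hg]
      refine ⟨fun u => ?_, fun i => ?_, fun u hu hgu => ?_, h4.trans ?_, ?_⟩
      · rw [h1]
        by_cases e2 : u = v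
        · subst e2; simp [hv, hg]
        · simp [e2]
      · refine List.Subset.trans ?_ (h2 i)
        by_cases e : i = deg v - 1
        · subst e; simp
        · simp [e]
      · rcases List.mem_cons.1 hu with rfl | huL
        · exact h2 _ (by simp)
        · have := h3 u huL hgu
          rwa [Function.update_of_ne (by rintro rfl; exact hv huL)] at this
      · rw [List.filter_cons_of_pos (by simpa using hg), List.length_cons]
        by_cases e : deg v - 1 ∈ Finset.range n
        · rw [← Finset.add_sum_erase _ _ e,
            ← Finset.add_sum_erase _ (fun i => (bucket i).length) e,
            Finset.sum_congr rfl fun i hi => by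
              rw [Function.update_of_ne (Finset.ne_of_mem_erase hi)]]
          simp
          omega
        · rw [Finset.sum_congr rfl fun i hi => by
              rw [Function.update_of_ne (by rintro rfl; exact e hi)]]
          omega
      · rw [h5, List.length_cons]; omega

/-- The number of neighbours of `u` in `R`. -/
def degIn (G : SimpleGraph (Fin n)) [DecidableRel G.Adj] (R : Finset (Fin n)) (u : Fin n) : ℕ :=
  (R.filter (G.Adj u)).card

theorem degIn_erase (R : Finset (Fin n)) {v : Fin n} (hv : v ∈ R) (u : Fin n) :
    degIn G R u = degIn G (R.erase v) u + if G.Adj u v then 1 else 0 := by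
  rw [degIn, ← Finset.insert_erase hv, Finset.filter_insert, Finset.erase_insert_eq_erase,
    Finset.erase_idem]
  split_ifs
  · rw [Finset.card_insert_of_notMem (by simp)]; rfl
  · rfl

theorem sum_degIn_erase (R : Finset (Fin n)) {v : Fin n} (hv : v ∈ R) :
    ∑ u ∈ R, degIn G R u = ∑ u ∈ R.erase v, degIn G (R.erase v) u + 2 * degIn G R v := by
  rw [← Finset.add_sum_erase R _ hv, Finset.sum_congr rfl fun u _ => degIn_erase R hv u,
    Finset.sum_add_distrib, ← Finset.card_filter]
  have : ((R.erase v).filter fun u => G.Adj u v).card = degIn G (R.erase v) v := by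
    simp only [degIn, G.adj_comm]
  have h2 := degIn_erase (G := G) R hv v
  rw [if_neg (G.loopless.irrefl v)] at h2
  omega

/-- The vertices that have not been peeled off. -/
def present (gone : Fin n → Bool) : Finset (Fin n) := Finset.univ.filter fun u => gone u = false

theorem mem_present {gone : Fin n → Bool} {u : Fin n} : u ∈ present gone ↔ gone u = false := by
  simp [present]

/-- The invariant of `peel`. -/
structure PeelState (G : SimpleGraph (Fin n)) [DecidableRel G.Adj] (left d : ℕ) (deg : Fin n → ℕ)
    (gone : Fin n → Bool) (bucket : ℕ → List (Fin n)) : Prop where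
  left_eq : left = (present gone).card
  deg_eq : ∀ u ∈ present gone, deg u = degIn G (present gone) u
  le_deg : ∀ u ∈ present gone, d ≤ deg u
  mem_bucket : ∀ u ∈ present gone, u ∈ bucket (deg u)

/-- A potential that decreases in each round of `peel`. Filing the neighbours of a vertex `v` anew
adds as many bucket entries as `v` has neighbours left, which the sum of the degrees pays for. -/
def peelPotential (G : SimpleGraph (Fin n)) [DecidableRel G.Adj] (d : ℕ)
    (gone : Fin n → Bool) (bucket : ℕ → List (Fin n)) : ℕ :=
  ∑ i ∈ Finset.range n, (bucket i).length + ∑ u ∈ present gone, degIn G (present gone) u +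
    (n - d) + (present gone).card

theorem sum_length_pop {bucket : ℕ → List (Fin n)} {d : ℕ} {v : Fin n} {rest : List (Fin n)}
    (hd : d < n) (hb : bucket d = v :: rest) :
    ∑ i ∈ Finset.range n, (Function.update bucket d rest i).length + 1 =
      ∑ i ∈ Finset.range n, (bucket i).length := by
  rw [← Finset.add_sum_erase _ _ (Finset.mem_range.2 hd),
    ← Finset.add_sum_erase _ (fun i => (bucket i).length) (Finset.mem_range.2 hd),
    Finset.sum_congr rfl fun i hi => by rw [Function.update_of_ne (Finset.ne_of_mem_erase hi)]]
  simp [hb]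
  omega

theorem degIn_lt (R : Finset (Fin n)) (u : Fin n) : degIn G R u < n := by
  have : R.filter (G.Adj u) ⊂ Finset.univ :=
    Finset.ssubset_univ_iff.2 fun h => by
      have := h ▸ Finset.mem_univ u
      simp at this
  simpa [degIn] using Finset.card_lt_card this

/-- The fuel is not exhausted, the ordering has the degeneracy property, and the steps are paid for
by the potential and by the lengths of the adjacency lists. -/
theorem peel_spec {nb : Fin n → List (Fin n)} (hnb : IsAdjLists G nb) (fuel : ℕ) :
    ∀ (left d : ℕ) (deg : Fin n → ℕ) (gone : Fin n → Bool) (bucket : ℕ → List (Fin n)),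
      PeelState G left d deg gone bucket → peelPotential G d gone bucket < fuel →
      (peel nb fuel left d deg gone bucket).val.Nodup ∧
      (∀ u, u ∈ (peel nb fuel left d deg gone bucket).val ↔ u ∈ present gone) ∧
      LaterDegLE G (degeneracy G) (peel nb fuel left d deg gone bucket).val ∧
      (peel nb fuel left d deg gone bucket).steps ≤
        peelPotential G d gone bucket + 1 + ∑ u ∈ present gone, ((nb u).length + 1) := by
  induction fuel with
  | zero => intro left d deg gone bucket _ h; omega
  | succ fuel ih =>
    intro left d deg gone bucket h hfuel
    by_cases hleft : left = 0
    · have hR : present gone = ∅ := Finset.card_eq_zero.1 (h.left_eq ▸ hleft)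
      simp only [peel, Timed.val_bind, Timed.steps_bind, if_pos hleft, steps_charge,
        Timed.val_pure, Timed.steps_pure, hR]
      refine ⟨List.nodup_nil, by simp, trivial, by omega⟩
    have hRne : (present gone).Nonempty := by
      rw [← Finset.card_pos, ← h.left_eq]; omega
    have hdn : d < n := by
      obtain ⟨u, hu⟩ := hRne
      have h1 := h.le_deg u hu
      rw [h.deg_eq u hu] at h1
      exact h1.trans_lt (degIn_lt _ u)
    cases hb : bucket d with
    | nil =>
      have hst : PeelState G left (d + 1) deg gone bucket := by
        refine ⟨h.left_eq, h.deg_eq, fun u hu => ?_, h.mem_bucket⟩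
        refine lt_of_le_of_ne (h.le_deg u hu) fun e => ?_
        have := h.mem_bucket u hu
        rw [← e, hb] at this
        simp at this
      have hpot : peelPotential G (d + 1) gone bucket + 1 = peelPotential G d gone bucket := by
        simp only [peelPotential]; omega
      obtain ⟨i1, i2, i3, i4⟩ := ih left (d + 1) deg gone bucket hst (by omega)
      simp only [peel, Timed.val_bind, Timed.steps_bind, if_neg hleft, steps_charge, hb]
      exact ⟨i1, i2, i3, by omega⟩
    | cons v rest =>
      have hpop := sum_length_pop hdn hb
      by_cases hstale : (gone v || decide (deg v ≠ d)) = true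
      · have hst : PeelState G left d deg gone (Function.update bucket d rest) := by
          refine ⟨h.left_eq, h.deg_eq, h.le_deg, fun u hu => ?_⟩
          by_cases e : deg u = d
          · rw [e, Function.update_self]
            have hm := h.mem_bucket u hu
            rw [e, hb, List.mem_cons] at hm
            refine hm.resolve_left ?_
            rintro rfl
            simp [mem_present.1 hu, e] at hstale
          · rw [Function.update_of_ne e]
            exact h.mem_bucket u hu
        have hpot : peelPotential G d gone (Function.update bucket d rest) + 1 =
            peelPotential G d gone bucket := by
          simp only [peelPotential]; omega
        obtain ⟨i1, i2, i3, i4⟩ := ih left d deg gone _ hst (by omega)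
        simp only [peel, Timed.val_bind, Timed.steps_bind, if_neg hleft, steps_charge, hb,
          if_pos hstale]
        exact ⟨i1, i2, i3, by omega⟩
      · have hv : v ∈ present gone := mem_present.2 (by
          cases hgv : gone v <;> simp_all)
        have hdv : deg v = d := by
          by_contra hne; simp [hne] at hstale
        have hR' : present (Function.update gone v true) = (present gone).erase v := by
          ext u
          by_cases e : u = v
          · subst e; simp [mem_present]
          · simp [mem_present, e]
        set gone' := Function.update gone v true with hgone'
        obtain ⟨l1, l2, l3, l4, l5⟩ := lowerDegrees_spec gone' (nb v) deg
          (Function.update bucket d rest) (hnb v).1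
        set r := (lowerDegrees gone' (nb v) deg (Function.update bucket d rest)).val with hr
        have hlen : ((nb v).filter fun u => gone' u = false).length = degIn G (present gone) v := by
          rw [← List.toFinset_card_of_nodup ((hnb v).1.filter _), degIn]
          congr 1
          ext u
          simp only [List.toFinset_filter, Finset.mem_filter, List.mem_toFinset, (hnb v).2,
            decide_eq_true_eq, mem_present]
          constructor
          · rintro ⟨e1, e2⟩
            rw [hgone', Function.update_of_ne e1.ne'] at e2
            exact ⟨e2, e1⟩
          · rintro ⟨e1, e2⟩
            rw [hgone', Function.update_of_ne e2.ne']
            exact ⟨e2, e1⟩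
        have hdeg' : ∀ u ∈ present gone', r.1 u = degIn G (present gone') u := by
          intro u hu
          have huR : u ∈ present gone := by rw [hR'] at hu; exact Finset.mem_of_mem_erase hu
          have e1 := degIn_erase (G := G) (present gone) hv u
          rw [← hR', ← h.deg_eq u huR] at e1
          have e3 : u ∈ nb v ↔ G.Adj u v := by rw [(hnb v).2, G.adj_comm]
          rw [l1]
          by_cases e2 : G.Adj u v
          · rw [if_pos ⟨e3.2 e2, mem_present.1 hu⟩, e1, if_pos e2]; omega
          · rw [if_neg fun h => e2 (e3.1 h.1), e1, if_neg e2]; omega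
        have hst : PeelState G (left - 1) (d - 1) r.1 gone' r.2 := by
          refine ⟨?_, hdeg', fun u hu => ?_, fun u hu => ?_⟩
          · rw [hR', Finset.card_erase_of_mem hv, h.left_eq]
          · have huR : u ∈ present gone := by rw [hR'] at hu; exact Finset.mem_of_mem_erase hu
            have e1 := h.le_deg u huR
            rw [l1]
            split_ifs <;> omega
          · have huR : u ∈ present gone := by rw [hR'] at hu; exact Finset.mem_of_mem_erase hu
            have huv : u ≠ v := by rw [hR'] at hu; exact Finset.ne_of_mem_erase hu
            rw [l1]
            split_ifs with e
            · exact l3 u e.1 e.2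
            · refine l2 _ ?_
              have hm := h.mem_bucket u huR
              by_cases e3 : deg u = d
              · rw [e3, Function.update_self]
                rw [e3, hb, List.mem_cons] at hm
                exact hm.resolve_left huv
              · rwa [Function.update_of_ne e3]
        have hsum := sum_degIn_erase (G := G) (present gone) hv
        have hcard := Finset.card_erase_add_one hv
        have hpot : peelPotential G (d - 1) gone' r.2 + 1 ≤ peelPotential G d gone bucket := by
          simp only [peelPotential, hR']
          omega
        obtain ⟨i1, i2, i3, i4⟩ := ih (left - 1) (d - 1) r.1 gone' r.2 hst (by omega)
        simp only [peel, Timed.val_bind, Timed.steps_bind, if_neg hleft, steps_charge, hb,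
          if_neg hstale, Timed.val_pure, Timed.steps_pure]
        rw [← hgone', ← hr]
        have hnotin : v ∉ (peel nb fuel (left - 1) (d - 1) r.1 gone' r.2).val := by
          rw [i2, hR']; exact Finset.notMem_erase v _
        refine ⟨List.nodup_cons.2 ⟨hnotin, i1⟩, fun u => ?_, ⟨?_, i3⟩, ?_⟩
        · rw [List.mem_cons, i2, hR', Finset.mem_erase]
          by_cases e : u = v
          · subst e; simp [hv]
          · simp [e]
        · -- `v` has minimum degree among the vertices that are present
          obtain ⟨w, hw, hwd⟩ := exists_degree_le_degeneracy G hRne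
          have e1 := h.le_deg w hw
          rw [h.deg_eq w hw] at e1
          have e2 := h.deg_eq v hv
          have e3 : ((peel nb fuel (left - 1) (d - 1) r.1 gone' r.2).val.filter
              (G.Adj v)).length = degIn G (present gone') v := by
            rw [← List.toFinset_card_of_nodup (i1.filter _), degIn]
            congr 1
            ext u
            simp [i2]
          have e4 := degIn_erase (G := G) (present gone) hv v
          rw [← hR'] at e4
          have e5 : degIn G (present gone) w ≤ degeneracy G := hwd
          omega
        · have e1 := Finset.add_sum_erase (present gone) (fun u => (nb u).length + 1) hv
          rw [hR'] at i4
          omega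

theorem IsAdjLists.length_eq {nb : Fin n → List (Fin n)} (hnb : IsAdjLists G nb) (v : Fin n) :
    (nb v).length = degIn G Finset.univ v := by
  rw [← List.toFinset_card_of_nodup (hnb v).1, degIn]
  congr 1
  ext u
  simp [(hnb v).2]

theorem IsAdjLists.length_le {nb : Fin n → List (Fin n)} (hnb : IsAdjLists G nb) (v : Fin n) :
    (nb v).length ≤ G.maxDegree := by
  refine le_trans (le_of_eq ?_) (G.degree_le_maxDegree v)
  rw [← List.toFinset_card_of_nodup (hnb v).1, ← SimpleGraph.card_neighborFinset_eq_degree]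
  congr 1
  ext u
  simp [(hnb v).2]

theorem degeneracyOrder_spec {nb : Fin n → List (Fin n)} (hnb : IsAdjLists G nb) :
    (degeneracyOrder nb).val.Nodup ∧ (∀ u, u ∈ (degeneracyOrder nb).val) ∧
    LaterDegLE G (degeneracy G) (degeneracyOrder nb).val ∧
    (degeneracyOrder nb).steps ≤ 7 * n + 3 * (n * G.maxDegree) + 3 := by
  obtain ⟨f1, -, f3, f4, f5⟩ := fillBuckets_spec nb (List.finRange n) (fun _ => 0) (fun _ => [])
  set r := (fillBuckets nb (List.finRange n) (fun _ => 0) (fun _ => [])).val with hr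
  have hR : present (fun _ : Fin n => false) = Finset.univ := by ext; simp [present]
  have hdeg : ∀ u, r.1 u = degIn G Finset.univ u := fun u => by
    rw [f1, if_pos (List.mem_finRange u), hnb.length_eq]
  have hst : PeelState G n 0 r.1 (fun _ => false) r.2 := by
    refine ⟨by rw [hR]; simp, fun u _ => by rw [hR, hdeg], fun _ _ => Nat.zero_le _, fun u _ => ?_⟩
    rw [hdeg, ← hnb.length_eq]
    exact f3 u (List.mem_finRange u)
  have hpot : peelPotential G 0 (fun _ => false) r.2 ≤
      3 * n + ∑ u : Fin n, degIn G Finset.univ u := by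
    simp only [peelPotential, hR]
    simp at f4 ⊢
    omega
  have hb1 : ∑ u : Fin n, degIn G Finset.univ u ≤ n * n := by
    refine (Finset.sum_le_card_nsmul _ _ n fun u _ => (degIn_lt _ u).le).trans ?_
    simp
  have hb2 : ∑ u : Fin n, degIn G Finset.univ u ≤ n * G.maxDegree := by
    refine (Finset.sum_le_card_nsmul _ _ G.maxDegree fun u _ => ?_).trans (by simp)
    rw [← hnb.length_eq]
    exact hnb.length_le u
  have hb3 : ∑ u : Fin n, ((nb u).length + 1) ≤ n * G.maxDegree + n := by
    refine (Finset.sum_le_card_nsmul _ _ (G.maxDegree + 1) fun u _ =>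
      Nat.add_le_add_right (hnb.length_le u) 1).trans ?_
    simp [mul_add]
  have hb4 : ((List.finRange n).map fun u => (nb u).length + 2).sum ≤ n * G.maxDegree + 2 * n := by
    refine (List.sum_le_card_nsmul _ (G.maxDegree + 2) fun x hx => ?_).trans ?_
    · obtain ⟨u, -, rfl⟩ := List.mem_map.1 hx
      exact Nat.add_le_add_right (hnb.length_le u) 2
    · simp; linarith
  obtain ⟨p1, p2, p3, p4⟩ := peel_spec hnb ((n + 2) ^ 2) n 0 r.1 (fun _ => false) r.2 hst
    (by nlinarith)
  simp only [degeneracyOrder, Timed.val_bind, Timed.steps_bind, steps_charge]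
  rw [← hr]
  refine ⟨p1, fun u => (p2 u).2 (by simp [hR]), p3, ?_⟩
  rw [hR] at p4
  omega

end

/-! ### Stage I -/

section

variable {n : ℕ} {G : SimpleGraph (Fin n)} [DecidableRel G.Adj] {k : ℕ}

/-- The state of the search from `v`: `acc` lists the vertices met so far, and exactly these are
marked. -/
structure SearchState (v : Fin n) (done : Fin n → Bool) (mark : Fin n → Option (Fin n))
    (acc : List (Fin n)) : Prop where
  nodup : acc.Nodup
  mark_iff : ∀ u, mark u = some v ↔ u ∈ acc
  ne : ∀ u ∈ acc, u ≠ v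
  not_done : ∀ u ∈ acc, done u = false

theorem addNew_spec {v : Fin n} {done : Fin n → Bool} (L : List (Fin n)) :
    ∀ (mark : Fin n → Option (Fin n)) (acc : List (Fin n)), SearchState v done mark acc →
      SearchState v done (addNew v done L mark acc).val.1 (addNew v done L mark acc).val.2 ∧
      (∀ u, u ∈ (addNew v done L mark acc).val.2 ↔
        u ∈ acc ∨ (u ∈ L ∧ u ≠ v ∧ done u = false)) ∧
      (∀ u x, (addNew v done L mark acc).val.1 u = some x → mark u = some x ∨ x = v) ∧
      (addNew v done L mark acc).steps = L.length + 1 := by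
  induction L with
  | nil => intro mark acc h; simp +contextual [addNew, h]
  | cons w L ih =>
    intro mark acc h
    by_cases hw : w = v ∨ done w = true ∨ mark w = some v
    · obtain ⟨i1, i2, i3, i4⟩ := ih mark acc h
      simp only [addNew, Timed.val_bind, Timed.steps_bind, steps_charge, if_pos hw]
      refine ⟨i1, fun u => ?_, i3, by rw [i4, List.length_cons]; omega⟩
      rw [i2, List.mem_cons]
      by_cases e : u = w
      · subst e
        rw [h.mark_iff] at hw
        rcases hw with rfl | hw | hw
        · simp
        · simp [hw]
        · simp [hw]
      · simp [e]
    · rw [h.mark_iff] at hw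
      push Not at hw
      obtain ⟨hwv, hwd, hwa⟩ := hw
      have hst : SearchState v done (Function.update mark w (some v)) (w :: acc) := by
        refine ⟨List.nodup_cons.2 ⟨hwa, h.nodup⟩, fun u => ?_, fun u hu => ?_, fun u hu => ?_⟩
        · by_cases e : u = w
          · subst e; simp
          · simp [e, h.mark_iff]
        · rcases List.mem_cons.1 hu with rfl | hu
          exacts [hwv, h.ne u hu]
        · rcases List.mem_cons.1 hu with rfl | hu
          exacts [by simpa using hwd, h.not_done u hu]
      obtain ⟨i1, i2, i3, i4⟩ := ih _ _ hst
      have hneg : ¬ (w = v ∨ done w = true ∨ mark w = some v) := by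
        rw [h.mark_iff]; tauto
      simp only [addNew, Timed.val_bind, Timed.steps_bind, steps_charge, if_neg hneg]
      refine ⟨i1, fun u => ?_, fun u x hx => ?_, by rw [i4, List.length_cons]; omega⟩
      · rw [i2, List.mem_cons, List.mem_cons]
        by_cases e : u = w
        · subst e; simp [hwv, hwd]
        · simp [e]
      · rcases i3 u x hx with h1 | h1
        · by_cases e : u = w
          · subst e
            rw [Function.update_self, Option.some_inj] at h1
            exact Or.inr h1.symm
          · rw [Function.update_of_ne e] at h1
            exact Or.inl h1
        · exact Or.inr h1

theorem addNbrs_spec {nb : Fin n → List (Fin n)} {d : ℕ} (hnb : ∀ w, (nb w).length ≤ d)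
    {v : Fin n} {done : Fin n → Bool} (L : List (Fin n)) :
    ∀ (mark : Fin n → Option (Fin n)) (acc : List (Fin n)), SearchState v done mark acc →
      SearchState v done (addNbrs nb v done L mark acc).val.1
        (addNbrs nb v done L mark acc).val.2 ∧
      (∀ u, u ∈ (addNbrs nb v done L mark acc).val.2 ↔
        u ∈ acc ∨ ((∃ w ∈ L, u ∈ nb w) ∧ u ≠ v ∧ done u = false)) ∧
      (∀ u x, (addNbrs nb v done L mark acc).val.1 u = some x → mark u = some x ∨ x = v) ∧
      (addNbrs nb v done L mark acc).steps ≤ L.length * (d + 2) + 1 := by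
  induction L with
  | nil => intro mark acc h; simp +contextual [addNbrs, h]
  | cons w L ih =>
    intro mark acc h
    obtain ⟨a1, a2, a3, a4⟩ := addNew_spec (nb w) mark acc h
    obtain ⟨i1, i2, i3, i4⟩ := ih _ _ a1
    simp only [addNbrs, Timed.val_bind, Timed.steps_bind, steps_charge]
    refine ⟨i1, fun u => ?_, fun u x hx => ?_, ?_⟩
    · rw [i2, a2]
      simp only [List.mem_cons, exists_eq_or_imp]
      tauto
    · rcases i3 u x hx with h1 | h1
      · exact a3 u x h1
      · exact Or.inr h1
    · have := hnb w
      rw [a4, List.length_cons, Nat.add_mul]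
      omega

/-- `u` is at distance one or two from `v`, or `u = v` has a neighbour. -/
def Near (G : SimpleGraph (Fin n)) (v u : Fin n) : Prop :=
  G.Adj v u ∨ ∃ w, G.Adj v w ∧ G.Adj w u

/-- The candidates of the branch of `v`, together with the new marks. -/
def searchFrom (nb : Fin n → List (Fin n)) (v : Fin n) (done : Fin n → Bool)
    (mark : Fin n → Option (Fin n)) : (Fin n → Option (Fin n)) × List (Fin n) :=
  (addNbrs nb v done (nb v) (addNew v done (nb v) mark []).val.1
    (addNew v done (nb v) mark []).val.2).val

theorem searchFrom_spec {nb : Fin n → List (Fin n)} (hnb : IsAdjLists G nb) {v : Fin n}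
    {done : Fin n → Bool} {mark : Fin n → Option (Fin n)} (hmark : ∀ u, mark u ≠ some v) :
    (searchFrom nb v done mark).2.Nodup ∧
    (∀ u, u ∈ (searchFrom nb v done mark).2 ↔ Near G v u ∧ u ≠ v ∧ done u = false) ∧
    (∀ u x, (searchFrom nb v done mark).1 u = some x → mark u = some x ∨ x = v) ∧
    (addNew v done (nb v) mark []).steps +
      (addNbrs nb v done (nb v) (addNew v done (nb v) mark []).val.1
        (addNew v done (nb v) mark []).val.2).steps ≤ (G.maxDegree + 2) ^ 2 := by
  have hst : SearchState v done mark [] :=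
    ⟨List.nodup_nil, by simpa using hmark, by simp, by simp⟩
  obtain ⟨a1, a2, a3, a4⟩ := addNew_spec (nb v) mark [] hst
  obtain ⟨b1, b2, b3, b4⟩ := addNbrs_spec hnb.length_le (nb v) _ _ a1
  refine ⟨b1.nodup, fun u => ?_, fun u x hx => ?_, ?_⟩
  · rw [searchFrom, b2, a2, Near]
    simp only [(hnb _).2, List.not_mem_nil, false_or]
    tauto
  · rcases b3 u x hx with h | h
    · exact a3 u x h
    · exact Or.inr h
  · have := hnb.length_le v
    nlinarith

theorem card_near_le (G : SimpleGraph (Fin n)) [DecidableRel G.Adj] (v : Fin n)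
    {A : Finset (Fin n)} (hA : ∀ u ∈ A, Near G v u) :
    A.card ≤ G.maxDegree ^ 2 + G.maxDegree := by
  have hsub : A ⊆ G.neighborFinset v ∪ (G.neighborFinset v).biUnion
      fun w => G.neighborFinset w := by
    intro u hu
    rcases hA u hu with h | ⟨w, h1, h2⟩
    · exact Finset.mem_union_left _ (by simpa using h)
    · exact Finset.mem_union_right _
        (Finset.mem_biUnion.2 ⟨w, by simpa using h1, by simpa using h2⟩)
  have h1 : (G.neighborFinset v).card ≤ G.maxDegree := by
    rw [G.card_neighborFinset_eq_degree]; exact G.degree_le_maxDegree v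
  have h2 := Finset.card_biUnion_le_card_mul (G.neighborFinset v) (fun w => G.neighborFinset w)
    G.maxDegree fun w _ => by rw [G.card_neighborFinset_eq_degree]; exact G.degree_le_maxDegree w
  have h3 := (Finset.card_le_card hsub).trans (Finset.card_union_le _ _)
  nlinarith

/-- The invariant of `stageOne`. -/
structure StageState (order : List (Fin n)) (done : Fin n → Bool)
    (mark : Fin n → Option (Fin n)) : Prop where
  nodup : order.Nodup
  done_iff : ∀ u, done u = false ↔ u ∈ order
  mark_done : ∀ u x, mark u = some x → done x = true

theorem isBranch_singleton {v : Fin n} {C : List (Fin n)} (hC : C.Nodup) (hv : v ∉ C) :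
    IsBranch G k [v] C := by
  refine ⟨by simp [hC, hv], ?_⟩
  have h := nonEdges_insert G (Finset.notMem_empty v)
  rw [nonEdges_empty, nonDeg, Finset.filter_empty, Finset.card_empty, insert_empty_eq] at h
  rw [List.toFinset_cons, List.toFinset_nil, insert_empty_eq, IsDefective, h]
  exact Nat.zero_le k

namespace StageState

variable {v : Fin n} {order : List (Fin n)} {done : Fin n → Bool}
  {mark : Fin n → Option (Fin n)} {nb : Fin n → List (Fin n)}

theorem mark_ne (h : StageState (v :: order) done mark) (u : Fin n) : mark u ≠ some v := by
  intro hu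
  have h1 := h.mark_done u v hu
  rw [(h.done_iff v).2 List.mem_cons_self] at h1
  simp at h1

theorem next (h : StageState (v :: order) done mark) (hnb : IsAdjLists G nb) :
    StageState order (Function.update done v true) (searchFrom nb v done mark).1 := by
  obtain ⟨-, -, h3, -⟩ := searchFrom_spec hnb (done := done) h.mark_ne
  obtain ⟨hv, hnd⟩ := List.nodup_cons.1 h.nodup
  refine ⟨hnd, fun u => ?_, fun u x hx => ?_⟩
  · by_cases e : u = v
    · subst e; simp [hv]
    · simp [e, h.done_iff]
  · by_cases e : x = v
    · subst e; simp
    · rw [Function.update_of_ne e]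
      exact h.mark_done u x ((h3 u x hx).resolve_right e)

theorem branch (h : StageState (v :: order) done mark) (hnb : IsAdjLists G nb) :
    IsBranch G k [v] (searchFrom nb v done mark).2 := by
  obtain ⟨h1, h2, -, -⟩ := searchFrom_spec hnb (done := done) h.mark_ne
  exact isBranch_singleton h1 fun hv => ((h2 v).1 hv).2.1 rfl

end StageState

theorem stageOne_cons (P : Pruning n) (piv sel : List (Fin n) → List (Fin n) → ℕ)
    (nb : Fin n → List (Fin n)) (v : Fin n) (order : List (Fin n)) (done : Fin n → Bool)
    (mark : Fin n → Option (Fin n)) (best : List (Fin n)) :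
    (stageOne G k P piv sel nb (v :: order) done mark best).val =
      (stageOne G k P piv sel nb order (Function.update done v true) (searchFrom nb v done mark).1
        (bbRec G k P piv sel ((searchFrom nb v done mark).2.length + 1) [v]
          (searchFrom nb v done mark).2 best).val).val ∧
    (stageOne G k P piv sel nb (v :: order) done mark best).steps =
      1 + ((addNew v done (nb v) mark []).steps +
        (addNbrs nb v done (nb v) (addNew v done (nb v) mark []).val.1
          (addNew v done (nb v) mark []).val.2).steps) +
      (bbRec G k P piv sel ((searchFrom nb v done mark).2.length + 1) [v]
          (searchFrom nb v done mark).2 best).steps +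
      (stageOne G k P piv sel nb order (Function.update done v true) (searchFrom nb v done mark).1
        (bbRec G k P piv sel ((searchFrom nb v done mark).2.length + 1) [v]
          (searchFrom nb v done mark).2 best).val).steps := by
  refine ⟨rfl, ?_⟩
  simp only [stageOne, Timed.steps_bind, steps_charge, searchFrom]
  ring

theorem stageOne_spec {P : Pruning n} {M : ℕ} (hP : P.Admissible G k M)
    (piv sel : List (Fin n) → List (Fin n) → ℕ) {nb : Fin n → List (Fin n)}
    (hnb : IsAdjLists G nb) (order : List (Fin n)) :
    ∀ (done : Fin n → Bool) (mark : Fin n → Option (Fin n)) (best : List (Fin n)),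
      StageState order done mark → IsFeasible G k best →
      IsFeasible G k (stageOne G k P piv sel nb order done mark best).val ∧
      best.length ≤ (stageOne G k P piv sel nb order done mark best).val.length ∧
      ∀ T : Finset (Fin n), IsDefective G k T → (∀ u ∈ T, u ∈ order) →
        (∀ u ∈ T, ∀ w ∈ T, u ≠ w → Near G u w) →
        T.card ≤ (stageOne G k P piv sel nb order done mark best).val.length := by
  induction order with
  | nil =>
    intro done mark best _ hbest
    refine ⟨hbest, le_rfl, fun T _ hT _ => ?_⟩
    rw [Finset.eq_empty_of_forall_notMem (s := T) fun u hu => by simpa using hT u hu]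
    exact Nat.zero_le _
  | cons v order ih =>
    intro done mark best h hbest
    rw [(stageOne_cons P piv sel nb v order done mark best).1]
    obtain ⟨b1, b2, b3⟩ := bbRec_spec hP piv sel _ [v] _ best (h.branch hnb) hbest
      (Nat.lt_succ_self _)
    obtain ⟨i1, i2, i3⟩ := ih _ _ _ (h.next hnb) b1
    refine ⟨i1, b2.trans i2, fun T hT hsub hnear => ?_⟩
    by_cases hv : v ∈ T
    · refine (b3 T ⟨hT, by simpa using hv, fun u hu => ?_⟩).trans i2
      by_cases e : u = v
      · simp [e]
      · have hmem := (searchFrom_spec hnb (done := done) h.mark_ne).2.1 u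
        have := hmem.2 ⟨hnear v hv u hu (Ne.symm e), e, (h.done_iff u).2 (hsub u hu)⟩
        simp [this]
    · refine i3 T hT (fun u hu => ?_) hnear
      rcases List.mem_cons.1 (hsub u hu) with rfl | h'
      · exact absurd hu hv
      · exact h'

/-- The running time of Stage I, when `F ℓ` bounds the time for the branch of a vertex that is
followed by `ℓ` others in the ordering. -/
theorem stageOne_steps_le {P : Pruning n} {M : ℕ} (hP : P.Admissible G k M)
    (piv sel : List (Fin n) → List (Fin n) → ℕ) {nb : Fin n → List (Fin n)}
    (hnb : IsAdjLists G nb) (F : ℕ → ℝ)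
    (hF : ∀ (v : Fin n) (C best : List (Fin n)) (l : ℕ), IsBranch G k [v] C →
      IsFeasible G k best → C.length ≤ l → C.length ≤ G.maxDegree ^ 2 + G.maxDegree →
      (C.filter (G.Adj v)).length ≤ degeneracy G →
      ((bbRec G k P piv sel (C.length + 1) [v] C best).steps : ℝ) ≤ F l)
    (order : List (Fin n)) :
    ∀ (done : Fin n → Bool) (mark : Fin n → Option (Fin n)) (best : List (Fin n)),
      StageState order done mark → LaterDegLE G (degeneracy G) order → IsFeasible G k best →
      ((stageOne G k P piv sel nb order done mark best).steps : ℝ) ≤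
        1 + ∑ i ∈ Finset.range order.length, (1 + ((G.maxDegree + 2 : ℕ) : ℝ) ^ 2 + F i) := by
  induction order with
  | nil => intro done mark best _ _ _; simp [stageOne]
  | cons v order ih =>
    intro done mark best h hdeg hbest
    obtain ⟨s1, s2, -, s4⟩ := searchFrom_spec hnb (done := done) h.mark_ne
    have hbr := h.branch (k := k) hnb
    obtain ⟨b1, -, -⟩ := bbRec_spec hP piv sel _ [v] _ best hbr hbest (Nat.lt_succ_self _)
    have i1 := ih _ _ _ (h.next hnb) hdeg.2 b1
    have hsub : (searchFrom nb v done mark).2 ⊆ order := by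
      intro u hu
      obtain ⟨-, h2, h3⟩ := (s2 u).1 hu
      exact (List.mem_cons.1 ((h.done_iff u).1 h3)).resolve_left h2
    have hF' := hF v (searchFrom nb v done mark).2 best order.length hbr hbest
      (List.subperm_of_subset s1 hsub).length_le
      (by
        rw [← List.toFinset_card_of_nodup s1]
        exact card_near_le G v fun u hu => ((s2 u).1 (by simpa using hu)).1)
      (le_trans (List.subperm_of_subset (s1.filter _)
        (List.filter_subset _ hsub)).length_le hdeg.1)
    rw [(stageOne_cons P piv sel nb v order done mark best).2, List.length_cons,
      Finset.sum_range_succ]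
    have s4' : (((addNew v done (nb v) mark []).steps +
        (addNbrs nb v done (nb v) (addNew v done (nb v) mark []).val.1
          (addNew v done (nb v) mark []).val.2).steps : ℕ) : ℝ) ≤
        ((G.maxDegree + 2 : ℕ) : ℝ) ^ 2 := by exact_mod_cast s4
    push_cast at s4' i1 ⊢
    linarith

/-! ### Large defective cliques -/

/-- Two vertices without a common neighbour force a non-edge at each of the other `k` vertices. -/
theorem near_of_isDefective {T : Finset (Fin n)} (hT : IsDefective G k T) (hk : k + 2 ≤ T.card)
    {x y : Fin n} (hx : x ∈ T) (hy : y ∈ T) (hxy : x ≠ y) : Near G x y := by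
  by_contra hcon
  rw [Near, not_or, not_exists] at hcon
  obtain ⟨hadj, hcom⟩ := hcon
  have hyx : y ∈ T.erase x := Finset.mem_erase.2 ⟨hxy.symm, hy⟩
  set U := (T.erase x).erase y with hU
  have hyU : y ∉ U := Finset.notMem_erase _ _
  have hxU : x ∉ insert y U := by
    rw [hU, Finset.insert_erase hyx]; exact Finset.notMem_erase _ _
  have hTU : insert x (insert y U) = T := by
    rw [hU, Finset.insert_erase hyx, Finset.insert_erase hx]
  have h1 := nonEdges_insert G hxU
  have h2 := nonEdges_insert G hyU
  have h3 := nonDeg_insert G hyU x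
  rw [if_pos ⟨hxy, hadj⟩] at h3
  have h4 : U.card ≤ nonDeg G U x + nonDeg G U y := by
    refine (Finset.card_le_card fun u hu => ?_).trans (Finset.card_union_le _ _)
    have hux : x ≠ u := by rintro rfl; exact hxU (Finset.mem_insert_of_mem hu)
    have huy : y ≠ u := by rintro rfl; exact hyU hu
    rw [Finset.mem_union, Finset.mem_filter, Finset.mem_filter]
    by_cases e : G.Adj x u
    · exact Or.inr ⟨hu, huy, fun h => hcom u ⟨e, h.symm⟩⟩
    · exact Or.inl ⟨hu, hux, e⟩
  have h5 : U.card + 2 = T.card := by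
    rw [← hTU, Finset.card_insert_of_notMem hxU, Finset.card_insert_of_notMem hyU]
  rw [hTU] at h1
  rw [IsDefective] at hT
  omega

/-- Removing a vertex with at most `degeneracy G` neighbours from a set of `s + 1` vertices removes
at least `s - degeneracy G` non-edges. -/
theorem choose_le_nonEdges (T : Finset (Fin n)) :
    (T.card - degeneracy G).choose 2 ≤ nonEdges G T := by
  induction h : T.card generalizing T with
  | zero => simp
  | succ s ih =>
    obtain ⟨v, hv, hdeg⟩ := exists_degree_le_degeneracy G
      (Finset.card_pos.1 (by omega : 0 < T.card))
    have hcard : (T.erase v).card = s := by rw [Finset.card_erase_of_mem hv, h]; rfl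
    have h1 := ih (T.erase v) hcard
    have h2 := nonEdges_insert G (Finset.notMem_erase v T)
    rw [Finset.insert_erase hv] at h2
    have h3 : s ≤ nonDeg G (T.erase v) v + degeneracy G := by
      rw [← hcard]
      refine le_trans ?_ (Nat.add_le_add_left hdeg _)
      refine (Finset.card_le_card fun u hu => ?_).trans (Finset.card_union_le _ _)
      rw [Finset.mem_union, Finset.mem_filter, Finset.mem_filter]
      by_cases e : G.Adj v u
      · exact Or.inr ⟨Finset.mem_of_mem_erase hu, e⟩
      · exact Or.inl ⟨hu, (Finset.ne_of_mem_erase hu).symm, e⟩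
    rcases Nat.lt_or_ge s (degeneracy G) with hs | hs
    · rw [Nat.choose_eq_zero_of_lt (by omega)]
      exact Nat.zero_le _
    · have h4 : (s + 1 - degeneracy G).choose 2 =
          (s - degeneracy G) + (s - degeneracy G).choose 2 := by
        rw [Nat.sub_add_comm hs, Nat.choose_succ_succ' _ 1, Nat.choose_one_right]
      omega

theorem exists_isDefective_card_eq (G : SimpleGraph (Fin n)) [DecidableRel G.Adj] (k : ℕ) :
    ∃ T : Finset (Fin n), IsDefective G k T ∧ T.card = defectiveNumber G k := by
  have hne : ((Finset.univ : Finset (Finset (Fin n))).filter (IsDefective G k)).Nonempty :=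
    ⟨∅, Finset.mem_filter.2 ⟨Finset.mem_univ _, Nat.zero_le k⟩⟩
  obtain ⟨T, hT, h⟩ := Finset.exists_mem_eq_sup _ hne Finset.card
  exact ⟨T, (Finset.mem_filter.1 hT).2, h.symm⟩

theorem defectiveNumber_le (G : SimpleGraph (Fin n)) [DecidableRel G.Adj] (k : ℕ) :
    defectiveNumber G k ≤ n :=
  Finset.sup_le fun T _ => (Finset.card_le_univ T).trans (by simp)

/-- A `k`-defective clique with at least `k + 2` vertices forces the degeneracy to be large. -/
theorem lt_two_mul_degeneracy (hk : k + 2 ≤ defectiveNumber G k) :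
    k < 2 * degeneracy G ∧ defectiveNumber G k ≤ 3 * degeneracy G := by
  obtain ⟨T, hT, hcard⟩ := exists_isDefective_card_eq G k
  have h1 := (choose_le_nonEdges (G := G) T).trans hT
  rw [hcard] at h1
  set d := degeneracy G
  set s := defectiveNumber G k
  have key : ∀ j, j ≤ s - d → j * (j - 1) ≤ 2 * k := by
    intro j hj
    have h2 := (Nat.choose_le_choose 2 hj).trans h1
    rw [Nat.choose_two_right] at h2
    have h3 := Nat.div_mul_cancel (Nat.even_mul_pred_self j).two_dvd
    omega
  have h2 : k < 2 * d := by
    by_contra! hcon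
    obtain ⟨j, rfl⟩ : ∃ j, k = d + j := ⟨k - d, by omega⟩
    have := key (j + 2) (by omega)
    simp only [show j + 2 - 1 = j + 1 by omega] at this
    have := Nat.le_mul_self j
    nlinarith
  refine ⟨h2, ?_⟩
  by_contra! hcon
  have := key (k + 2) (by omega)
  simp only [show k + 2 - 1 = k + 1 by omega] at this
  nlinarith

theorem degeneracy_le_maxDegree (G : SimpleGraph (Fin n)) [DecidableRel G.Adj] :
    degeneracy G ≤ G.maxDegree := by
  refine Nat.sInf_le fun T ⟨v, hv⟩ => ⟨v, hv, le_trans (Finset.card_le_card fun u hu => ?_)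
    ((G.card_neighborFinset_eq_degree v).le.trans (G.degree_le_maxDegree v))⟩
  simpa using (Finset.mem_filter.1 hu).2

theorem maxDegree_le (G : SimpleGraph (Fin n)) [DecidableRel G.Adj] : G.maxDegree ≤ n :=
  G.maxDegree_le_of_forall_degree_le n fun v =>
    (G.degree_lt_card_verts v).le.trans (by simp)

end

/-! ### Growth estimates -/

/-- As long as `m` is at most exponential in `k`, replacing `2` by `λ_k` costs a constant factor. -/
theorem two_pow_le_of_le {k m : ℕ} (hk : 1 ≤ k) (hm : (m : ℝ) ≤ (4 / 3) ^ k) :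
    (2 : ℝ) ^ m ≤ Real.exp 8 * lam k ^ m := by
  have h1 := four_thirds_lt_lam hk
  have h2 := lam_lt_two k
  have hpos : 0 < lam k := by linarith
  have h3 : 2 / lam k ≤ Real.exp (2 - lam k) := by
    refine le_trans ?_ (Real.add_one_le_exp _)
    rw [div_le_iff₀ hpos]
    nlinarith
  have h4 : (2 / lam k) ^ m ≤ Real.exp 8 := by
    calc (2 / lam k) ^ m ≤ Real.exp (2 - lam k) ^ m := pow_le_pow_left₀ (by positivity) h3 m
      _ = Real.exp (m * (2 - lam k)) := (Real.exp_nat_mul _ _).symm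
      _ ≤ Real.exp 8 := Real.exp_le_exp.2 <| by
        have := two_sub_lam_mul_le hk
        have := mul_le_mul_of_nonneg_right hm (by linarith : 0 ≤ 2 - lam k)
        linarith
  calc (2 : ℝ) ^ m = (2 / lam k) ^ m * lam k ^ m := by
        rw [← mul_pow, div_mul_cancel₀ _ hpos.ne']
    _ ≤ _ := mul_le_mul_of_nonneg_right h4 (by positivity)

/-- When `m` is more than exponential in `k`, the power `(m + 1) ^ (k + 2)` is quasi-polynomial
in `m`. -/
theorem eventually_pow_le :
    ∀ᶠ m : ℕ in atTop, ∀ k : ℕ, ((4 : ℝ) / 3) ^ k ≤ m →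
      ((m : ℝ) + 1) ^ (k + 2) ≤ (4 / 3) ^ (m + 1) := by
  have hc : 0 < Real.log (4 / 3) := Real.log_pos (by norm_num)
  set c := Real.log (4 / 3) with hcdef
  have h1 : (fun x : ℝ => Real.log x ^ 2 / c + 2 * Real.log x) =o[atTop] fun x : ℝ => x := by
    have e2 := (Real.isLittleO_pow_log_id_atTop (n := 2)).const_mul_left (1 / c)
    have e1 := (Real.isLittleO_pow_log_id_atTop (n := 1)).const_mul_left 2
    refine (e2.add e1).congr_left fun x => ?_
    ring
  have h2 : Tendsto (fun m : ℕ => (m : ℝ) + 1) atTop atTop :=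
    tendsto_atTop_add_const_right _ _ tendsto_natCast_atTop_atTop
  filter_upwards [h2.eventually (h1.bound hc), eventually_ge_atTop 1] with m hm hm1 k hk
  have hmpos : (0 : ℝ) < m := by exact_mod_cast hm1
  have hl0 : 0 ≤ Real.log ((m : ℝ) + 1) := Real.log_nonneg (by linarith)
  have hk' : k * c ≤ Real.log ((m : ℝ) + 1) := by
    rw [hcdef, ← Real.log_pow]
    exact Real.log_le_log (by positivity) (by linarith)
  rw [Real.norm_eq_abs, Real.norm_eq_abs, abs_of_pos (by positivity : (0 : ℝ) < m + 1)] at hm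
  have hm' := (le_abs_self _).trans hm
  rw [← Real.log_le_log_iff (by positivity) (by positivity), Real.log_pow, Real.log_pow]
  push_cast
  have hkk : (k : ℝ) * Real.log ((m : ℝ) + 1) ≤ Real.log ((m : ℝ) + 1) ^ 2 / c := by
    rw [le_div_iff₀ hc]
    nlinarith
  rw [← hcdef]
  linarith

/-- A search tree over `m` candidates in which at most `k + 1` of them can be included has
`O(λ_k ^ m)` nodes, uniformly in `k`. -/
theorem exists_nodes_le : ∃ K : ℝ, 0 ≤ K ∧ ∀ k m : ℕ, 1 ≤ k →
    min ((2 : ℝ) ^ (m + 1)) (2 * ((m : ℝ) + 1) ^ (k + 2)) ≤ K * lam k ^ m := by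
  obtain ⟨N, hN⟩ := eventually_atTop.1 eventually_pow_le
  refine ⟨2 * Real.exp 8 + 3 + 2 ^ (N + 1), by positivity, fun k m hk => ?_⟩
  have h1 := four_thirds_lt_lam hk
  have hone : 1 ≤ lam k ^ m := one_le_pow₀ (by linarith)
  have hexp := Real.exp_pos 8
  have hN0 : (0 : ℝ) < 2 ^ (N + 1) := by positivity
  rcases le_total (m : ℝ) ((4 / 3) ^ k) with hm | hm
  · refine (min_le_left _ _).trans ?_
    have := two_pow_le_of_le hk hm
    rw [pow_succ]
    nlinarith
  rcases le_total N m with hNm | hNm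
  · refine (min_le_right _ _).trans ?_
    have h2 := hN m hNm k hm
    have h3 : ((4 : ℝ) / 3) ^ m ≤ lam k ^ m := pow_le_pow_left₀ (by norm_num) h1.le m
    rw [pow_succ (4 / 3 : ℝ) m] at h2
    nlinarith
  · refine (min_le_left _ _).trans ?_
    have h2 : (2 : ℝ) ^ (m + 1) ≤ 2 ^ (N + 1) := pow_le_pow_right₀ (by norm_num) (by omega)
    nlinarith

/-- The hypothesis `d ≤ D` makes the finitely many `D` for which the polynomial exceeds
`(4 / 3) ^ D` harmless. -/
theorem exists_poly_pow_le : ∃ K : ℝ, 0 ≤ K ∧ ∀ D d : ℕ, d ≤ D →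
    (2 * ((D : ℝ) + 2) ^ 8) ^ d ≤ K * (4 / 3) ^ (D * d) := by
  have h := (isLittleO_pow_const_const_pow_of_one_lt (R := ℝ) 8
    (by norm_num : (1 : ℝ) < 4 / 3)).bound (by norm_num : (0 : ℝ) < 1 / (2 * 3 ^ 8))
  obtain ⟨N, hN⟩ := eventually_atTop.1 h
  refine ⟨1 + (2 * ((N : ℝ) + 3) ^ 8) ^ (N + 1), by positivity, fun D d hd => ?_⟩
  have hK : (0 : ℝ) ≤ (2 * ((N : ℝ) + 3) ^ 8) ^ (N + 1) := by positivity
  have hone : (1 : ℝ) ≤ (4 / 3) ^ (D * d) := one_le_pow₀ (by norm_num)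
  rcases le_total (N + 1) D with hD | hD
  · have h1 := hN D (by omega)
    rw [Real.norm_eq_abs, Real.norm_eq_abs, abs_of_nonneg (by positivity),
      abs_of_nonneg (by positivity)] at h1
    have hD1 : (1 : ℝ) ≤ D := by exact_mod_cast (by omega : 1 ≤ D)
    have h2 : ((D : ℝ) + 2) ^ 8 ≤ (3 * D) ^ 8 := pow_le_pow_left₀ (by positivity) (by linarith) 8
    rw [mul_pow] at h2
    have h3 : 2 * ((D : ℝ) + 2) ^ 8 ≤ (4 / 3) ^ D := by
      norm_num at h1 h2 ⊢
      linarith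
    rw [pow_mul]
    have h4 := pow_le_pow_left₀ (by positivity) h3 d
    have h5 : (0 : ℝ) ≤ ((4 / 3) ^ D) ^ d := by positivity
    nlinarith
  · have hDN : (D : ℝ) ≤ N + 1 := by exact_mod_cast hD
    have h1 : 2 * ((D : ℝ) + 2) ^ 8 ≤ 2 * ((N : ℝ) + 3) ^ 8 := by
      have := pow_le_pow_left₀ (by positivity) (by linarith : (D : ℝ) + 2 ≤ N + 3) 8
      linarith
    have h2 : (1 : ℝ) ≤ 2 * ((N : ℝ) + 3) ^ 8 := by
      have : (1 : ℝ) ≤ ((N : ℝ) + 3) ^ 8 := one_le_pow₀ (by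
        have : (0 : ℝ) ≤ N := Nat.cast_nonneg N
        linarith)
      linarith
    have h3 := (pow_le_pow_left₀ (by positivity) h1 d).trans
      (pow_le_pow_right₀ h2 (by omega : d ≤ N + 1))
    nlinarith

/-! ### The running time of `BBRes` -/

section

variable {n : ℕ} {G : SimpleGraph (Fin n)} [DecidableRel G.Adj] {k : ℕ}

theorem bbRes_steps (G : SimpleGraph (Fin n)) [DecidableRel G.Adj] (k : ℕ) (P : Pruning n)
    (piv sel : List (Fin n) → List (Fin n) → ℕ) (nb : Fin n → List (Fin n)) :
    (bbRes G k P piv sel nb).steps = (degeneracyOrder nb).steps + (n + 1) +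
      (stageOne G k P piv sel nb (degeneracyOrder nb).val (fun _ => false) (fun _ => none)
        []).steps +
      ((stageOne G k P piv sel nb (degeneracyOrder nb).val (fun _ => false) (fun _ => none)
        []).val.length + 1) +
      if (stageOne G k P piv sel nb (degeneracyOrder nb).val (fun _ => false) (fun _ => none)
        []).val.length < k + 1 then
        (n + 1) + (bbRec G k P piv sel (n + 1) [] (List.finRange n)
          (stageOne G k P piv sel nb (degeneracyOrder nb).val (fun _ => false) (fun _ => none)
            []).val).steps
      else 0 := by
  simp only [bbRes, Timed.steps_bind, steps_charge, lengthT_val, lengthT_steps, Timed.steps_ite,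
    Timed.steps_pure]
  simp only [add_assoc]

theorem isFeasible_nil : IsFeasible G k [] := ⟨List.nodup_nil, Nat.zero_le k⟩

theorem stageState_init {nb : Fin n → List (Fin n)} (hnb : IsAdjLists G nb) :
    StageState (degeneracyOrder nb).val (fun _ => false) (fun _ => none) := by
  obtain ⟨h1, h2, -, -⟩ := degeneracyOrder_spec hnb
  exact ⟨h1, fun u => by simp [h2 u], fun u x h => by simp at h⟩

theorem length_degeneracyOrder {nb : Fin n → List (Fin n)} (hnb : IsAdjLists G nb) :
    (degeneracyOrder nb).val.length = n := by
  obtain ⟨h1, h2, -, -⟩ := degeneracyOrder_spec hnb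
  rw [← List.toFinset_card_of_nodup h1,
    Finset.eq_univ_of_forall (s := (degeneracyOrder nb).val.toFinset) fun u => by simpa using h2 u]
  simp

/-- The branches of Stage I when there is a `k`-defective clique with at least `k + 2`
vertices. Everything is polynomial in the maximum degree, up to an exponent that is linear in the
degeneracy. -/
theorem callCost_mul_nodeBound_le (M : ℕ) (hk : k + 2 ≤ defectiveNumber G k) :
    callCost G k M (G.maxDegree ^ 2 + G.maxDegree + 2) *
        nodeBound (degeneracy G) (G.maxDegree ^ 2 + G.maxDegree) k ≤
      (4 * M + 212) * (2 * (G.maxDegree + 2) ^ 8) ^ degeneracy G := by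
  obtain ⟨h1, h2⟩ := lt_two_mul_degeneracy hk
  have h3 := degeneracy_le_maxDegree G
  set d := degeneracy G
  set D := G.maxDegree
  have hD : D ^ 2 + D + 2 ≤ (D + 2) ^ 2 := by nlinarith
  have c1 : callCost G k M (D ^ 2 + D + 2) ≤ (2 * M + 106) * ((D + 2) ^ 4) ^ d := by
    have e1 : (D ^ 2 + D + 2) ^ 2 ≤ (D + 2) ^ 4 := by
      refine (Nat.pow_le_pow_left hD 2).trans (le_of_eq ?_)
      ring
    have e2 : (D + 2) ^ 4 ≤ ((D + 2) ^ 4) ^ d := Nat.le_self_pow (by omega) _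
    have e3 : D ≤ (D + 2) ^ 4 :=
      (by omega : D ≤ D + 2).trans (Nat.le_self_pow (by norm_num) _)
    have e4 := Nat.mul_le_mul_left (2 * M + 100) (e1.trans e2)
    rw [callCost]
    calc _ ≤ (2 * M + 100) * ((D + 2) ^ 4) ^ d + 6 * ((D + 2) ^ 4) ^ d := by omega
      _ = _ := by ring
  have c2 : nodeBound d (D ^ 2 + D) k ≤ 2 * (2 * (D + 2) ^ 4) ^ d := by
    refine (Nat.sub_le _ _).trans ?_
    have e1 : (D ^ 2 + D + 1) ^ (k + 1) ≤ ((D + 2) ^ 2) ^ (2 * d) :=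
      (Nat.pow_le_pow_left (by omega) _).trans (Nat.pow_le_pow_right (by positivity) (by omega))
    calc _ ≤ 2 ^ (d + 1) * ((D + 2) ^ 2) ^ (2 * d) := Nat.mul_le_mul_left _ e1
      _ = 2 * (2 * (D + 2) ^ 4) ^ d := by
        rw [mul_pow, ← pow_mul, ← pow_mul, show 2 * (2 * d) = 4 * d by ring]; ring
  refine (Nat.mul_le_mul c1 c2).trans (le_of_eq ?_)
  rw [show 2 * (D + 2) ^ 8 = (D + 2) ^ 4 * (2 * (D + 2) ^ 4) by ring, mul_pow ((D + 2) ^ 4)]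
  ring

/-- With a `k`-defective clique of at least `k + 2` vertices, Stage II is not entered. -/
theorem bbRes_steps_le_of_large (hn : 1 ≤ n) {nb : Fin n → List (Fin n)}
    (hnb : IsAdjLists G nb) {P : Pruning n} {M : ℕ} (hP : P.Admissible G k M)
    (piv sel : List (Fin n) → List (Fin n) → ℕ) (hk : k + 2 ≤ defectiveNumber G k) :
    (bbRes G k P piv sel nb).steps ≤
      n * ((4 * M + 217) * (2 * (G.maxDegree + 2) ^ 8) ^ degeneracy G) := by
  obtain ⟨hδ, hω⟩ := lt_two_mul_degeneracy hk
  have hδΔ := degeneracy_le_maxDegree G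
  obtain ⟨-, o2, o3, o4⟩ := degeneracyOrder_spec hnb
  obtain ⟨s1, -, s3⟩ := stageOne_spec hP piv sel hnb _ _ _ _ (stageState_init hnb) isFeasible_nil
  have hX := callCost_mul_nodeBound_le M hk
  set X := callCost G k M (G.maxDegree ^ 2 + G.maxDegree + 2) *
        nodeBound (degeneracy G) (G.maxDegree ^ 2 + G.maxDegree) k
  have hst := stageOne_steps_le hP piv sel hnb (fun _ => (X : ℝ))
    (fun v C best l hbr hbest _ hC hadj => by
      have := bbRec_steps_le hP piv sel (isTreeBound_adj (k := k) v)
        (G.maxDegree ^ 2 + G.maxDegree + 2) (C.length + 1) [v] C best hbr hbest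
        (Nat.lt_succ_self _) List.mem_cons_self (by simp; omega)
      exact_mod_cast this.trans (Nat.mul_le_mul_left _ (nodeBound_mono hadj hC (Nat.sub_le _ _))))
    _ _ _ _ (stageState_init hnb) o3 isFeasible_nil
  rw [length_degeneracyOrder hnb, Finset.sum_const, Finset.card_range, nsmul_eq_mul] at hst
  have hst' := (by exact_mod_cast hst : _ ≤ 1 + n * (1 + (G.maxDegree + 2) ^ 2 + X))
  obtain ⟨T, hT, hcard⟩ := exists_isDefective_card_eq G k
  have hbig := s3 T hT (fun u _ => o2 u) fun u hu w hw hne =>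
    near_of_isDefective hT (hcard ▸ hk) hu hw hne
  have hsmall := s1.length_le
  rw [bbRes_steps, if_neg (by omega)]
  set D := G.maxDegree
  set Q := (2 * (D + 2) ^ 8) ^ degeneracy G
  have hQ : (D + 2) ^ 2 ≤ Q := by
    calc (D + 2) ^ 2 ≤ (D + 2) ^ 8 := Nat.pow_le_pow_right (by omega) (by norm_num)
      _ ≤ 2 * (D + 2) ^ 8 := by omega
      _ ≤ Q := Nat.le_self_pow (by omega) _
  have hnX : n * X ≤ n * ((4 * M + 212) * Q) := Nat.mul_le_mul_left n hX
  have hnQ : n * (5 * (D + 2) ^ 2) ≤ n * (5 * Q) :=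
    Nat.mul_le_mul_left n (Nat.mul_le_mul_left 5 hQ)
  have hrest : 7 * n + 3 * (n * D) + 3 + (n + 1) + (1 + n * (1 + (D + 2) ^ 2 + X)) + (3 * D + 1) ≤
      n * (5 * (D + 2) ^ 2) + n * X := by
    have e1 : D ≤ n * D := Nat.le_mul_of_pos_left D hn
    have e2 : 0 ≤ n * (D * D) := Nat.zero_le _
    nlinarith
  calc _ ≤ 7 * n + 3 * (n * D) + 3 + (n + 1) + (1 + n * (1 + (D + 2) ^ 2 + X)) + (3 * D + 1) := by
        omega
    _ ≤ n * (5 * Q) + n * ((4 * M + 212) * Q) := by omega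
    _ = _ := by ring

/-- The branches when all `k`-defective cliques have at most `k + 1` vertices. -/
theorem bbRec_steps_le_of_small {K : ℝ} (hK0 : 0 ≤ K) (hK : ∀ k m : ℕ, 1 ≤ k →
      min ((2 : ℝ) ^ (m + 1)) (2 * ((m : ℝ) + 1) ^ (k + 2)) ≤ K * lam k ^ m)
    {P : Pruning n} {M : ℕ} (hP : P.Admissible G k M)
    (piv sel : List (Fin n) → List (Fin n) → ℕ) (hk1 : 1 ≤ k) (hn : 1 ≤ n)
    (hk : defectiveNumber G k ≤ k + 1) {S C best : List (Fin n)} (hbr : IsBranch G k S C)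
    (hbest : IsFeasible G k best) {fuel : ℕ} (hfuel : C.length < fuel) :
    ((bbRec G k P piv sel fuel S C best).steps : ℝ) ≤
      ((8 * M + 402 : ℕ) : ℝ) * (n : ℝ) ^ 2 * K * lam k ^ C.length := by
  have hL : S.length + C.length + 1 ≤ n + 1 := by
    have := hbr.1.length_le_card
    rw [List.length_append, Fintype.card_fin] at this
    omega
  have h1 := bbRec_steps_le hP piv sel isTreeBound_two_pow (n + 1) fuel S C best hbr hbest hfuel
    trivial hL
  have h2 := bbRec_steps_le hP piv sel isTreeBound_card (n + 1) fuel S C best hbr hbest hfuel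
    trivial hL
  have h2' : nodeBound 0 C.length (defectiveNumber G k - S.length) ≤
      2 * (C.length + 1) ^ (k + 2) := by
    refine (nodeBound_mono le_rfl le_rfl (by omega : _ ≤ k + 1)).trans ((Nat.sub_le _ _).trans ?_)
    simp
  have hc : callCost G k M (n + 1) ≤ (8 * M + 402) * n ^ 2 := by
    have e1 := defectiveNumber_le G k
    have e2 : (n + 1) ^ 2 ≤ 4 * n ^ 2 := by nlinarith
    have e3 : n ≤ n ^ 2 := Nat.le_self_pow two_ne_zero n
    have e4 := Nat.mul_le_mul_left (2 * M + 100) e2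
    rw [callCost]
    calc _ ≤ (2 * M + 100) * (4 * n ^ 2) + 2 * n ^ 2 := by omega
      _ = _ := by ring
  have h3 : ((bbRec G k P piv sel fuel S C best).steps : ℝ) ≤
      (callCost G k M (n + 1) : ℝ) * 2 ^ (C.length + 1) := by
    exact_mod_cast h1.trans (Nat.mul_le_mul_left _ (Nat.sub_le _ _))
  have h4 : ((bbRec G k P piv sel fuel S C best).steps : ℝ) ≤
      (callCost G k M (n + 1) : ℝ) * (2 * ((C.length : ℝ) + 1) ^ (k + 2)) := by
    exact_mod_cast h2.trans (Nat.mul_le_mul_left _ h2')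
  have hc' : (callCost G k M (n + 1) : ℝ) ≤ ((8 * M + 402 : ℕ) : ℝ) * (n : ℝ) ^ 2 := by
    exact_mod_cast hc
  have hlam := four_thirds_lt_lam hk1
  calc _ ≤ (callCost G k M (n + 1) : ℝ) *
        min ((2 : ℝ) ^ (C.length + 1)) (2 * ((C.length : ℝ) + 1) ^ (k + 2)) := by
        rw [mul_min_of_nonneg _ _ (Nat.cast_nonneg _)]
        exact le_min h3 h4
    _ ≤ (callCost G k M (n + 1) : ℝ) * (K * lam k ^ C.length) :=
        mul_le_mul_of_nonneg_left (hK k _ hk1) (Nat.cast_nonneg _)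
    _ ≤ ((8 * M + 402 : ℕ) : ℝ) * (n : ℝ) ^ 2 * (K * lam k ^ C.length) :=
        mul_le_mul_of_nonneg_right hc' (mul_nonneg hK0 (pow_nonneg (by linarith) _))
    _ = _ := by ring

theorem bbRes_steps_le_of_small {K : ℝ} (hK0 : 0 ≤ K) (hK : ∀ k m : ℕ, 1 ≤ k →
      min ((2 : ℝ) ^ (m + 1)) (2 * ((m : ℝ) + 1) ^ (k + 2)) ≤ K * lam k ^ m)
    (hn : 1 ≤ n) {nb : Fin n → List (Fin n)} (hnb : IsAdjLists G nb) {P : Pruning n} {M : ℕ}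
    (hP : P.Admissible G k M) (piv sel : List (Fin n) → List (Fin n) → ℕ) (hk1 : 1 ≤ k)
    (hk : defectiveNumber G k ≤ k + 1) :
    ((bbRes G k P piv sel nb).steps : ℝ) ≤
      (60 + 4 * (((8 * M + 402 : ℕ) : ℝ) * K)) * ((n : ℝ) ^ 2 * lam k ^ n) := by
  obtain ⟨-, -, o3, o4⟩ := degeneracyOrder_spec hnb
  obtain ⟨s1, -, -⟩ := stageOne_spec hP piv sel hnb _ _ _ _ (stageState_init hnb) isFeasible_nil
  have hlam := four_thirds_lt_lam hk1
  have hΔ := maxDegree_le G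
  have hω := s1.length_le.trans (defectiveNumber_le G k)
  set A : ℝ := ((8 * M + 402 : ℕ) : ℝ) * (n : ℝ) ^ 2 * K with hA
  have hA0 : 0 ≤ A := by positivity
  have hst := stageOne_steps_le hP piv sel hnb (fun l => A * lam k ^ l)
    (fun v C best l hbr hbest hl _ _ =>
      (bbRec_steps_le_of_small hK0 hK hP piv sel hk1 hn hk hbr hbest (Nat.lt_succ_self _)).trans
        (mul_le_mul_of_nonneg_left (pow_le_pow_right₀ (by linarith) hl) hA0))
    _ _ _ _ (stageState_init hnb) o3 isFeasible_nil
  rw [length_degeneracyOrder hnb, Finset.sum_add_distrib, Finset.sum_const, Finset.card_range,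
    nsmul_eq_mul, ← Finset.mul_sum] at hst
  -- the branches of Stage I have fewer and fewer candidates, and form a geometric series
  have hgeom : ∑ i ∈ Finset.range n, lam k ^ i ≤ 3 * lam k ^ n := by
    have e1 := geom_sum_mul (lam k) n
    have e2 : 0 ≤ ∑ i ∈ Finset.range n, lam k ^ i :=
      Finset.sum_nonneg fun i _ => pow_nonneg (by linarith) i
    nlinarith
  have hroot : IsBranch G k [] (List.finRange n) :=
    ⟨by simpa using List.nodup_finRange n, Nat.zero_le k⟩
  have hII := bbRec_steps_le_of_small hK0 hK hP piv sel hk1 hn hk hroot s1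
    (fuel := n + 1) (by simp)
  rw [List.length_finRange, ← hA] at hII
  have hn1 : (1 : ℝ) ≤ n := by exact_mod_cast hn
  have hnlam : (n : ℝ) ≤ 3 * lam k ^ n := by
    have e1 := one_add_mul_le_pow (by norm_num : (-2 : ℝ) ≤ 1 / 3) n
    have e2 : ((1 : ℝ) + 1 / 3) ^ n ≤ lam k ^ n := pow_le_pow_left₀ (by norm_num) (by linarith) n
    linarith
  have hone : 1 ≤ lam k ^ n := one_le_pow₀ (by linarith)
  have hΔ' : (G.maxDegree : ℝ) ≤ n := by exact_mod_cast hΔ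
  have hΔ0 : (0 : ℝ) ≤ G.maxDegree := Nat.cast_nonneg _
  have o4' : ((degeneracyOrder nb).steps : ℝ) ≤ 7 * n + 3 * (n * G.maxDegree) + 3 := by
    exact_mod_cast o4
  have hω' : ((stageOne G k P piv sel nb (degeneracyOrder nb).val (fun _ => false)
      (fun _ => none) []).val.length : ℝ) ≤ n := by exact_mod_cast hω
  rw [bbRes_steps]
  set st := stageOne G k P piv sel nb (degeneracyOrder nb).val (fun _ => false) (fun _ => none) []
  have hif : (((if st.val.length < k + 1 then
        (n + 1) + (bbRec G k P piv sel (n + 1) [] (List.finRange n) st.val).steps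
      else 0 : ℕ)) : ℝ) ≤ n + 1 + A * lam k ^ n := by
    split_ifs
    · push_cast; linarith
    · push_cast; positivity
  generalize (if st.val.length < k + 1 then
    (n + 1) + (bbRec G k P piv sel (n + 1) [] (List.finRange n) st.val).steps else 0) = c at hif ⊢
  have hgeomA := mul_le_mul_of_nonneg_left hgeom hA0
  have hn2 : (1 : ℝ) ≤ (n : ℝ) ^ 2 := one_le_pow₀ hn1
  have hnn : (n : ℝ) ≤ (n : ℝ) ^ 2 := by nlinarith
  have hnΔ : (n : ℝ) * G.maxDegree ≤ (n : ℝ) ^ 2 := by nlinarith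
  have hcube : (n : ℝ) * (1 + ((G.maxDegree + 2 : ℕ) : ℝ) ^ 2) ≤
      30 * ((n : ℝ) ^ 2 * lam k ^ n) := by
    have e1 : 1 + ((G.maxDegree + 2 : ℕ) : ℝ) ^ 2 ≤ 10 * (n : ℝ) ^ 2 := by
      push_cast
      have : ((G.maxDegree : ℝ) + 2) ^ 2 ≤ (3 * n) ^ 2 :=
        pow_le_pow_left₀ (by positivity) (by linarith) 2
      nlinarith
    calc _ ≤ (n : ℝ) * (10 * (n : ℝ) ^ 2) := mul_le_mul_of_nonneg_left e1 (by positivity)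
      _ = 10 * (n : ℝ) ^ 2 * n := by ring
      _ ≤ 10 * (n : ℝ) ^ 2 * (3 * lam k ^ n) := mul_le_mul_of_nonneg_left hnlam (by positivity)
      _ = _ := by ring
  have hsq : (n : ℝ) ^ 2 ≤ (n : ℝ) ^ 2 * lam k ^ n := by nlinarith
  push_cast at hst hcube ⊢
  calc _ ≤ 30 * (n : ℝ) ^ 2 + 30 * ((n : ℝ) ^ 2 * lam k ^ n) + 4 * (A * lam k ^ n) := by linarith
    _ ≤ 60 * ((n : ℝ) ^ 2 * lam k ^ n) + 4 * (A * lam k ^ n) := by linarith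
    _ = _ := by rw [hA]; push_cast; ring

end

end Defective

theorem lemma2 :
    (∀ M : ℕ, ∃ K : ℝ, ∀ (n : ℕ) (_ : 1 ≤ n) (G : SimpleGraph (Fin n)) [DecidableRel G.Adj]
      (k : ℕ) (_ : 1 ≤ k) (nb : Fin n → List (Fin n)) (_ : Defective.IsAdjLists G nb)
      (P : Defective.Pruning n) (_ : P.Admissible G k M)
      (piv sel : List (Fin n) → List (Fin n) → ℕ),
      (k + 2 ≤ Defective.defectiveNumber G k →
        ((Defective.bbRes G k P piv sel nb).steps : ℝ) ≤
          K * (n * ((G.maxDegree * Defective.degeneracy G : ℕ) : ℝ) ^ 2 *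
            Defective.lam k ^ (G.maxDegree * Defective.degeneracy G))) ∧
      (¬ k + 2 ≤ Defective.defectiveNumber G k →
        ((Defective.bbRes G k P piv sel nb).steps : ℝ) ≤
          K * ((n : ℝ) ^ 2 * Defective.lam k ^ n))) ∧
    (∀ k : ℕ, 1 ≤ k →
      IsGreatest {x : ℝ | (Defective.lamPoly k).IsRoot x} (Defective.lam k) ∧
      IsGreatest {x : ℝ | (Defective.gamPoly k).IsRoot x} (Defective.gam k) ∧
      Defective.lam k < Defective.gam k ∧
      Defective.lam k < Defective.lam (k + 1) ∧
      Defective.gam k < Defective.gam (k + 1)) ∧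
    Tendsto Defective.lam atTop (𝓝 2) ∧
    Tendsto Defective.gam atTop (𝓝 2) := by
  refine ⟨fun M => ?_, fun k hk => ⟨Defective.lam_isGreatest k, Defective.gam_isGreatest k,
    Defective.lam_lt_gam hk, Defective.lam_lt_succ hk, Defective.gam_lt_succ hk⟩,
    Defective.tendsto_lam, Defective.tendsto_gam⟩
  obtain ⟨K₁, hK₁, h₁⟩ := Defective.exists_poly_pow_le
  obtain ⟨K₂, hK₂, h₂⟩ := Defective.exists_nodes_le
  set A : ℝ := ((4 * M + 217 : ℕ) : ℝ) * K₁ with hA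
  set B : ℝ := 60 + 4 * (((8 * M + 402 : ℕ) : ℝ) * K₂) with hB
  have hA0 : 0 ≤ A := by positivity
  have hB0 : 0 ≤ B := by positivity
  refine ⟨A + B, fun n hn G _ k hk nb hnb P hP piv sel => ⟨fun hlarge => ?_, fun hsmall => ?_⟩⟩
  · have hsteps := Defective.bbRes_steps_le_of_large hn hnb hP piv sel hlarge
    have hδ := (Defective.lt_two_mul_degeneracy hlarge).1
    have hδΔ := Defective.degeneracy_le_maxDegree G
    have hlam := Defective.four_thirds_lt_lam hk
    have hpow := h₁ G.maxDegree (Defective.degeneracy G) hδΔ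
    set E := G.maxDegree * Defective.degeneracy G
    have hE : (1 : ℝ) ≤ ((E : ℕ) : ℝ) ^ 2 := by
      refine one_le_pow₀ ?_
      exact_mod_cast Nat.mul_pos (by omega : 0 < G.maxDegree) (by omega)
    have hlE : ((4 : ℝ) / 3) ^ E ≤ Defective.lam k ^ E :=
      pow_le_pow_left₀ (by norm_num) hlam.le E
    have hl0 : 0 ≤ Defective.lam k ^ E := pow_nonneg (by linarith) E
    calc ((Defective.bbRes G k P piv sel nb).steps : ℝ)
        ≤ n * (((4 * M + 217 : ℕ) : ℝ) *
          (2 * ((G.maxDegree : ℝ) + 2) ^ 8) ^ Defective.degeneracy G) := by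
          exact_mod_cast hsteps
      _ ≤ n * (((4 * M + 217 : ℕ) : ℝ) * (K₁ * Defective.lam k ^ E)) := by
          gcongr
          exact hpow.trans (mul_le_mul_of_nonneg_left hlE hK₁)
      _ = A * (n * 1 * Defective.lam k ^ E) := by rw [hA]; ring
      _ ≤ (A + B) * (n * ((E : ℕ) : ℝ) ^ 2 * Defective.lam k ^ E) := by
          gcongr
          linarith
  · have hsteps := Defective.bbRes_steps_le_of_small hK₂ h₂ hn hnb hP piv sel hk (by omega)
    have hlam := Defective.four_thirds_lt_lam hk
    refine hsteps.trans (mul_le_mul_of_nonneg_right (by linarith) ?_)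
    exact mul_nonneg (by positivity) (pow_nonneg (by linarith) n)
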